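/- **Setting.** Consider the system $x_{t+1}=Ax_t+Bu_t+w_t$, $y_t=Cx_t+z_t$ ($t\ge 0$) with $x_t\in\mathbb R^n$, $u_t\in\mathbb R^p$, $y_t\in\mathbb R^m$, $w_t\sim\mathcal N(0,\sigma_w^2I)$, $z_t\sim\mathcal N(0,\sigma_z^2I)$, $\sigma_w,\sigma_z>0$, and $\rho(A)<1$. Let $\Sigma\succeq 0$ solve $\Sigma=A\Sigma A^\top-A\Sigma C^\top(C\Sigma C^\top+\sigma_z^2I)^{-1}C\Sigma A^\top+\sigma_w^2I$, and put $F=A\Sigma C^\top(C\Sigma C^\top+\sigma_z^2I)^{-1}$, $\bar A=A-FC$. Assume $(A,B)$ and $(A,F)$ are controllable and $(A,C)$ is observable, and $x_0\sim\mathcal N(0,\Sigma)$. The variables $x_0$, $(w_t)_t$, $(z_t)_t$ and a source of exogenous randomness $\mathcal V$ are mutually independent, and each $u_t$ is a measurable function of $\mathcal V$ and $y_0,\dots,y_t$ (open loop: of $\mathcal V$ only; closed loop: in general). $\|\cdot\|$ is the spectral norm for matrices and the Euclidean norm for vectors. Let $G^{[0]}=0$, $G^{[i]}=CA^{i-1}B$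 for $i\ge1$, and $\mathbf G(H)=[G^{[0]}\ \cdots\ G^{[H-1]}]$. **Estimation.** Fix $\lambda>0$, $d_1,d_2\ge n$ and $H_e=d_1+d_2+1$. For $t\ge H_e$ let $\phi_t=[y_{t-1}^\top\cdots y_{t-H_e}^\top\ u_{t-1}^\top\cdots u_{t-H_e}^\top]^\top$, let $V_T=\lambda I+\sum_{t=H_e}^T\phi_t\phi_t^\top$, and let $\widehat{\mathcal G}_{\mathbf y}$ minimize $\lambda\|X\|_F^2+\sum_{t=H_e}^T\|y_t-X\phi_t\|^2$ over $X\in\mathbb R^{m\times(m+p)H_e}$. Write $\widehat{\mathcal G}_{\mathbf y}=[\hat{\mathbf F}_1,\dots,\hat{\mathbf F}_{H_e},\hat{\mathbf G}_1,\dots,\hat{\mathbf G}_{H_e}]$ with $m\times m$ blocks $\hat{\mathbf F}_j$ and $m\times p$ blocks $\hat{\mathbf G}_j$. SysId is the following procedure. Form $\hat{\mathcal H}=[\mathcal H_{\hat F},\mathcal H_{\hat G}]$, where each part has $d_1$ block rows and $d_2+1$ block columns and $(j,k)$ block $\hat{\mathbf F}_{j+k-1}$, respectively $\hat{\mathbf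 G}_{j+k-1}$. Let $\hat{\mathcal H}^-$ (resp. $\hat{\mathcal H}^+$) be $\hat{\mathcal H}$ without the last (resp. first) block column of each part. Let $\hat{\mathcal N}$ be the best rank-$n$ approximation of $\hat{\mathcal H}^-$ (its top $n$ singular values kept, the others set to zero), with singular value decomposition $\hat{\mathcal N}=U\Lambda V^\top$, and put $\hat O=U\Lambda^{1/2}$, $\hat Q=[\hat Q_F,\hat Q_B]=\Lambda^{1/2}V^\top$. Then $\hat C$ is the first $m$ rows of $\hat O$, $\hat F$ the first $m$ columns of $\hat Q_F$, $\hat B$ the first $p$ columns of $\hat Q_B$, and $\hat A=\hat O^\dagger\hat{\mathcal H}^+\hat Q^\dagger+\hat F\hat C$. Finally $\widehat{\mathbf G}(H)$ is formed from $(\hat A,\hat B,\hat C)$ as $\mathbf G(H)$ is from $(A,B,C)$. **Theorem.** (i) There is $\upsilon\in(0,1)$ such that $\|P\bar AP^{-1}\|\le\upsilon$ for some invertible $P$. (ii) Fix any such $\upsilon$, and constants $\sigma_\star,c_H,c_E>0$, $\kappa\ge0$ and $q\in\mathbb N$. There are $K>0$ and $k\in\mathbb N$, depending only on these constants, $\lambda$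 and the system, such that the following holds for all $\delta\in(0,1)$, all $T$ large enough that $K(1+\log(T/\delta))^k\le\sqrt T$, all $d_1,d_2\ge n$ such that $H_e=d_1+d_2+1$ satisfies $$\frac{\log(c_HT^2\sqrt m/\sqrt\lambda)}{\log(1/\upsilon)}\le H_e\le c_E\,(1+\log(T/\delta)),$$ and every open- or closed-loop generated trajectory as above. With probability at least $1-\delta$: if the inputs are persistently exciting, $\sigma_{\min}(V_T)\ge\sigma_\star^2T$, and bounded, $\|u_t\|\le\kappa(1+\log(T/\delta))^q$ for all $t<T$, then for the estimates that SysId returns on $\widehat{\mathcal G}_{\mathbf y}$ (whatever singular value decompositions it uses) there is an invertible $S\in\mathbb R^{n\times n}$ with $\|S\|,\|S^{-1}\|\le K$ and $$\|\hat A-S^{-1}AS\|,\ \|\hat B-S^{-1}B\|,\ \|\hat C-CS\|\ \le\ \frac{K(1+\log(T/\delta))^k}{\sqrt T},$$ and moreover, simultaneously for all $H\in\mathbb N$, $$\|\widehat{\mathbf G}(H)-\mathbf G(H)\|\ \le\ \frac{K(1+\log(T/\delta))^k}{\sqrt T}.$$ -/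

import Mathlib

open MeasureTheory ProbabilityTheory Matrix
open scoped Matrix.Norms.L2Operator

noncomputable section

namespace LTI

/-! Throughout, `‖M‖` for a real matrix `M` is the spectral norm (the operator norm between
Euclidean spaces). State, output and input dimensions are `n`, `m`, `p`. -/

section System

variable {n m p : ℕ}

/-- The extended controllability matrix `[B, A B, …, A^(n-1) B]`. -/
def ctrbMatrix {q : ℕ} (A : Matrix (Fin n) (Fin n) ℝ) (B : Matrix (Fin n) (Fin q) ℝ) :
    Matrix (Fin n) (Fin n × Fin q) ℝ :=
  Matrix.of fun i c => (A ^ (c.1 : ℕ) * B) i c.2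

/-- The observability matrix with block rows `C, C A, …, C A^(n-1)`. -/
def obsvMatrix (A : Matrix (Fin n) (Fin n) ℝ) (C : Matrix (Fin m) (Fin n) ℝ) :
    Matrix (Fin n × Fin m) (Fin n) ℝ :=
  Matrix.of fun r j => (C * A ^ (r.1 : ℕ)) r.2 j

/-- `(A, B)` is controllable: the controllability matrix has full row rank. -/
def IsControllable {q : ℕ} (A : Matrix (Fin n) (Fin n) ℝ) (B : Matrix (Fin n) (Fin q) ℝ) : Prop :=
  (ctrbMatrix A B).rank = n

/-- `(A, C)` is observable: the observability matrix has full column rank. -/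
def IsObservable (A : Matrix (Fin n) (Fin n) ℝ) (C : Matrix (Fin m) (Fin n) ℝ) : Prop :=
  (obsvMatrix A C).rank = n

/-- `ρ(A) < 1`: every complex eigenvalue of `A` has modulus less than one. -/
def IsSchurStable (A : Matrix (Fin n) (Fin n) ℝ) : Prop :=
  spectralRadius ℂ (A.map (algebraMap ℝ ℂ)) < 1

/-- The steady-state innovation covariance `C Σ Cᵀ + σ_z² I`. -/
def innovCov (C : Matrix (Fin m) (Fin n) ℝ) (Sig : Matrix (Fin n) (Fin n) ℝ) (σz : ℝ) :
    Matrix (Fin m) (Fin m) ℝ :=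
  C * Sig * Cᵀ + σz ^ 2 • (1 : Matrix (Fin m) (Fin m) ℝ)

/-- `Σ` is a positive semidefinite solution of the filtering Riccati equation
`Σ = A Σ Aᵀ - A Σ Cᵀ (C Σ Cᵀ + σ_z² I)⁻¹ C Σ Aᵀ + σ_w² I`. -/
structure IsDARESolution (A : Matrix (Fin n) (Fin n) ℝ) (C : Matrix (Fin m) (Fin n) ℝ)
    (σw σz : ℝ) (Sig : Matrix (Fin n) (Fin n) ℝ) : Prop where
  posSemidef : Sig.PosSemidef
  riccati : Sig = A * Sig * Aᵀ - A * Sig * Cᵀ * (innovCov C Sig σz)⁻¹ * C * Sig * Aᵀ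
    + σw ^ 2 • (1 : Matrix (Fin n) (Fin n) ℝ)

/-- The Kalman gain `F = A Σ Cᵀ (C Σ Cᵀ + σ_z² I)⁻¹`. -/
def kalmanGain (A : Matrix (Fin n) (Fin n) ℝ) (C : Matrix (Fin m) (Fin n) ℝ)
    (Sig : Matrix (Fin n) (Fin n) ℝ) (σz : ℝ) : Matrix (Fin n) (Fin m) ℝ :=
  A * Sig * Cᵀ * (innovCov C Sig σz)⁻¹

/-- The predictor-form state matrix `Ā = A - F C`. -/
def predictorMatrix (A : Matrix (Fin n) (Fin n) ℝ) (C : Matrix (Fin m) (Fin n) ℝ)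
    (Sig : Matrix (Fin n) (Fin n) ℝ) (σz : ℝ) : Matrix (Fin n) (Fin n) ℝ :=
  A - kalmanGain A C Sig σz * C

/-- `M` is similar to a matrix of spectral norm at most `υ`. -/
def IsSimilarToContraction (M : Matrix (Fin n) (Fin n) ℝ) (υ : ℝ) : Prop :=
  ∃ P : Matrix (Fin n) (Fin n) ℝ, IsUnit P.det ∧ ‖P * M * P⁻¹‖ ≤ υ

/-- The Markov parameters `G^[0] = 0` and `G^[i] = C A^(i-1) B` for `i > 0`. -/
def markovParam (A : Matrix (Fin n) (Fin n) ℝ) (B : Matrix (Fin n) (Fin p) ℝ)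
    (C : Matrix (Fin m) (Fin n) ℝ) (i : ℕ) : Matrix (Fin m) (Fin p) ℝ :=
  if i = 0 then 0 else C * A ^ (i - 1) * B

/-- The `H`-length Markov parameters matrix `G(H) = [G^[0], G^[1], …, G^[H-1]]`. -/
def markovMatrix (A : Matrix (Fin n) (Fin n) ℝ) (B : Matrix (Fin n) (Fin p) ℝ)
    (C : Matrix (Fin m) (Fin n) ℝ) (H : ℕ) : Matrix (Fin m) (Fin H × Fin p) ℝ :=
  Matrix.of fun i c => markovParam A B C c.1 i c.2

end System

section Data

/-- Labels of the independent sources of randomness. -/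
inductive Source where
  | exo : Source
  | init : Source
  | process (t : ℕ) : Source
  | meas (t : ℕ) : Source

variable {Ω : Type*} {n m p : ℕ}

/-- The σ-algebra generated by each source: exogenous randomness `𝒱` (which the input design may
use), the initial state, the process noise `w_t` and the measurement noise `z_t`. -/
abbrev sourceSigma (𝒱 : MeasurableSpace Ω) (x0 : Ω → EuclideanSpace ℝ (Fin n))
    (w : ℕ → Ω → EuclideanSpace ℝ (Fin n)) (z : ℕ → Ω → EuclideanSpace ℝ (Fin m)) :
    Source → MeasurableSpace Ω
  | .exo => 𝒱
  | .init => MeasurableSpace.comap x0 inferInstance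
  | .process t => MeasurableSpace.comap (w t) inferInstance
  | .meas t => MeasurableSpace.comap (z t) inferInstance

/-- The information available when `u_t` is chosen: the outputs `y_0, …, y_t` and the exogenous
randomness. Past inputs are functions of these. -/
abbrev inputInfo (𝒱 : MeasurableSpace Ω) (y : ℕ → Ω → EuclideanSpace ℝ (Fin m)) (t : ℕ) :
    MeasurableSpace Ω :=
  𝒱 ⊔ ⨆ s ∈ Finset.range (t + 1), MeasurableSpace.comap (y s) inferInstance

/-- `(x, y, u)` is a trajectory of `x_{t+1} = A x_t + B u_t + w_t`, `y_t = C x_t + z_t`, with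
`x_0 ~ N(0, Σ)`, `w_t ~ N(0, σ_w² I)`, `z_t ~ N(0, σ_z² I)`, all independent of each other and of
the exogenous randomness `𝒱`. The inputs are generated in open loop (`u_t` a function of `𝒱` only)
or in closed loop (`u_t` a function of `𝒱` and of `y_0, …, y_t`). -/
structure IsTrajectory (𝒱 : MeasurableSpace Ω) {mΩ : MeasurableSpace Ω} (μ : Measure Ω)
    (A : Matrix (Fin n) (Fin n) ℝ) (B : Matrix (Fin n) (Fin p) ℝ) (C : Matrix (Fin m) (Fin n) ℝ)
    (Sig : Matrix (Fin n) (Fin n) ℝ) (σw σz : ℝ)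
    (x w : ℕ → Ω → EuclideanSpace ℝ (Fin n)) (y z : ℕ → Ω → EuclideanSpace ℝ (Fin m))
    (u : ℕ → Ω → EuclideanSpace ℝ (Fin p)) : Prop where
  exo_le : 𝒱 ≤ mΩ
  measurable_init : Measurable[mΩ] (x 0)
  measurable_process : ∀ t, Measurable[mΩ] (w t)
  measurable_meas : ∀ t, Measurable[mΩ] (z t)
  law_init : HasLaw (x 0) (multivariateGaussian 0 Sig) μ
  law_process : ∀ t, HasLaw (w t)
    (multivariateGaussian 0 (σw ^ 2 • (1 : Matrix (Fin n) (Fin n) ℝ))) μ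
  law_meas : ∀ t, HasLaw (z t)
    (multivariateGaussian 0 (σz ^ 2 • (1 : Matrix (Fin m) (Fin m) ℝ))) μ
  indep : iIndep (sourceSigma 𝒱 (x 0) w z) μ
  state : ∀ t ω, (x (t + 1) ω).ofLp
    = A *ᵥ (x t ω).ofLp + B *ᵥ (u t ω).ofLp + (w t ω).ofLp
  output : ∀ t ω, (y t ω).ofLp = C *ᵥ (x t ω).ofLp + (z t ω).ofLp
  input : ∀ t, Measurable[inputInfo 𝒱 y t] (u t)

end Data

section LeastSquares

variable {m p : ℕ}

/-- Column index of the predictor-form ARX parameters with `h` lags: `h` blocks of size `m` (acting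
on past outputs) followed by `h` blocks of size `p` (acting on past inputs). -/
abbrev ArxIdx (m p h : ℕ) : Type := (Fin h × Fin m) ⊕ (Fin h × Fin p)

/-- The regressor `φ_t = [y_{t-1}; …; y_{t-h}; u_{t-1}; …; u_{t-h}]`; used only for `h ≤ t`. -/
def regressor (h : ℕ) (y : ℕ → EuclideanSpace ℝ (Fin m)) (u : ℕ → EuclideanSpace ℝ (Fin p))
    (t : ℕ) : ArxIdx m p h → ℝ
  | .inl (k, i) => y (t - 1 - (k : ℕ)) i
  | .inr (k, i) => u (t - 1 - (k : ℕ)) i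

/-- The regularized design matrix `V_T = lam I + ∑_{t=h}^T φ_t φ_tᵀ`. -/
def designMatrix (h : ℕ) (lam : ℝ) (y : ℕ → EuclideanSpace ℝ (Fin m))
    (u : ℕ → EuclideanSpace ℝ (Fin p)) (T : ℕ) : Matrix (ArxIdx m p h) (ArxIdx m p h) ℝ :=
  lam • (1 : Matrix (ArxIdx m p h) (ArxIdx m p h) ℝ)
    + ∑ t ∈ Finset.Icc h T, Matrix.vecMulVec (regressor h y u t) (regressor h y u t)

/-- Persistence of excitation at time `T`: `σ_min(V_T) ≥ σs² T`, i.e. `V_T ⪰ σs² T I`. -/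
def PersistentlyExciting (h : ℕ) (lam σs : ℝ) (y : ℕ → EuclideanSpace ℝ (Fin m))
    (u : ℕ → EuclideanSpace ℝ (Fin p)) (T : ℕ) : Prop :=
  (designMatrix h lam y u T
    - (σs ^ 2 * (T : ℝ)) • (1 : Matrix (ArxIdx m p h) (ArxIdx m p h) ℝ)).PosSemidef

/-- The squared Frobenius norm. -/
def frobSq {α β : Type*} [Fintype α] [Fintype β] (M : Matrix α β ℝ) : ℝ :=
  ∑ i, ∑ j, M i j ^ 2

/-- The objective `lam ‖X‖_F² + ∑_{t=h}^T ‖y_t - X φ_t‖²`. -/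
def ridgeObjective (h : ℕ) (lam : ℝ) (y : ℕ → EuclideanSpace ℝ (Fin m))
    (u : ℕ → EuclideanSpace ℝ (Fin p)) (T : ℕ) (X : Matrix (Fin m) (ArxIdx m p h) ℝ) : ℝ :=
  lam * frobSq X
    + ∑ t ∈ Finset.Icc h T, ‖y t - WithLp.toLp 2 (X *ᵥ regressor h y u t)‖ ^ 2

/-- `Ghat` is a minimizer of the regularized least-squares objective. -/
def IsRidgeEstimate (h : ℕ) (lam : ℝ) (y : ℕ → EuclideanSpace ℝ (Fin m))
    (u : ℕ → EuclideanSpace ℝ (Fin p)) (T : ℕ) (Ghat : Matrix (Fin m) (ArxIdx m p h) ℝ) : Prop :=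
  ∀ X, ridgeObjective h lam y u T Ghat ≤ ridgeObjective h lam y u T X

end LeastSquares

section SysId

variable {n m p : ℕ}

/-- The block Hankel matrix `[H_F, H_G]` with `d₁` block rows and `d₂ + 1` block columns in each
part, whose `(j, k)` block is (zero-based) the block number `j + k` of the respective part of
`G`. -/
def hankel (d₁ d₂ : ℕ) (G : Matrix (Fin m) (ArxIdx m p (d₁ + d₂ + 1)) ℝ) :
    Matrix (Fin d₁ × Fin m) (ArxIdx m p (d₂ + 1)) ℝ :=
  Matrix.of fun r c => match c with
    | .inl (k, i) => G r.2 (.inl (⟨r.1 + k, by omega⟩, i))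
    | .inr (k, i) => G r.2 (.inr (⟨r.1 + k, by omega⟩, i))

/-- `H⁻`: the last block column of each of the two parts is discarded. -/
def hankelMinus (d₁ d₂ : ℕ) (G : Matrix (Fin m) (ArxIdx m p (d₁ + d₂ + 1)) ℝ) :
    Matrix (Fin d₁ × Fin m) (ArxIdx m p d₂) ℝ :=
  (hankel d₁ d₂ G).submatrix id
    (Sum.map (Prod.map Fin.castSucc id) (Prod.map Fin.castSucc id))

/-- `H⁺`: the first block column of each of the two parts is discarded. -/
def hankelPlus (d₁ d₂ : ℕ) (G : Matrix (Fin m) (ArxIdx m p (d₁ + d₂ + 1)) ℝ) :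
    Matrix (Fin d₁ × Fin m) (ArxIdx m p d₂) ℝ :=
  (hankel d₁ d₂ G).submatrix id
    (Sum.map (Prod.map Fin.succ id) (Prod.map Fin.succ id))

/-- `N` is a best approximation of `M` of rank at most `r` in Frobenius norm. Such `N` are exactly
the matrices that arise from a singular value decomposition of `M` by setting all but the top `r`
singular values to zero. -/
def IsBestRankApprox {α β : Type*} [Fintype α] [Fintype β] (r : ℕ) (M N : Matrix α β ℝ) : Prop :=
  N.rank ≤ r ∧ ∀ N' : Matrix α β ℝ, N'.rank ≤ r → frobSq (M - N) ≤ frobSq (M - N')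

/-- `N = U diag(s) Vᵀ` is a singular value decomposition with `r` (possibly zero) singular
values. -/
structure IsThinSVD {α β : Type*} [Fintype α] [Fintype β] {r : ℕ} (N : Matrix α β ℝ)
    (U : Matrix α (Fin r) ℝ) (s : Fin r → ℝ) (V : Matrix β (Fin r) ℝ) : Prop where
  left_orthonormal : Uᵀ * U = 1
  right_orthonormal : Vᵀ * V = 1
  nonneg : ∀ i, 0 ≤ s i
  antitone : Antitone s
  eq : N = U * Matrix.diagonal s * Vᵀ

/-- `X` is the Moore–Penrose inverse of `M`. -/
structure IsMoorePenroseInverse {α β : Type*} [Fintype α] [Fintype β]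
    (M : Matrix α β ℝ) (X : Matrix β α ℝ) : Prop where
  mul_mul_left : M * X * M = M
  mul_mul_right : X * M * X = X
  symm_left : (M * X)ᵀ = M * X
  symm_right : (X * M)ᵀ = X * M

/-- `(Ahat, Bhat, Chat)` is an output of the SysId procedure run on `G` with order `n` and Hankel
sizes `d₁, d₂` (for some choice of the singular value decompositions). -/
structure IsSysIdOutput (d₁ d₂ : ℕ) (G : Matrix (Fin m) (ArxIdx m p (d₁ + d₂ + 1)) ℝ)
    (Ahat : Matrix (Fin n) (Fin n) ℝ) (Bhat : Matrix (Fin n) (Fin p) ℝ)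
    (Chat : Matrix (Fin m) (Fin n) ℝ) : Prop where
  exists_steps : ∃ (N : Matrix (Fin d₁ × Fin m) (ArxIdx m p d₂) ℝ)
    (U : Matrix (Fin d₁ × Fin m) (Fin n) ℝ) (s : Fin n → ℝ) (V : Matrix (ArxIdx m p d₂) (Fin n) ℝ)
    (O : Matrix (Fin d₁ × Fin m) (Fin n) ℝ) (Q : Matrix (Fin n) (ArxIdx m p d₂) ℝ)
    (Odag : Matrix (Fin n) (Fin d₁ × Fin m) ℝ) (Qdag : Matrix (ArxIdx m p d₂) (Fin n) ℝ)
    (Fhat : Matrix (Fin n) (Fin m) ℝ) (Abar : Matrix (Fin n) (Fin n) ℝ),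
    IsBestRankApprox n (hankelMinus d₁ d₂ G) N ∧
    IsThinSVD N U s V ∧
    O = U * Matrix.diagonal (fun i => √(s i)) ∧
    Q = Matrix.diagonal (fun i => √(s i)) * Vᵀ ∧
    (∀ k : Fin d₁, (k : ℕ) = 0 → ∀ i j, Chat i j = O (k, i) j) ∧
    (∀ k : Fin d₂, (k : ℕ) = 0 → ∀ i j, Fhat i j = Q i (.inl (k, j))) ∧
    (∀ k : Fin d₂, (k : ℕ) = 0 → ∀ i j, Bhat i j = Q i (.inr (k, j))) ∧
    IsMoorePenroseInverse O Odag ∧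
    IsMoorePenroseInverse Q Qdag ∧
    Abar = Odag * hankelPlus d₁ d₂ G * Qdag ∧
    Ahat = Abar + Fhat * Chat

end SysId

end LTI

end

open LTI

/-! Part (i). The Riccati equation rearranges to the Lyapunov identity `Σ = Ā Σ Āᵀ + σw² I + σz² F
Fᵀ`. Hence `Σ` is positive definite, and conjugating by a square root of `Σ` turns `Ā` into a strict
contraction.

Part (ii) separates probability from perturbation theory. Let `x̂` be the steady-state Kalman
predictor started at `0`. Unrolling it over `h = H_e` steps gives `y_t = G₀ φ_t + C Ā^h x̂_{t-h} +
e_t`, where `G₀` has blocks `C Ā^k F` and `C Ā^k B` and `e_t` is the innovation (`residual_eq`).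
Inputs cancel in `x_t - x̂_t`, whatever feedback produces them. Since `x_0` has the stationary
covariance `Σ`, each `e_t` is exactly Gaussian and independent of `𝒱` and of `y_0, …, y_{t-1}`
(`IsTrajectory.innovation_properties`), while `φ_t` is a function of these. So each product of a
regressor coordinate and an innovation coordinate is a martingale difference, with an exponential
supermartingale (`lintegral_exp_transform_le_one`). Markov's inequality, applied once to the sum of
these exponentials and of the exponentials of all noise norms, yields one event on which everything
is logarithmically bounded (`exists_noise_event`). Excitation and boundedness of the inputs are not
part of this event; they enter path by path.

On the event the score `∑ (y_t - G₀ φ_t) φ_tᵀ - lam G₀` is of order `√T` up to logarithms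
(`exists_score_bound`): the martingale part by taking `θ = ±1/√T`, the truncation bias because the
lower bound on `H_e` makes `‖Ā^h‖ T²` bounded. Persistent excitation divides by `T`, so the ridge
estimate has error of order `1/√T` (`frobSq_sub_le_of_isRidgeEstimate`).

The rest is deterministic (`sysId_perturbation`). The Hankel matrices of `G₀` factor as
observability times controllability of `Ā`, with factors and one-sided inverses bounded uniformly in
`d₁, d₂`. A rank-`n` truncation close to such a product has balanced factors close to `O S` and `S⁻¹
Q` (`exists_changeOfBasis_of_factorization`). The Markov parameters are then controlled for all `H`
at once, because the powers of `A` are summable and this is stable under small perturbations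
(`sum_norm_pow_perturb`). -/

namespace LTI

/-! ### Spectral norm, Frobenius norm and entries. -/

section Norms

variable {α β γ : Type*} [Fintype α] [Fintype β] [Fintype γ]

lemma frobSq_nonneg (M : Matrix α β ℝ) : 0 ≤ frobSq M :=
  Finset.sum_nonneg fun _ _ => Finset.sum_nonneg fun _ _ => sq_nonneg _

lemma frobSq_sub_comm (M N : Matrix α β ℝ) : frobSq (M - N) = frobSq (N - M) := by
  unfold frobSq
  refine Finset.sum_congr rfl fun i _ => Finset.sum_congr rfl fun j _ => ?_
  simp only [Matrix.sub_apply]; ring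

lemma norm_mulVec_sq_le_frobSq (M : Matrix α β ℝ) (x : EuclideanSpace ℝ β) :
    ‖WithLp.toLp 2 (M *ᵥ x.ofLp)‖ ^ 2 ≤ frobSq M * ‖x‖ ^ 2 := by
  simp only [EuclideanSpace.real_norm_sq_eq]
  unfold frobSq
  rw [Finset.sum_mul]
  exact Finset.sum_le_sum fun i _ => Finset.sum_mul_sq_le_sq_mul_sq _ _ _

/-- A matrix whose block rows are obtained by selecting distinct columns of `D`. -/
lemma frobSq_le_of_injective {d : ℕ} {δ : Type*} [Fintype δ] {M : Matrix (Fin d × α) β ℝ}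
    {D : Matrix α δ ℝ} (f : Fin d → β → δ) (hf : ∀ r, Function.Injective (f r))
    (h : ∀ r i c, M (r, i) c = D i (f r c)) : frobSq M ≤ d * frobSq D := by
  unfold frobSq
  rw [Fintype.sum_prod_type]
  calc ∑ r : Fin d, ∑ i, ∑ c, M (r, i) c ^ 2 ≤ ∑ _r : Fin d, ∑ i, ∑ c, D i c ^ 2 := by
        refine Finset.sum_le_sum fun r _ => Finset.sum_le_sum fun i _ => ?_
        simp only [h]
        classical
        rw [← Finset.sum_image (s := Finset.univ) (g := f r) (f := fun c => D i c ^ 2)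
          (fun a _ b _ hab => hf r hab)]
        exact Finset.sum_le_sum_of_subset_of_nonneg (Finset.subset_univ _)
          fun _ _ _ => sq_nonneg _
    _ = _ := by simp

variable [DecidableEq β]

lemma norm_toLp_mulVec_le (M : Matrix α β ℝ) (x : β → ℝ) :
    ‖WithLp.toLp 2 (M *ᵥ x)‖ ≤ ‖M‖ * ‖WithLp.toLp 2 x‖ :=
  Matrix.l2_opNorm_mulVec M (WithLp.toLp 2 x)

lemma norm_le_sqrt_frobSq (M : Matrix α β ℝ) : ‖M‖ ≤ √(frobSq M) := by
  rw [Matrix.l2_opNorm_def]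
  refine ContinuousLinearMap.opNorm_le_bound _ (Real.sqrt_nonneg _) fun x => ?_
  refine Real.le_sqrt_of_sq_le (norm_mulVec_sq_le_frobSq M x) |>.trans ?_
  rw [Real.sqrt_mul (frobSq_nonneg M), Real.sqrt_sq (norm_nonneg x)]

lemma norm_le_of_frobSq_le (M : Matrix α β ℝ) {c : ℝ} (hc : 0 ≤ c) (h : frobSq M ≤ c ^ 2) :
    ‖M‖ ≤ c :=
  (norm_le_sqrt_frobSq M).trans (Real.sqrt_le_iff.2 ⟨hc, h⟩)

lemma abs_entry_le_norm (M : Matrix α β ℝ) (i : α) (j : β) : |M i j| ≤ ‖M‖ := by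
  have h := norm_toLp_mulVec_le M (Pi.single j 1)
  have h2 : ‖WithLp.toLp 2 (Pi.single j (1 : ℝ) : β → ℝ)‖ = 1 := by
    simp
  rw [h2, mul_one] at h
  refine le_trans ?_ h
  have := PiLp.norm_apply_le (WithLp.toLp 2 (M *ᵥ Pi.single j (1 : ℝ))) i
  simpa using this

lemma norm_le_of_abs_entry_le (M : Matrix α β ℝ) {c : ℝ} (hc : 0 ≤ c)
    (h : ∀ i j, |M i j| ≤ c) : ‖M‖ ≤ Fintype.card α * Fintype.card β * c := by
  refine norm_le_of_frobSq_le M (by positivity) ?_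
  have h1 : frobSq M ≤ Fintype.card α * (Fintype.card β * c ^ 2) := by
    unfold frobSq
    have : ∀ i, ∑ j, M i j ^ 2 ≤ Fintype.card β * c ^ 2 := fun i => by
      calc ∑ j, M i j ^ 2 ≤ ∑ _j : β, c ^ 2 := Finset.sum_le_sum fun j _ => by
            rw [← sq_abs]; gcongr; exact h i j
        _ = _ := by simp
    calc _ ≤ ∑ _i : α, Fintype.card β * c ^ 2 := Finset.sum_le_sum fun i _ => this i
      _ = _ := by simp
  refine h1.trans ?_
  have ha : (Fintype.card α : ℝ) ≤ (Fintype.card α : ℝ) ^ 2 := by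
    exact_mod_cast Nat.le_self_pow two_ne_zero _
  have hb : (Fintype.card β : ℝ) ≤ (Fintype.card β : ℝ) ^ 2 := by
    exact_mod_cast Nat.le_self_pow two_ne_zero _
  calc (Fintype.card α : ℝ) * (Fintype.card β * c ^ 2)
      ≤ (Fintype.card α : ℝ) ^ 2 * ((Fintype.card β : ℝ) ^ 2 * c ^ 2) := by gcongr
    _ = _ := by ring

lemma frobSq_le_card_mul_norm_sq (M : Matrix α β ℝ) :
    frobSq M ≤ Fintype.card α * Fintype.card β * ‖M‖ ^ 2 := by
  unfold frobSq
  calc ∑ i, ∑ j, M i j ^ 2 ≤ ∑ _i : α, ∑ _j : β, ‖M‖ ^ 2 :=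
        Finset.sum_le_sum fun i _ => Finset.sum_le_sum fun j _ => by
          rw [← sq_abs]; gcongr; exact abs_entry_le_norm M i j
    _ = _ := by simp; ring

/-- Only an inequality, since the norm is `0` when the index type is empty; the dimensions `n`, `m`,
`p` are allowed to vanish. -/
lemma norm_one_le_one : ‖(1 : Matrix β β ℝ)‖ ≤ 1 := by
  rw [Matrix.l2_opNorm_def]
  refine ContinuousLinearMap.opNorm_le_bound _ zero_le_one fun x => ?_
  rw [one_mul]
  apply le_of_eq
  congr 1
  ext i
  simp

lemma norm_le_one_of_orthonormal (U : Matrix α β ℝ) (h : Uᵀ * U = 1) : ‖U‖ ≤ 1 := by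
  have h1 := Matrix.l2_opNorm_conjTranspose_mul_self U
  rw [Matrix.conjTranspose_eq_transpose_of_trivial, h] at h1
  have h2 : ‖(1 : Matrix β β ℝ)‖ ≤ 1 := norm_one_le_one
  nlinarith [norm_nonneg U]

lemma norm_transpose_eq [DecidableEq α] (M : Matrix α β ℝ) : ‖Mᵀ‖ = ‖M‖ := by
  rw [← Matrix.conjTranspose_eq_transpose_of_trivial, Matrix.l2_opNorm_conjTranspose]

lemma l2_norm_mul_le_of_le [DecidableEq γ] {M : Matrix α β ℝ} {N : Matrix β γ ℝ} {a b : ℝ}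
    (hM : ‖M‖ ≤ a) (hN : ‖N‖ ≤ b) : ‖M * N‖ ≤ a * b :=
  (Matrix.l2_opNorm_mul M N).trans
    (mul_le_mul hM hN (norm_nonneg _) ((norm_nonneg _).trans hM))

lemma norm_diagonal_le {s : β → ℝ} {c : ℝ} (hc : 0 ≤ c) (h : ∀ i, |s i| ≤ c) :
    ‖(Matrix.diagonal s : Matrix β β ℝ)‖ ≤ c := by
  rw [Matrix.l2_opNorm_diagonal]
  exact (pi_norm_le_iff_of_nonneg hc).2 h

end Norms

/-! ### Perturbation theory of the balanced rank-`n` factorization. -/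

section Realization

variable {α β : Type*} [Fintype α] [Fintype β] {n : ℕ}

/-- Neumann series for invertibility; then `W⁻¹ = 1 - (W - 1) W⁻¹` bounds `‖W⁻¹‖` by `1 + ‖W⁻¹‖ /
2`. -/
lemma isUnit_det_of_norm_sub_one_le {W : Matrix (Fin n) (Fin n) ℝ} (h : ‖W - 1‖ ≤ 1 / 2) :
    IsUnit W.det ∧ ‖W⁻¹‖ ≤ 2 := by
  have hu : IsUnit W := by
    have := isUnit_one_sub_of_norm_lt_one (x := 1 - W)
      (by rw [← norm_neg, neg_sub]; linarith)
    simpa using this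
  have hd : IsUnit W.det := (Matrix.isUnit_iff_isUnit_det W).1 hu
  refine ⟨hd, ?_⟩
  have h1 : W⁻¹ = 1 - (W - 1) * W⁻¹ := by
    rw [Matrix.sub_mul, Matrix.mul_nonsing_inv _ hd, Matrix.one_mul]; abel
  have h2 : ‖W⁻¹‖ ≤ 1 + 1 / 2 * ‖W⁻¹‖ := by
    calc ‖W⁻¹‖ = ‖1 - (W - 1) * W⁻¹‖ := by rw [← h1]
      _ ≤ ‖(1 : Matrix (Fin n) (Fin n) ℝ)‖ + ‖(W - 1) * W⁻¹‖ := norm_sub_le _ _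
      _ ≤ 1 + 1 / 2 * ‖W⁻¹‖ := add_le_add norm_one_le_one (l2_norm_mul_le_of_le h le_rfl)
  linarith

/-- The Moore–Penrose inverse of a factor `U diag(a)` with `U` orthonormal and `a` nonzero. -/
lemma IsMoorePenroseInverse.eq_of_orthonormal {U : Matrix α (Fin n) ℝ} {a : Fin n → ℝ}
    (hU : Uᵀ * U = 1) (ha : ∀ i, a i ≠ 0) {X : Matrix (Fin n) α ℝ}
    (hX : IsMoorePenroseInverse (U * Matrix.diagonal a) X) :
    X = Matrix.diagonal (fun i => (a i)⁻¹) * Uᵀ := by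
  have hda : Matrix.diagonal (fun i => (a i)⁻¹) * Matrix.diagonal a
      = (1 : Matrix (Fin n) (Fin n) ℝ) := by
    rw [Matrix.diagonal_mul_diagonal, ← Matrix.diagonal_one]
    congr 1; ext i; exact inv_mul_cancel₀ (ha i)
  set O := U * Matrix.diagonal a with hO
  have hL : (Matrix.diagonal (fun i => (a i)⁻¹) * Uᵀ) * O = 1 := by
    rw [hO, Matrix.mul_assoc, ← Matrix.mul_assoc Uᵀ, hU, Matrix.one_mul, hda]
  have hXO : X * O = 1 := by
    calc X * O = ((Matrix.diagonal (fun i => (a i)⁻¹) * Uᵀ) * O) * (X * O) := by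
          rw [hL, Matrix.one_mul]
      _ = (Matrix.diagonal (fun i => (a i)⁻¹) * Uᵀ) * (O * X * O) := by
          simp only [Matrix.mul_assoc]
      _ = 1 := by rw [hX.mul_mul_left, hL]
  have hOt : Oᵀ * O = Matrix.diagonal a * Matrix.diagonal a := by
    rw [hO, Matrix.transpose_mul, Matrix.diagonal_transpose, Matrix.mul_assoc,
      ← Matrix.mul_assoc Uᵀ, hU, Matrix.one_mul]
  have h1 : Oᵀ * O * X = Oᵀ := by
    rw [Matrix.mul_assoc, ← hX.symm_left, ← Matrix.transpose_mul, hX.mul_mul_left]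
  have h2 : Oᵀ = Matrix.diagonal a * Uᵀ := by
    rw [hO, Matrix.transpose_mul, Matrix.diagonal_transpose]
  rw [hOt, h2] at h1
  have h3 : X = (Matrix.diagonal (fun i => (a i)⁻¹) * Matrix.diagonal (fun i => (a i)⁻¹)) *
      (Matrix.diagonal a * Matrix.diagonal a * X) := by
    rw [← Matrix.mul_assoc, Matrix.mul_assoc (Matrix.diagonal fun i => (a i)⁻¹),
      ← Matrix.mul_assoc (Matrix.diagonal fun i => (a i)⁻¹) (Matrix.diagonal a), hda,
      Matrix.one_mul, hda, Matrix.one_mul]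
  rw [h3, h1, Matrix.mul_assoc, ← Matrix.mul_assoc (Matrix.diagonal fun i => (a i)⁻¹)
    (Matrix.diagonal a), hda, Matrix.one_mul]

lemma IsMoorePenroseInverse.transpose {M : Matrix α β ℝ} {X : Matrix β α ℝ}
    (h : IsMoorePenroseInverse M X) : IsMoorePenroseInverse Mᵀ Xᵀ where
  mul_mul_left := by
    rw [← Matrix.transpose_mul, ← Matrix.transpose_mul, ← Matrix.mul_assoc, h.mul_mul_left]
  mul_mul_right := by
    rw [← Matrix.transpose_mul, ← Matrix.transpose_mul, ← Matrix.mul_assoc, h.mul_mul_right]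
  symm_left := by rw [← Matrix.transpose_mul, h.symm_right, h.symm_right]
  symm_right := by rw [← Matrix.transpose_mul, h.symm_left, h.symm_left]

variable [DecidableEq α] [DecidableEq β]

/-- `Od` and `Qd` are exact one-sided inverses of the estimated factors, and `O M₀ Q = (Oh - E1) M
(Qh - E2)` with `M = S⁻¹ M₀ S`. Hence compressing `O M₀ Q` gives `(1 - Od E1) M (1 - E2 Qd)`, and
the error consists of the compressed Hankel error, two terms linear in `E1`, `E2`, and one product.
The power `c ^ 13` comes from the product term. -/
lemma norm_shift_sub_le {c η : ℝ} (hc : 1 ≤ c) (hη : 0 ≤ η) (hη1 : η ≤ 1 / 4)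
    {O Oh : Matrix α (Fin n) ℝ} {Q Qh : Matrix (Fin n) β ℝ} {M₀ S : Matrix (Fin n) (Fin n) ℝ}
    {Od : Matrix (Fin n) α ℝ} {Qd : Matrix β (Fin n) ℝ} {Hp : Matrix α β ℝ}
    (hSS' : S * S⁻¹ = 1) (hHp : ‖Hp - O * M₀ * Q‖ ≤ η) (hOdO : Od * Oh = 1) (hQQd : Qh * Qd = 1)
    (hOdn : ‖Od‖ ≤ 2 * c) (hQdn : ‖Qd‖ ≤ 2 * c) (hMn : ‖S⁻¹ * M₀ * S‖ ≤ 8 * c ^ 5)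
    (hE1 : ‖Oh - O * S‖ ≤ 8 * c ^ 3 * η) (hE2 : ‖Qh - S⁻¹ * Q‖ ≤ 8 * c ^ 3 * η) :
    ‖Od * Hp * Qd - S⁻¹ * M₀ * S‖ ≤ 2400 * c ^ 13 * η := by
  set M := S⁻¹ * M₀ * S with hM
  set E1 := Oh - O * S with hE1d
  set E2 := Qh - S⁻¹ * Q with hE2d
  have h0 : O * M₀ * Q = (Oh - E1) * M * (Qh - E2) := by
    have e1 : Oh - E1 = O * S := by rw [hE1d]; abel
    have e2 : Qh - E2 = S⁻¹ * Q := by rw [hE2d]; abel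
    rw [e1, e2, hM]
    calc O * M₀ * Q = O * (S * S⁻¹) * M₀ * (S * S⁻¹) * Q := by
          rw [hSS', Matrix.mul_one, Matrix.mul_one]
      _ = _ := by simp only [Matrix.mul_assoc]
  have h1 : Od * Hp * Qd - M = Od * (Hp - O * M₀ * Q) * Qd - Od * E1 * M - M * (E2 * Qd)
      + Od * E1 * M * (E2 * Qd) := by
    have h2 : Od * (O * M₀ * Q) * Qd = M - Od * E1 * M - M * (E2 * Qd)
        + Od * E1 * M * (E2 * Qd) := by
      rw [h0]
      calc Od * ((Oh - E1) * M * (Qh - E2)) * Qd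
          = (Od * Oh - Od * E1) * M * (Qh * Qd - E2 * Qd) := by
            simp only [Matrix.mul_assoc, Matrix.mul_sub, Matrix.sub_mul]
        _ = _ := by
            rw [hOdO, hQQd]
            simp only [Matrix.mul_sub, Matrix.sub_mul, Matrix.one_mul, Matrix.mul_one]
            abel
    have h3 : Od * (Hp - O * M₀ * Q) * Qd = Od * Hp * Qd - Od * (O * M₀ * Q) * Qd := by
      rw [Matrix.mul_sub, Matrix.sub_mul]
    rw [h3, h2]; abel
  rw [h1]
  have b1 : ‖Od * E1‖ ≤ 16 * c ^ 4 * η :=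
    (l2_norm_mul_le_of_le hOdn hE1).trans (le_of_eq (by ring))
  have b2 : ‖E2 * Qd‖ ≤ 16 * c ^ 4 * η :=
    (l2_norm_mul_le_of_le hE2 hQdn).trans (le_of_eq (by ring))
  have t1 : ‖Od * (Hp - O * M₀ * Q) * Qd‖ ≤ 2 * c * η * (2 * c) :=
    l2_norm_mul_le_of_le (l2_norm_mul_le_of_le hOdn hHp) hQdn
  have t2 : ‖Od * E1 * M‖ ≤ 16 * c ^ 4 * η * (8 * c ^ 5) := l2_norm_mul_le_of_le b1 hMn
  have t3 : ‖M * (E2 * Qd)‖ ≤ 8 * c ^ 5 * (16 * c ^ 4 * η) := l2_norm_mul_le_of_le hMn b2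
  have t4 : ‖Od * E1 * M * (E2 * Qd)‖ ≤ 16 * c ^ 4 * η * (8 * c ^ 5) * (16 * c ^ 4 * η) :=
    l2_norm_mul_le_of_le t2 b2
  have hp2 : c ^ 2 * η ≤ c ^ 13 * η :=
    mul_le_mul_of_nonneg_right (pow_le_pow_right₀ hc (by norm_num)) hη
  have hp9 : c ^ 9 * η ≤ c ^ 13 * η :=
    mul_le_mul_of_nonneg_right (pow_le_pow_right₀ hc (by norm_num)) hη
  have hp13 : c ^ 13 * η * η ≤ c ^ 13 * η := by
    have : 0 ≤ c ^ 13 * η := by positivity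
    nlinarith
  calc _ ≤ 2 * c * η * (2 * c) + 16 * c ^ 4 * η * (8 * c ^ 5) + 8 * c ^ 5 * (16 * c ^ 4 * η)
        + 16 * c ^ 4 * η * (8 * c ^ 5) * (16 * c ^ 4 * η) := by
        refine (norm_add_le _ _).trans (add_le_add ((norm_sub_le _ _).trans (add_le_add
          ((norm_sub_le _ _).trans (add_le_add t1 t2)) t3)) t4)
    _ = 4 * (c ^ 2 * η) + 256 * (c ^ 9 * η) + 2048 * (c ^ 13 * η * η) := by ring
    _ ≤ 4 * (c ^ 13 * η) + 256 * (c ^ 13 * η) + 2048 * (c ^ 13 * η) := by linarith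
    _ ≤ _ := by
        have : 0 ≤ c ^ 13 * η := by positivity
        linarith

set_option maxHeartbeats 1000000 in
/-- Perturbation bound for the Ho–Kalman factorization: the balanced factors of a near-best
rank-`n` approximation of `O * Q` are close to the factors `O S`, `S⁻¹ Q` for a well-conditioned
change of basis `S`. -/
lemma exists_changeOfBasis_of_factorization {c η : ℝ} (hc : 1 ≤ c) (hη : 0 ≤ η)
    (hsmall : 4 * c ^ 2 * η ≤ 1)
    {O : Matrix α (Fin n) ℝ} {Q : Matrix (Fin n) β ℝ} {L : Matrix (Fin n) α ℝ}
    {R : Matrix β (Fin n) ℝ} {M₀ : Matrix (Fin n) (Fin n) ℝ}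
    (hLO : L * O = 1) (hQR : Q * R = 1)
    (hO : ‖O‖ ≤ c) (hQ : ‖Q‖ ≤ c) (hL : ‖L‖ ≤ c) (hR : ‖R‖ ≤ c) (hM₀ : ‖M₀‖ ≤ c)
    {Hm Hp N : Matrix α β ℝ} (hHm : frobSq (Hm - O * Q) ≤ η ^ 2)
    (hHp : ‖Hp - O * M₀ * Q‖ ≤ η)
    (hN : IsBestRankApprox n Hm N)
    {U : Matrix α (Fin n) ℝ} {s : Fin n → ℝ} {V : Matrix β (Fin n) ℝ} (hsvd : IsThinSVD N U s V)
    {Oh : Matrix α (Fin n) ℝ} {Qh : Matrix (Fin n) β ℝ}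
    (hOh : Oh = U * Matrix.diagonal (fun i => √(s i)))
    (hQh : Qh = Matrix.diagonal (fun i => √(s i)) * Vᵀ)
    {Od : Matrix (Fin n) α ℝ} {Qd : Matrix β (Fin n) ℝ}
    (hOd : IsMoorePenroseInverse Oh Od) (hQd : IsMoorePenroseInverse Qh Qd) :
    ∃ S : Matrix (Fin n) (Fin n) ℝ, IsUnit S.det ∧ ‖S‖ ≤ 2 * c ^ 2 ∧ ‖S⁻¹‖ ≤ 4 * c ^ 2 ∧
      ‖Oh - O * S‖ ≤ 8 * c ^ 3 * η ∧ ‖Qh - S⁻¹ * Q‖ ≤ 8 * c ^ 3 * η ∧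
      ‖Od * Hp * Qd - S⁻¹ * M₀ * S‖ ≤ 2400 * c ^ 13 * η := by
  have hc0 : (0 : ℝ) ≤ c := by linarith
  have hc1 : (1 : ℝ) ≤ c ^ 2 := one_le_pow₀ hc
  have hη1 : η ≤ 1 / 4 := by nlinarith
  set D := N - O * Q with hD
  -- `O * Q` has rank at most `n`, hence competes with `N`: both are within `η` of `Hm`.
  have hDn : ‖D‖ ≤ 2 * η := by
    have h1 : frobSq (Hm - N) ≤ frobSq (Hm - O * Q) := by
      apply hN.2
      exact (Matrix.rank_mul_le_left O Q).trans (by simpa using Matrix.rank_le_card_width O)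
    have h2 : ‖N - Hm‖ ≤ η :=
      norm_le_of_frobSq_le _ hη (by rw [frobSq_sub_comm]; exact h1.trans hHm)
    have h3 : ‖Hm - O * Q‖ ≤ η := norm_le_of_frobSq_le _ hη hHm
    calc ‖D‖ = ‖(N - Hm) + (Hm - O * Q)‖ := by rw [hD]; congr 1; abel
      _ ≤ ‖N - Hm‖ + ‖Hm - O * Q‖ := norm_add_le _ _
      _ ≤ 2 * η := by linarith
  have hNeq : N = O * Q + D := by rw [hD]; abel
  have hsqrt : Matrix.diagonal (fun i => √(s i)) * Matrix.diagonal (fun i => √(s i))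
      = Matrix.diagonal s := by
    rw [Matrix.diagonal_mul_diagonal]; congr 1; ext i; exact Real.mul_self_sqrt (hsvd.nonneg i)
  have hNf : N = Oh * Qh := by
    rw [hsvd.eq, hOh, hQh, ← hsqrt]; simp only [Matrix.mul_assoc]
  -- the compressed approximant is close to the identity
  set W := L * N * R with hW
  have hWeq : W - 1 = L * D * R := by
    rw [hW, hNeq, Matrix.mul_add, Matrix.add_mul, ← Matrix.mul_assoc, hLO, Matrix.one_mul, hQR]
    abel
  have hW1 : ‖W - 1‖ ≤ 1 / 2 := by
    rw [hWeq]
    refine (l2_norm_mul_le_of_le (l2_norm_mul_le_of_le hL hDn) hR).trans ?_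
    nlinarith
  obtain ⟨hWu, hWi⟩ := isUnit_det_of_norm_sub_one_le hW1
  -- Choice of basis: if the estimate were exactly `Oh = O S`, applying `L` would return `S`. Since
  -- `N = Oh Qh`, the near-identity matrix `W` equals `S (Qh R)`, which gives the invertibility of
  -- `S` and its inverse explicitly.
  set S := L * Oh with hS
  have hWS : W = S * (Qh * R) := by rw [hW, hNf, hS]; simp only [Matrix.mul_assoc]
  have hSinv : S * (Qh * R * W⁻¹) = 1 := by
    rw [← Matrix.mul_assoc, ← hWS, Matrix.mul_nonsing_inv _ hWu]
  have hSu : IsUnit S.det := Matrix.isUnit_det_of_right_inverse hSinv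
  have hSeq : S⁻¹ = Qh * R * W⁻¹ := Matrix.inv_eq_right_inv hSinv
  have hSS : S⁻¹ * S = 1 := Matrix.nonsing_inv_mul _ hSu
  have hSS' : S * S⁻¹ = 1 := Matrix.mul_nonsing_inv _ hSu
  have hUn : ‖U‖ ≤ 1 := norm_le_one_of_orthonormal U hsvd.left_orthonormal
  have hUt : ‖Uᵀ‖ ≤ 1 := by rwa [norm_transpose_eq]
  have hVn : ‖Vᵀ‖ ≤ 1 := by
    rw [norm_transpose_eq]; exact norm_le_one_of_orthonormal V hsvd.right_orthonormal
  -- the singular values are bounded above and away from zero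
  have hslow : ∀ i, 1 ≤ s i * (2 * c ^ 2) := by
    intro i
    -- Both factors are square, so they commute and `diagonal s` can be moved to the front; a
    -- diagonal entry of the resulting inverse then bounds `1 / s i`.
    have h1 : (L * U) * (Matrix.diagonal s * (Vᵀ * R * W⁻¹)) = 1 := by
      rw [← Matrix.mul_nonsing_inv _ hWu, hW, hsvd.eq]; simp only [Matrix.mul_assoc]
    have h2 : Matrix.diagonal s * ((Vᵀ * R * W⁻¹) * (L * U)) = 1 := by
      rw [← Matrix.mul_assoc]; exact mul_eq_one_comm.1 (by simpa only [Matrix.mul_assoc] using h1)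
    have h3 : s i * ((Vᵀ * R * W⁻¹) * (L * U)) i i = 1 := by
      rw [← Matrix.diagonal_mul, h2, Matrix.one_apply_eq]
    have h4 : ‖(Vᵀ * R * W⁻¹) * (L * U)‖ ≤ (1 * c * 2) * (c * 1) :=
      l2_norm_mul_le_of_le (l2_norm_mul_le_of_le (l2_norm_mul_le_of_le hVn hR) hWi)
        (l2_norm_mul_le_of_le hL hUn)
    have h5 := (le_abs_self _).trans ((abs_entry_le_norm _ i i).trans h4)
    calc (1 : ℝ) = s i * ((Vᵀ * R * W⁻¹) * (L * U)) i i := h3.symm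
      _ ≤ s i * ((1 * c * 2) * (c * 1)) := mul_le_mul_of_nonneg_left h5 (hsvd.nonneg i)
      _ = _ := by ring
  have hspos : ∀ i, 0 < s i := fun i => by
    rcases (hsvd.nonneg i).lt_or_eq with h | h
    · exact h
    · have := hslow i; rw [← h] at this; norm_num at this
  have hNn : ‖N‖ ≤ 2 * c ^ 2 := by
    rw [hNeq]
    calc ‖O * Q + D‖ ≤ c * c + 2 * η :=
          (norm_add_le _ _).trans (add_le_add (l2_norm_mul_le_of_le hO hQ) hDn)
      _ ≤ _ := by nlinarith
  have hsup : ∀ i, s i ≤ 2 * c ^ 2 := fun i => by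
    have h1 : Uᵀ * N * V = Matrix.diagonal s := by
      rw [hsvd.eq]
      calc Uᵀ * (U * Matrix.diagonal s * Vᵀ) * V
          = (Uᵀ * U) * Matrix.diagonal s * (Vᵀ * V) := by simp only [Matrix.mul_assoc]
        _ = _ := by rw [hsvd.left_orthonormal, hsvd.right_orthonormal, Matrix.one_mul,
                Matrix.mul_one]
    have h2 : ‖Uᵀ * N * V‖ ≤ 1 * (2 * c ^ 2) * 1 :=
      l2_norm_mul_le_of_le (l2_norm_mul_le_of_le hUt hNn)
        (norm_le_one_of_orthonormal V hsvd.right_orthonormal)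
    have h3 := (le_abs_self _).trans ((abs_entry_le_norm _ i i).trans h2)
    rw [h1, Matrix.diagonal_apply_eq] at h3
    linarith
  have hd1 : ‖(Matrix.diagonal (fun i => √(s i)) : Matrix (Fin n) (Fin n) ℝ)‖ ≤ 2 * c := by
    refine norm_diagonal_le (by positivity) fun i => ?_
    rw [abs_of_nonneg (Real.sqrt_nonneg _)]
    refine Real.sqrt_le_iff.2 ⟨by positivity, (hsup i).trans ?_⟩
    nlinarith
  have hd2 : ‖(Matrix.diagonal (fun i => (√(s i))⁻¹) : Matrix (Fin n) (Fin n) ℝ)‖ ≤ 2 * c := by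
    refine norm_diagonal_le (by positivity) fun i => ?_
    rw [abs_of_nonneg (inv_nonneg.2 (Real.sqrt_nonneg _)), ← Real.sqrt_inv]
    refine Real.sqrt_le_iff.2 ⟨by positivity, ?_⟩
    rw [inv_le_iff_one_le_mul₀ (hspos i)]
    have := hslow i; have := hspos i; nlinarith [mul_nonneg (sq_nonneg c) (hspos i).le]
  have hne : ∀ i, √(s i) ≠ 0 := fun i => (Real.sqrt_pos.2 (hspos i)).ne'
  have hOhn : ‖Oh‖ ≤ 2 * c := by
    rw [hOh]; exact (l2_norm_mul_le_of_le hUn hd1).trans (by linarith)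
  have hQhn : ‖Qh‖ ≤ 2 * c := by
    rw [hQh]; exact (l2_norm_mul_le_of_le hd1 hVn).trans (by linarith)
  have hcancel : Matrix.diagonal (fun i => (√(s i))⁻¹) * Matrix.diagonal (fun i => √(s i))
      = (1 : Matrix (Fin n) (Fin n) ℝ) := by
    rw [Matrix.diagonal_mul_diagonal, ← Matrix.diagonal_one]
    congr 1; ext i; exact inv_mul_cancel₀ (hne i)
  have hOdeq : Od = Matrix.diagonal (fun i => (√(s i))⁻¹) * Uᵀ :=
    IsMoorePenroseInverse.eq_of_orthonormal hsvd.left_orthonormal hne (by rwa [← hOh])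
  have hQdeq : Qd = V * Matrix.diagonal (fun i => (√(s i))⁻¹) := by
    have h1 := hQd.transpose
    rw [hQh, Matrix.transpose_mul, Matrix.transpose_transpose, Matrix.diagonal_transpose] at h1
    have h2 := IsMoorePenroseInverse.eq_of_orthonormal hsvd.right_orthonormal hne h1
    rw [← Matrix.transpose_transpose Qd, h2, Matrix.transpose_mul, Matrix.transpose_transpose,
      Matrix.diagonal_transpose]
  have hOdO : Od * Oh = 1 := by
    rw [hOdeq, hOh, Matrix.mul_assoc, ← Matrix.mul_assoc Uᵀ, hsvd.left_orthonormal,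
      Matrix.one_mul, hcancel]
  have hQQd : Qh * Qd = 1 := by
    refine Matrix.transpose_injective ?_
    rw [hQdeq, hQh, Matrix.transpose_one, Matrix.transpose_mul, Matrix.transpose_mul,
      Matrix.transpose_mul, Matrix.transpose_transpose, Matrix.diagonal_transpose,
      Matrix.diagonal_transpose, Matrix.mul_assoc, ← Matrix.mul_assoc Vᵀ,
      hsvd.right_orthonormal, Matrix.one_mul, hcancel]
  have hOdn : ‖Od‖ ≤ 2 * c := by
    rw [hOdeq]
    exact (l2_norm_mul_le_of_le hd2 hUt).trans (by linarith)
  have hQdn : ‖Qd‖ ≤ 2 * c := by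
    rw [hQdeq]
    exact (l2_norm_mul_le_of_le (norm_le_one_of_orthonormal V hsvd.right_orthonormal)
      hd2).trans (by linarith)
  have hSn : ‖S‖ ≤ 2 * c ^ 2 := (l2_norm_mul_le_of_le hL hOhn).trans (le_of_eq (by ring))
  have hSin : ‖S⁻¹‖ ≤ 4 * c ^ 2 := by
    rw [hSeq]
    exact (l2_norm_mul_le_of_le (l2_norm_mul_le_of_le hQhn hR) hWi).trans (le_of_eq (by ring))
  -- `Oh = N Qd` and `O S = O L N Qd`; as `O L` fixes `O Q`, only the part of `N` coming from `D`
  -- survives. In the same way `S Qh = L N = Q + L D` gives the error of `Qh`.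
  have hE1eq : Oh - O * S = (D - O * (L * D)) * Qd := by
    have h1 : Oh = N * Qd := by rw [hNf, Matrix.mul_assoc, hQQd, Matrix.mul_one]
    have h2 : O * S = O * (L * N) * Qd := by
      rw [hS]; conv_lhs => rw [h1]
      simp only [Matrix.mul_assoc]
    rw [h2, h1, ← Matrix.sub_mul]
    congr 1
    rw [hNeq, Matrix.mul_add, Matrix.mul_add, ← Matrix.mul_assoc L, hLO, Matrix.one_mul]
    abel
  have hE1 : ‖Oh - O * S‖ ≤ 8 * c ^ 3 * η := by
    rw [hE1eq]
    have h1 : ‖D - O * (L * D)‖ ≤ 2 * η + c * (c * (2 * η)) :=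
      (norm_sub_le _ _).trans
        (add_le_add hDn (l2_norm_mul_le_of_le hO (l2_norm_mul_le_of_le hL hDn)))
    refine (l2_norm_mul_le_of_le h1 hQdn).trans ?_
    have : 0 ≤ c * η * (c ^ 2 - 1) := mul_nonneg (by positivity) (by linarith)
    nlinarith
  have hE2eq : Qh - S⁻¹ * Q = S⁻¹ * (L * D) := by
    have h1 : S * Qh = Q + L * D := by
      rw [hS, Matrix.mul_assoc, ← hNf, hNeq, Matrix.mul_add, ← Matrix.mul_assoc, hLO,
        Matrix.one_mul]
    have h2 : Qh = S⁻¹ * (S * Qh) := by rw [← Matrix.mul_assoc, hSS, Matrix.one_mul]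
    rw [h2, h1, Matrix.mul_add]; abel
  have hE2 : ‖Qh - S⁻¹ * Q‖ ≤ 8 * c ^ 3 * η := by
    rw [hE2eq]
    exact (l2_norm_mul_le_of_le hSin (l2_norm_mul_le_of_le hL hDn)).trans (le_of_eq (by ring))
  have hMn : ‖S⁻¹ * M₀ * S‖ ≤ 8 * c ^ 5 :=
    (l2_norm_mul_le_of_le (l2_norm_mul_le_of_le hSin hM₀) hSn).trans (le_of_eq (by ring))
  exact ⟨S, hSu, hSn, hSin, hE1, hE2,
    norm_shift_sub_le hc hη hη1 hSS' hHp hOdO hQQd hOdn hQdn hMn hE1 hE2⟩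

end Realization

/-! ### Summable powers and Markov parameters under perturbation. -/

section Powers

variable {n m p : ℕ}

/-- Young's inequality for a truncated convolution: for fixed `j` the index `k - 1 - j` takes each
value below `N` at most once. -/
lemma sum_range_conv_le {f g : ℕ → ℝ} (hf : ∀ k, 0 ≤ f k) (hg : ∀ k, 0 ≤ g k) (N : ℕ) :
    ∑ k ∈ Finset.range N, ∑ j ∈ Finset.range k, f j * g (k - 1 - j)
      ≤ (∑ j ∈ Finset.range N, f j) * ∑ i ∈ Finset.range N, g i := by
  have h1 : ∀ k ∈ Finset.range N, ∑ j ∈ Finset.range k, f j * g (k - 1 - j)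
      = ∑ j ∈ Finset.range N, if j < k then f j * g (k - 1 - j) else 0 := by
    intro k hk
    rw [← Finset.sum_filter]
    refine Finset.sum_congr ?_ fun _ _ => rfl
    ext j
    simp only [Finset.mem_range, Finset.mem_filter] at hk ⊢
    omega
  rw [Finset.sum_congr rfl h1, Finset.sum_comm, Finset.sum_mul]
  refine Finset.sum_le_sum fun j _ => ?_
  rw [← Finset.sum_filter, ← Finset.mul_sum]
  refine mul_le_mul_of_nonneg_left ?_ (hf j)
  have hinj : Set.InjOn (fun k => k - 1 - j) ↑{k ∈ Finset.range N | j < k} := by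
    intro a ha b hb hab
    simp only [Finset.coe_filter, Finset.mem_range, Set.mem_ofPred_eq] at ha hb hab
    omega
  rw [← Finset.sum_image (f := g) hinj]
  refine Finset.sum_le_sum_of_subset_of_nonneg ?_ fun _ _ _ => hg _
  intro i hi
  simp only [Finset.mem_image, Finset.mem_filter, Finset.mem_range] at hi ⊢
  omega

lemma pow_sub_pow_eq_sum (X Y : Matrix (Fin n) (Fin n) ℝ) (k : ℕ) :
    X ^ k - Y ^ k = ∑ j ∈ Finset.range k, Y ^ j * (X - Y) * X ^ (k - 1 - j) := by
  have h := Finset.sum_range_sub' (fun j => Y ^ j * X ^ (k - j)) k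
  simp only [pow_zero, one_mul, tsub_zero, tsub_self, mul_one] at h
  rw [← h]
  refine Finset.sum_congr rfl fun j hj => ?_
  have hj := Finset.mem_range.1 hj
  have e : k - j = (k - 1 - j) + 1 := by omega
  have e2 : k - (j + 1) = k - 1 - j := by omega
  rw [e, e2, pow_succ', pow_succ, mul_sub, sub_mul]
  simp only [mul_assoc]

/-- Small perturbations of a matrix with summable powers have summable powers, close to the
original ones. -/
lemma sum_norm_pow_perturb {X Y : Matrix (Fin n) (Fin n) ℝ} {a ε : ℝ}
    (ha : ∀ N, ∑ k ∈ Finset.range N, ‖Y ^ k‖ ≤ a) (hXY : ‖X - Y‖ ≤ ε) (hε : a * ε ≤ 1 / 2)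
    (N : ℕ) :
    ∑ k ∈ Finset.range N, ‖X ^ k‖ ≤ 2 * a ∧
      ∑ k ∈ Finset.range N, ‖X ^ k - Y ^ k‖ ≤ 2 * a ^ 2 * ε := by
  have ha0 : 0 ≤ a := by simpa using ha 0
  have hε0 : 0 ≤ ε := (norm_nonneg _).trans hXY
  set sX := ∑ k ∈ Finset.range N, ‖X ^ k‖ with hsX
  have hsX0 : 0 ≤ sX := Finset.sum_nonneg fun _ _ => norm_nonneg _
  have hD : ∑ k ∈ Finset.range N, ‖X ^ k - Y ^ k‖ ≤ a * ε * sX := by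
    calc ∑ k ∈ Finset.range N, ‖X ^ k - Y ^ k‖
        ≤ ∑ k ∈ Finset.range N, ∑ j ∈ Finset.range k, ε * (‖Y ^ j‖ * ‖X ^ (k - 1 - j)‖) := by
          refine Finset.sum_le_sum fun k _ => ?_
          rw [pow_sub_pow_eq_sum]
          refine (norm_sum_le _ _).trans (Finset.sum_le_sum fun j _ => ?_)
          refine (l2_norm_mul_le_of_le (l2_norm_mul_le_of_le le_rfl hXY) le_rfl).trans
            (le_of_eq (by ring))
      _ = ε * ∑ k ∈ Finset.range N, ∑ j ∈ Finset.range k, ‖Y ^ j‖ * ‖X ^ (k - 1 - j)‖ := by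
          simp only [Finset.mul_sum]
      _ ≤ ε * ((∑ j ∈ Finset.range N, ‖Y ^ j‖) * sX) :=
          mul_le_mul_of_nonneg_left (sum_range_conv_le (f := fun j => ‖Y ^ j‖)
            (g := fun j => ‖X ^ j‖) (fun _ => norm_nonneg _) (fun _ => norm_nonneg _) N) hε0
      _ ≤ ε * (a * sX) :=
          mul_le_mul_of_nonneg_left (mul_le_mul_of_nonneg_right (ha N) hsX0) hε0
      _ = a * ε * sX := by ring
  -- Self-bounding: `sX ≤ a + a ε sX` and `a ε ≤ 1 / 2`. The partial sum is finite, so it can be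
  -- absorbed, and the result does not depend on `N`.
  have hs : sX ≤ 2 * a := by
    have h1 : sX ≤ ∑ k ∈ Finset.range N, ‖Y ^ k‖ + ∑ k ∈ Finset.range N, ‖X ^ k - Y ^ k‖ := by
      rw [← Finset.sum_add_distrib]
      refine Finset.sum_le_sum fun k _ => ?_
      calc ‖X ^ k‖ = ‖Y ^ k + (X ^ k - Y ^ k)‖ := by congr 1; abel
        _ ≤ _ := norm_add_le _ _
    have h2 : a * ε * sX ≤ 1 / 2 * sX := mul_le_mul_of_nonneg_right hε hsX0
    have := ha N
    linarith
  refine ⟨hs, hD.trans ?_⟩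
  have : a * ε * sX ≤ a * ε * (2 * a) := mul_le_mul_of_nonneg_left hs (by positivity)
  linarith

lemma norm_markovMatrix_sub_le (A A' : Matrix (Fin n) (Fin n) ℝ) (B B' : Matrix (Fin n) (Fin p) ℝ)
    (C C' : Matrix (Fin m) (Fin n) ℝ) (H : ℕ) :
    ‖markovMatrix A B C H - markovMatrix A' B' C' H‖
      ≤ m * p * ∑ k ∈ Finset.range H, ‖C * A ^ k * B - C' * A' ^ k * B'‖ := by
  set s := ∑ k ∈ Finset.range H, ‖C * A ^ k * B - C' * A' ^ k * B'‖ with hs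
  have hs0 : 0 ≤ s := Finset.sum_nonneg fun _ _ => norm_nonneg _
  have hmp : (0 : ℝ) ≤ m * p := by positivity
  refine norm_le_of_frobSq_le _ (mul_nonneg hmp hs0) ?_
  have hb : ∀ k : Fin H, ∀ i j, (markovMatrix A B C H - markovMatrix A' B' C' H) i (k, j) ^ 2
      ≤ ‖markovParam A B C k - markovParam A' B' C' k‖ ^ 2 := by
    intro k i j
    rw [← sq_abs]
    gcongr
    exact abs_entry_le_norm (markovParam A B C k - markovParam A' B' C' k) i j
  have h1 : frobSq (markovMatrix A B C H - markovMatrix A' B' C' H)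
      ≤ m * p * ∑ k ∈ Finset.range H, ‖markovParam A B C k - markovParam A' B' C' k‖ ^ 2 := by
    unfold frobSq
    calc _ ≤ ∑ _i : Fin m, ∑ c : Fin H × Fin p,
          ‖markovParam A B C c.1 - markovParam A' B' C' c.1‖ ^ 2 :=
          Finset.sum_le_sum fun i _ => Finset.sum_le_sum fun c _ => hb c.1 i c.2
      _ = _ := by
          rw [Fintype.sum_prod_type]
          simp only [Finset.sum_const, Finset.card_univ, Fintype.card_fin, nsmul_eq_mul,
            ← Finset.mul_sum]
          rw [Finset.sum_range, mul_assoc]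
  have h2 : ∑ k ∈ Finset.range H, ‖markovParam A B C k - markovParam A' B' C' k‖ ^ 2
      ≤ s ^ 2 := by
    refine (Finset.sum_sq_le_sq_sum_of_nonneg fun _ _ => norm_nonneg _).trans ?_
    refine pow_le_pow_left₀ (Finset.sum_nonneg fun _ _ => norm_nonneg _) ?_ 2
    rcases H with _ | H
    · simp [hs]
    -- Block `0` vanishes for both systems and block `k + 1` is `C A^k B`, so `H + 1` blocks only
    -- involve powers below `H`.
    · rw [Finset.sum_range_succ']
      simp only [markovParam, Nat.add_eq_zero_iff, one_ne_zero, and_false, if_false, if_true,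
        add_tsub_cancel_right, sub_self, norm_zero, add_zero]
      rw [hs]
      exact Finset.sum_le_sum_of_subset_of_nonneg (Finset.range_mono (Nat.le_succ H))
        fun _ _ _ => norm_nonneg _
  have h3 : ((m : ℝ) * p) ≤ (m * p) ^ 2 := by
    have : ((m * p : ℕ) : ℝ) ≤ ((m * p : ℕ) : ℝ) ^ 2 := by
      exact_mod_cast Nat.le_self_pow two_ne_zero _
    push_cast at this
    exact this
  calc _ ≤ _ := h1
    _ ≤ (m * p) * s ^ 2 := mul_le_mul_of_nonneg_left h2 hmp
    _ ≤ (m * p) ^ 2 * s ^ 2 := mul_le_mul_of_nonneg_right h3 (sq_nonneg s)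
    _ = _ := by ring

/-- Each difference is telescoped over the three factors; the bound is summed over `k` and free of
`N`, which is what makes the final estimate simultaneous in `H`. -/
lemma sum_norm_markov_perturb {A A' : Matrix (Fin n) (Fin n) ℝ} {B B' : Matrix (Fin n) (Fin p) ℝ}
    {C C' : Matrix (Fin m) (Fin n) ℝ} {a b ε : ℝ}
    (ha : ∀ N, ∑ k ∈ Finset.range N, ‖A' ^ k‖ ≤ a) (hA : ‖A - A'‖ ≤ ε) (hB : ‖B - B'‖ ≤ ε)
    (hC : ‖C - C'‖ ≤ ε) (hε : a * ε ≤ 1 / 2) (hε1 : ε ≤ 1) (hB' : ‖B'‖ ≤ b) (hC' : ‖C'‖ ≤ b)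
    (N : ℕ) :
    ∑ k ∈ Finset.range N, ‖C * A ^ k * B - C' * A' ^ k * B'‖
      ≤ (2 * a * (b + 1) + 2 * a ^ 2 * b * (b + 1) + a * b) * ε := by
  obtain ⟨h1, h2⟩ := sum_norm_pow_perturb ha hA hε N
  have hb0 : 0 ≤ b := (norm_nonneg _).trans hB'
  have hε0 : 0 ≤ ε := (norm_nonneg _).trans hA
  have hBn : ‖B‖ ≤ b + 1 := by
    calc ‖B‖ = ‖B' + (B - B')‖ := by congr 1; abel
      _ ≤ b + 1 := (norm_add_le _ _).trans (add_le_add hB' (hB.trans hε1))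
  have hterm : ∀ k, ‖C * A ^ k * B - C' * A' ^ k * B'‖
      ≤ ε * (b + 1) * ‖A ^ k‖ + b * (b + 1) * ‖A ^ k - A' ^ k‖ + b * ε * ‖A' ^ k‖ := by
    intro k
    have e : C * A ^ k * B - C' * A' ^ k * B'
        = (C - C') * A ^ k * B + C' * (A ^ k - A' ^ k) * B + C' * A' ^ k * (B - B') := by
      simp only [Matrix.sub_mul, Matrix.mul_sub]; abel
    rw [e]
    refine (norm_add_le _ _).trans (add_le_add ((norm_add_le _ _).trans (add_le_add ?_ ?_)) ?_)
    · exact (l2_norm_mul_le_of_le (l2_norm_mul_le_of_le hC le_rfl) hBn).trans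
        (le_of_eq (by ring))
    · exact (l2_norm_mul_le_of_le (l2_norm_mul_le_of_le hC' le_rfl) hBn).trans
        (le_of_eq (by ring))
    · exact (l2_norm_mul_le_of_le (l2_norm_mul_le_of_le hC' le_rfl) hB).trans
        (le_of_eq (by ring))
  refine (Finset.sum_le_sum fun k _ => hterm k).trans ?_
  rw [Finset.sum_add_distrib, Finset.sum_add_distrib, ← Finset.mul_sum, ← Finset.mul_sum,
    ← Finset.mul_sum]
  have b1 := mul_le_mul_of_nonneg_left h1 (show 0 ≤ ε * (b + 1) by positivity)
  have b2 := mul_le_mul_of_nonneg_left h2 (show 0 ≤ b * (b + 1) by positivity)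
  have b3 := mul_le_mul_of_nonneg_left (ha N) (show 0 ≤ b * ε by positivity)
  linarith

end Powers

/-! ### Hankel factorization with bounds uniform in the Hankel sizes. -/

section Hankel

variable {n m p : ℕ}

/-- The observability matrix with `d` block rows `C, C M, …`. -/
def extObsv (d : ℕ) (M : Matrix (Fin n) (Fin n) ℝ) (C : Matrix (Fin m) (Fin n) ℝ) :
    Matrix (Fin d × Fin m) (Fin n) ℝ :=
  Matrix.of fun r j => (C * M ^ (r.1 : ℕ)) r.2 j

/-- The controllability matrix `[F, M F, …, B, M B, …]` with `h` blocks in each part. -/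
def extCtrb (h : ℕ) (M : Matrix (Fin n) (Fin n) ℝ) (F : Matrix (Fin n) (Fin m) ℝ)
    (B : Matrix (Fin n) (Fin p) ℝ) : Matrix (Fin n) (ArxIdx m p h) ℝ :=
  Matrix.of fun i c => match c with
    | .inl (k, j) => (M ^ (k : ℕ) * F) i j
    | .inr (k, j) => (M ^ (k : ℕ) * B) i j

variable (M : Matrix (Fin n) (Fin n) ℝ) (F : Matrix (Fin n) (Fin m) ℝ)
  (B : Matrix (Fin n) (Fin p) ℝ) (C : Matrix (Fin m) (Fin n) ℝ)

/-- The block in position `(j, k)` depends on `j + k` only, and `M ^ (j + k)` splits as `M ^ j * M ^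
k`: the Hankel matrix factors through the state space. The shifted matrix has one more `M` between
the same factors. -/
lemma hankelMinus_mul_extCtrb (d₁ d₂ : ℕ) :
    hankelMinus d₁ d₂ (C * extCtrb (d₁ + d₂ + 1) M F B) = extObsv d₁ M C * extCtrb d₂ M F B := by
  have key : ∀ {q : ℕ} (E : Matrix (Fin n) (Fin q) ℝ) (a b : ℕ) (i : Fin m) (j : Fin q),
      ∑ l, C i l * (M ^ (a + b) * E) l j = ∑ l, (C * M ^ a) i l * (M ^ b * E) l j := by
    intro q E a b i j
    rw [← Matrix.mul_apply, ← Matrix.mul_apply, pow_add]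
    simp only [Matrix.mul_assoc]
  ext ⟨r, i⟩ c
  rcases c with ⟨k, j⟩ | ⟨k, j⟩
  · exact key F r k i j
  · exact key B r k i j

lemma hankelPlus_mul_extCtrb (d₁ d₂ : ℕ) :
    hankelPlus d₁ d₂ (C * extCtrb (d₁ + d₂ + 1) M F B)
      = extObsv d₁ M C * M * extCtrb d₂ M F B := by
  have key : ∀ {q : ℕ} (E : Matrix (Fin n) (Fin q) ℝ) (a b : ℕ) (i : Fin m) (j : Fin q),
      ∑ l, C i l * (M ^ (a + (b + 1)) * E) l j
        = ∑ l, (C * M ^ a) i l * (M * (M ^ b * E)) l j := by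
    intro q E a b i j
    rw [← Matrix.mul_apply, ← Matrix.mul_apply, pow_add, pow_succ']
    simp only [Matrix.mul_assoc]
  rw [Matrix.mul_assoc]
  ext ⟨r, i⟩ c
  rcases c with ⟨k, j⟩ | ⟨k, j⟩
  · exact key F r k i j
  · exact key B r k i j

/-- Within one block row distinct blocks of the Hankel matrix are distinct blocks of `G`, so each
block row costs at most one copy of the error. -/
lemma frobSq_hankelMinus_sub_le (d₁ d₂ : ℕ) (G G' : Matrix (Fin m) (ArxIdx m p (d₁ + d₂ + 1)) ℝ) :
    frobSq (hankelMinus d₁ d₂ G - hankelMinus d₁ d₂ G') ≤ d₁ * frobSq (G - G') := by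
  refine frobSq_le_of_injective (fun r c => match c with
    | .inl (k, i) => .inl (⟨r.1 + k.1, by omega⟩, i)
    | .inr (k, i) => .inr (⟨r.1 + k.1, by omega⟩, i)) ?_ ?_
  · rintro r (⟨k, i⟩ | ⟨k, i⟩) (⟨k', i'⟩ | ⟨k', i'⟩) h <;> simp_all [Fin.ext_iff]
  · rintro r i (⟨k, j⟩ | ⟨k, j⟩) <;> rfl

lemma frobSq_hankelPlus_sub_le (d₁ d₂ : ℕ) (G G' : Matrix (Fin m) (ArxIdx m p (d₁ + d₂ + 1)) ℝ) :
    frobSq (hankelPlus d₁ d₂ G - hankelPlus d₁ d₂ G') ≤ d₁ * frobSq (G - G') := by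
  refine frobSq_le_of_injective (fun r c => match c with
    | .inl (k, i) => .inl (⟨r.1 + (k.1 + 1), by omega⟩, i)
    | .inr (k, i) => .inr (⟨r.1 + (k.1 + 1), by omega⟩, i)) ?_ ?_
  · rintro r (⟨k, i⟩ | ⟨k, i⟩) (⟨k', i'⟩ | ⟨k', i'⟩) h <;> simp_all [Fin.ext_iff]
  · rintro r i (⟨k, j⟩ | ⟨k, j⟩) <;> rfl

lemma sum_norm_pow_sq_le {a : ℝ} (ha : ∀ N, ∑ k ∈ Finset.range N, ‖M ^ k‖ ≤ a) (d : ℕ) :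
    ∑ k : Fin d, ‖M ^ (k : ℕ)‖ ^ 2 ≤ a ^ 2 := by
  rw [← Finset.sum_range (fun k => ‖M ^ k‖ ^ 2)]
  exact (Finset.sum_sq_le_sq_sum_of_nonneg fun _ _ => norm_nonneg _).trans
    (pow_le_pow_left₀ (Finset.sum_nonneg fun _ _ => norm_nonneg _) (ha d) 2)

/-- The bound is free of `d` because summable norms of powers are square summable. -/
lemma norm_extObsv_le {a : ℝ} (ha : ∀ N, ∑ k ∈ Finset.range N, ‖M ^ k‖ ≤ a) (d : ℕ) :
    ‖extObsv d M C‖ ≤ √(m * n * (‖C‖ ^ 2 * a ^ 2)) := by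
  refine (norm_le_sqrt_frobSq _).trans (Real.sqrt_le_sqrt ?_)
  have h1 : frobSq (extObsv d M C) = ∑ k : Fin d, frobSq (C * M ^ (k : ℕ)) := by
    unfold frobSq; rw [Fintype.sum_prod_type]; rfl
  rw [h1]
  calc _ ≤ ∑ k : Fin d, (m * n * (‖C‖ ^ 2 * ‖M ^ (k : ℕ)‖ ^ 2) : ℝ) := by
        refine Finset.sum_le_sum fun k _ => (frobSq_le_card_mul_norm_sq _).trans ?_
        rw [Fintype.card_fin, Fintype.card_fin, ← mul_pow]
        gcongr
        exact Matrix.l2_opNorm_mul _ _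
    _ = m * n * (‖C‖ ^ 2 * ∑ k : Fin d, ‖M ^ (k : ℕ)‖ ^ 2) := by
        rw [Finset.mul_sum, Finset.mul_sum]
    _ ≤ _ := by gcongr; exact sum_norm_pow_sq_le M ha d

lemma frobSq_extCtrb_le {a : ℝ} (ha : ∀ N, ∑ k ∈ Finset.range N, ‖M ^ k‖ ≤ a) (d : ℕ) :
    frobSq (extCtrb d M F B) ≤ n * m * (‖F‖ ^ 2 * a ^ 2) + n * p * (‖B‖ ^ 2 * a ^ 2) := by
  have key : ∀ {q : ℕ} (E : Matrix (Fin n) (Fin q) ℝ),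
      ∑ k : Fin d, frobSq (M ^ (k : ℕ) * E) ≤ n * q * (‖E‖ ^ 2 * a ^ 2) := by
    intro q E
    calc _ ≤ ∑ k : Fin d, (n * q * (‖E‖ ^ 2 * ‖M ^ (k : ℕ)‖ ^ 2) : ℝ) := by
          refine Finset.sum_le_sum fun k _ => (frobSq_le_card_mul_norm_sq _).trans ?_
          rw [Fintype.card_fin, Fintype.card_fin, ← mul_pow, mul_comm ‖E‖]
          gcongr
          exact Matrix.l2_opNorm_mul _ _
      _ = n * q * (‖E‖ ^ 2 * ∑ k : Fin d, ‖M ^ (k : ℕ)‖ ^ 2) := by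
          rw [Finset.mul_sum, Finset.mul_sum]
      _ ≤ _ := by gcongr; exact sum_norm_pow_sq_le M ha d
  have h1 : frobSq (extCtrb d M F B)
      = ∑ k : Fin d, frobSq (M ^ (k : ℕ) * F) + ∑ k : Fin d, frobSq (M ^ (k : ℕ) * B) := by
    unfold frobSq
    simp only [Fintype.sum_sum_type, Fintype.sum_prod_type, Finset.sum_add_distrib]
    rw [Finset.sum_comm]
    congr 1
    rw [Finset.sum_comm]
    rfl
  rw [h1]
  exact add_le_add (key F) (key B)

lemma exists_left_inverse_of_rank {α : Type*} [Fintype α] (X : Matrix α (Fin n) ℝ)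
    (h : X.rank = n) : ∃ L : Matrix (Fin n) α ℝ, L * X = 1 := by
  classical
  have hli : LinearIndependent ℝ X.col := by
    rw [linearIndependent_iff_card_eq_finrank_span, Fintype.card_fin, Set.finrank,
      ← Matrix.rank_eq_finrank_span_cols, h]
  have hinj : Function.Injective X.mulVec := Matrix.mulVec_injective_iff.2 hli
  obtain ⟨g, hg⟩ := X.mulVecLin.exists_leftInverse_of_injective
    (LinearMap.ker_eq_bot.2 hinj)
  refine ⟨LinearMap.toMatrix' g, ?_⟩
  have := congrArg LinearMap.toMatrix' hg
  rw [LinearMap.toMatrix'_comp, ← Matrix.toLin'_apply', LinearMap.toMatrix'_toLin',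
    LinearMap.toMatrix'_id] at this
  exact this

lemma rank_eq_of_mulVec_injective {α : Type*} [Fintype α] (X : Matrix α (Fin n) ℝ)
    (h : ∀ v, X *ᵥ v = 0 → v = 0) : X.rank = n := by
  have hinj : Function.Injective X.mulVecLin := by
    rw [← LinearMap.ker_eq_bot, LinearMap.ker_eq_bot']
    exact h
  rw [Matrix.rank, LinearMap.finrank_range_of_inj hinj]
  simp

/-- Output injection preserves observability. -/
lemma IsObservable.output_injection {A : Matrix (Fin n) (Fin n) ℝ} {C : Matrix (Fin m) (Fin n) ℝ}
    (h : IsObservable A C) (F : Matrix (Fin n) (Fin m) ℝ) : IsObservable (A - F * C) C := by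
  obtain ⟨L, hL⟩ := exists_left_inverse_of_rank _ h
  refine rank_eq_of_mulVec_injective _ fun v hv => ?_
  have h1 : ∀ k < n, C *ᵥ ((A - F * C) ^ k *ᵥ v) = 0 := fun k hk => by
    rw [Matrix.mulVec_mulVec]
    ext i
    exact congrFun hv (⟨k, hk⟩, i)
  -- As long as `C` annihilates the orbit of `v`, the injected term `F C` is zero along it, so the
  -- orbits under `A - F C` and `A` agree.
  have h2 : ∀ k ≤ n, (A - F * C) ^ k *ᵥ v = A ^ k *ᵥ v := by
    intro k
    induction k with
    | zero => simp
    | succ k ih =>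
      intro hk
      have h3 := h1 k (by omega)
      rw [pow_succ', ← Matrix.mulVec_mulVec, Matrix.sub_mulVec, ← Matrix.mulVec_mulVec, h3,
        Matrix.mulVec_zero, sub_zero, ih (by omega), Matrix.mulVec_mulVec, ← pow_succ']
  have h4 : obsvMatrix A C *ᵥ v = 0 := by
    ext ⟨k, i⟩
    have h5 := h1 k k.2
    rw [h2 k k.2.le, Matrix.mulVec_mulVec] at h5
    exact congrFun h5 i
  rw [← Matrix.one_mulVec v, ← hL, ← Matrix.mulVec_mulVec, h4, Matrix.mulVec_zero]

lemma ctrbMatrix_transpose {q : ℕ} (A : Matrix (Fin n) (Fin n) ℝ) (F : Matrix (Fin n) (Fin q) ℝ) :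
    (ctrbMatrix A F)ᵀ = obsvMatrix Aᵀ Fᵀ := by
  ext ⟨k, i⟩ j
  simp only [ctrbMatrix, obsvMatrix, Matrix.transpose_apply, Matrix.of_apply]
  rw [← Matrix.transpose_pow, ← Matrix.transpose_mul, Matrix.transpose_apply]

/-- State feedback preserves controllability. -/
lemma IsControllable.state_feedback {A : Matrix (Fin n) (Fin n) ℝ} {F : Matrix (Fin n) (Fin m) ℝ}
    (h : IsControllable A F) (C : Matrix (Fin m) (Fin n) ℝ) : IsControllable (A - F * C) F := by
  have h1 : IsObservable Aᵀ Fᵀ := by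
    unfold IsObservable
    rw [← ctrbMatrix_transpose, Matrix.rank_transpose]; exact h
  have h2 := h1.output_injection Cᵀ
  rw [← Matrix.transpose_mul, ← Matrix.transpose_sub] at h2
  unfold IsObservable at h2
  rwa [← ctrbMatrix_transpose, Matrix.rank_transpose] at h2

lemma norm_submatrix_one_le {α β : Type*} [Fintype α] [Fintype β] [DecidableEq α] [DecidableEq β]
    {e : β → α} (he : Function.Injective e) :
    ‖(1 : Matrix α α ℝ).submatrix id e‖ ≤ 1 := by
  refine norm_le_one_of_orthonormal _ ?_
  ext i j
  simp only [Matrix.mul_apply, Matrix.transpose_apply, Matrix.submatrix_apply, id_eq,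
    Matrix.one_apply, mul_ite, mul_one, mul_zero]
  simp [he.eq_iff, eq_comm]

/-- A left inverse of the order-`n` observability matrix, padded with zero columns, works for every
`d ≥ n` and keeps its norm. This keeps the conditioning independent of the Hankel sizes, which grow
with `T`. -/
lemma exists_left_inverse_extObsv (h : IsObservable M C) :
    ∃ l : ℝ, ∀ d, n ≤ d → ∃ L : Matrix (Fin n) (Fin d × Fin m) ℝ,
      L * extObsv d M C = 1 ∧ ‖L‖ ≤ l := by
  obtain ⟨L, hL⟩ := exists_left_inverse_of_rank _ h
  refine ⟨‖L‖, fun d hd => ?_⟩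
  let e : Fin n × Fin m → Fin d × Fin m := Prod.map (Fin.castLE hd) id
  have he : Function.Injective e := (Fin.castLE_injective hd).prodMap Function.injective_id
  refine ⟨L * ((1 : Matrix _ _ ℝ).submatrix id e)ᵀ, ?_, ?_⟩
  · rw [Matrix.mul_assoc, ← hL]
    congr 1
    ext r j
    simp only [Matrix.mul_apply, Matrix.transpose_apply, Matrix.submatrix_apply, id_eq,
      Matrix.one_apply, ite_mul, one_mul, zero_mul]
    simp [e, extObsv, obsvMatrix]
  · refine (l2_norm_mul_le_of_le le_rfl ?_).trans (mul_one _).le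
    rw [norm_transpose_eq]
    exact norm_submatrix_one_le he

/-- Zero rows are placed on the further powers and on the whole `B` part: the first `n` blocks `M ^
k * F` already span the state space. -/
lemma exists_right_inverse_extCtrb (h : IsControllable M F) :
    ∃ l : ℝ, ∀ d, n ≤ d → ∃ R : Matrix (ArxIdx m p d) (Fin n) ℝ,
      extCtrb d M F B * R = 1 ∧ ‖R‖ ≤ l := by
  obtain ⟨L, hL⟩ := exists_left_inverse_of_rank (ctrbMatrix M F)ᵀ
    (by rw [Matrix.rank_transpose]; exact h)
  have hR : ctrbMatrix M F * Lᵀ = 1 := by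
    rw [← Matrix.transpose_transpose (ctrbMatrix M F), ← Matrix.transpose_mul, hL,
      Matrix.transpose_one]
  refine ⟨‖Lᵀ‖, fun d hd => ?_⟩
  let e : Fin n × Fin m → ArxIdx m p d := fun c => .inl (Prod.map (Fin.castLE hd) id c)
  have he : Function.Injective e :=
    Sum.inl_injective.comp ((Fin.castLE_injective hd).prodMap Function.injective_id)
  refine ⟨(1 : Matrix _ _ ℝ).submatrix id e * Lᵀ, ?_, ?_⟩
  · rw [← Matrix.mul_assoc, ← hR]
    congr 1
    ext i c
    simp only [Matrix.mul_apply, Matrix.submatrix_apply, id_eq, Matrix.one_apply, mul_ite, mul_one,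
      mul_zero]
    rw [Finset.sum_ite_eq' Finset.univ (e c)]
    simp [e, extCtrb, ctrbMatrix]
  · exact (l2_norm_mul_le_of_le (norm_submatrix_one_le he) le_rfl).trans (one_mul _).le

end Hankel

/-! ### Robustness of SysId to errors in the ARX parameters. -/

section SysIdPerturbation

variable {n m p : ℕ}

lemma extObsv_zero {d : ℕ} (h : 0 < d) (M : Matrix (Fin n) (Fin n) ℝ)
    (C : Matrix (Fin m) (Fin n) ℝ) (i : Fin m) (j : Fin n) :
    extObsv d M C (⟨0, h⟩, i) j = C i j := by
  simp [extObsv]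

lemma extCtrb_inl_zero {d : ℕ} (h : 0 < d) (M : Matrix (Fin n) (Fin n) ℝ)
    (F : Matrix (Fin n) (Fin m) ℝ) (B : Matrix (Fin n) (Fin p) ℝ) (i : Fin n) (j : Fin m) :
    extCtrb d M F B i (.inl (⟨0, h⟩, j)) = F i j := by
  simp [extCtrb]

lemma extCtrb_inr_zero {d : ℕ} (h : 0 < d) (M : Matrix (Fin n) (Fin n) ℝ)
    (F : Matrix (Fin n) (Fin m) ℝ) (B : Matrix (Fin n) (Fin p) ℝ) (i : Fin n) (j : Fin p) :
    extCtrb d M F B i (.inr (⟨0, h⟩, j)) = B i j := by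
  simp [extCtrb]

lemma conj_pow {S : Matrix (Fin n) (Fin n) ℝ} (hS : IsUnit S.det) (A : Matrix (Fin n) (Fin n) ℝ)
    (k : ℕ) : (S⁻¹ * A * S) ^ k = S⁻¹ * A ^ k * S := by
  induction k with
  | zero => simp [Matrix.nonsing_inv_mul _ hS]
  | succ k ih =>
    rw [pow_succ, ih, pow_succ]
    calc S⁻¹ * A ^ k * S * (S⁻¹ * A * S) = S⁻¹ * A ^ k * (S * S⁻¹) * A * S := by
          simp only [Matrix.mul_assoc]
      _ = _ := by rw [Matrix.mul_nonsing_inv _ hS, Matrix.mul_one]; simp only [Matrix.mul_assoc]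

lemma markov_conj {S : Matrix (Fin n) (Fin n) ℝ} (hS : IsUnit S.det)
    (A : Matrix (Fin n) (Fin n) ℝ) (B : Matrix (Fin n) (Fin p) ℝ) (C : Matrix (Fin m) (Fin n) ℝ)
    (k : ℕ) : (C * S) * (S⁻¹ * A * S) ^ k * (S⁻¹ * B) = C * A ^ k * B := by
  rw [conj_pow hS]
  calc (C * S) * (S⁻¹ * A ^ k * S) * (S⁻¹ * B) = C * (S * S⁻¹) * A ^ k * (S * S⁻¹) * B := by
        simp only [Matrix.mul_assoc]
    _ = _ := by rw [Matrix.mul_nonsing_inv _ hS, Matrix.mul_one, Matrix.mul_one]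

/-- Markov parameters do not depend on the basis, so the estimates may be compared with `(S⁻¹ A S,
S⁻¹ B, C S)`; conjugation costs a factor `s' * s` in the sum of the norms of powers. -/
lemma norm_markovMatrix_sub_le_of_conj {A Ah : Matrix (Fin n) (Fin n) ℝ}
    {B Bh : Matrix (Fin n) (Fin p) ℝ} {C Ch : Matrix (Fin m) (Fin n) ℝ}
    {S : Matrix (Fin n) (Fin n) ℝ} (hS : IsUnit S.det) {a b ε s s' : ℝ}
    (ha : ∀ N, ∑ k ∈ Finset.range N, ‖A ^ k‖ ≤ a) (hSn : ‖S‖ ≤ s) (hSi : ‖S⁻¹‖ ≤ s')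
    (hA : ‖Ah - S⁻¹ * A * S‖ ≤ ε) (hB : ‖Bh - S⁻¹ * B‖ ≤ ε) (hC : ‖Ch - C * S‖ ≤ ε)
    (hε : s' * s * a * ε ≤ 1 / 2) (hε1 : ε ≤ 1) (hB' : ‖S⁻¹ * B‖ ≤ b) (hC' : ‖C * S‖ ≤ b) (H : ℕ) :
    ‖markovMatrix Ah Bh Ch H - markovMatrix A B C H‖
      ≤ m * p * ((2 * (s' * s * a) * (b + 1) + 2 * (s' * s * a) ^ 2 * b * (b + 1)
        + (s' * s * a) * b) * ε) := by
  have hs0 : 0 ≤ s := (norm_nonneg _).trans hSn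
  have hs0' : 0 ≤ s' := (norm_nonneg _).trans hSi
  refine (norm_markovMatrix_sub_le _ _ _ _ _ _ H).trans ?_
  refine mul_le_mul_of_nonneg_left ?_ (by positivity)
  have h1 : ∀ N, ∑ k ∈ Finset.range N, ‖(S⁻¹ * A * S) ^ k‖ ≤ s' * s * a := by
    intro N
    calc _ ≤ ∑ k ∈ Finset.range N, s' * s * ‖A ^ k‖ := by
          refine Finset.sum_le_sum fun k _ => ?_
          rw [conj_pow hS]
          exact (l2_norm_mul_le_of_le (l2_norm_mul_le_of_le hSi le_rfl) hSn).trans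
            (le_of_eq (by ring))
      _ ≤ _ := by
          rw [← Finset.mul_sum]
          exact mul_le_mul_of_nonneg_left (ha N) (mul_nonneg hs0' hs0)
  have h2 := sum_norm_markov_perturb h1 hA hB hC hε hε1 hB' hC' H
  simpa only [markov_conj hS] using h2

/-- The outputs of SysId are close, up to a well-conditioned change of basis, to the true system
when the ARX parameters are accurately estimated. -/
theorem sysId_perturbation (A : Matrix (Fin n) (Fin n) ℝ) (B : Matrix (Fin n) (Fin p) ℝ)
    (C : Matrix (Fin m) (Fin n) ℝ) (F : Matrix (Fin n) (Fin m) ℝ)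
    (hAC : IsObservable A C) (hAF : IsControllable A F) {a : ℝ}
    (haM : ∀ N, ∑ k ∈ Finset.range N, ‖(A - F * C) ^ k‖ ≤ a)
    (haA : ∀ N, ∑ k ∈ Finset.range N, ‖A ^ k‖ ≤ a) :
    ∃ K : ℝ, 1 ≤ K ∧ ∀ d₁ d₂ : ℕ, n ≤ d₁ → n ≤ d₂ →
      ∀ (G : Matrix (Fin m) (ArxIdx m p (d₁ + d₂ + 1)) ℝ) (η : ℝ), 0 ≤ η → K * η ≤ 1 →
      d₁ * frobSq (G - C * extCtrb (d₁ + d₂ + 1) (A - F * C) F B) ≤ η ^ 2 →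
      ∀ (Ah : Matrix (Fin n) (Fin n) ℝ) (Bh : Matrix (Fin n) (Fin p) ℝ)
        (Ch : Matrix (Fin m) (Fin n) ℝ), IsSysIdOutput d₁ d₂ G Ah Bh Ch →
      (∃ S : Matrix (Fin n) (Fin n) ℝ, IsUnit S.det ∧ ‖S‖ ≤ K ∧ ‖S⁻¹‖ ≤ K ∧
        ‖Ah - S⁻¹ * A * S‖ ≤ K * η ∧ ‖Bh - S⁻¹ * B‖ ≤ K * η ∧ ‖Ch - C * S‖ ≤ K * η) ∧
      ∀ H : ℕ, ‖markovMatrix Ah Bh Ch H - markovMatrix A B C H‖ ≤ K * η := by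
  set M := A - F * C with hM
  obtain ⟨l₁, hl₁⟩ := exists_left_inverse_extObsv M C (hAC.output_injection F)
  obtain ⟨l₂, hl₂⟩ := exists_right_inverse_extCtrb M F B (hAF.state_feedback C)
  have ha0 : 0 ≤ a := by simpa using haA 0
  obtain ⟨c, hc, h1, h2, h3, h4, hBc, hCc, hFc, hMc⟩ : ∃ c : ℝ, 1 ≤ c ∧ l₁ ≤ c ∧ l₂ ≤ c ∧
      √(m * n * (‖C‖ ^ 2 * a ^ 2)) ≤ c ∧
      √(n * m * (‖F‖ ^ 2 * a ^ 2) + n * p * (‖B‖ ^ 2 * a ^ 2)) ≤ c ∧ ‖B‖ ≤ c ∧ ‖C‖ ≤ c ∧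
      ‖F‖ ≤ c ∧ ‖M‖ ≤ c := by
    refine ⟨1 + |l₁| + |l₂| + √(m * n * (‖C‖ ^ 2 * a ^ 2)) +
      √(n * m * (‖F‖ ^ 2 * a ^ 2) + n * p * (‖B‖ ^ 2 * a ^ 2)) + ‖B‖ + ‖C‖ + ‖F‖ + ‖M‖, ?_⟩
    have e1 := le_abs_self l₁
    have e2 := le_abs_self l₂
    have e3 := Real.sqrt_nonneg (m * n * (‖C‖ ^ 2 * a ^ 2))
    have e4 := Real.sqrt_nonneg (n * m * (‖F‖ ^ 2 * a ^ 2) + n * p * (‖B‖ ^ 2 * a ^ 2))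
    have e5 := abs_nonneg l₁
    have e6 := abs_nonneg l₂
    have e7 := norm_nonneg B
    have e8 := norm_nonneg C
    have e9 := norm_nonneg F
    have e10 := norm_nonneg M
    refine ⟨?_, ?_, ?_, ?_, ?_, ?_, ?_, ?_, ?_⟩ <;> linarith
  have hc0 : 0 ≤ c := by linarith
  have hc3 : 1 ≤ c ^ 3 := one_le_pow₀ hc
  -- `g` turns the entrywise error of a first block into a norm bound, with one prefactor covering
  -- all three shapes. `f` collects the error of `Ahat`: the shift estimate plus the two terms of
  -- `Fhat * Chat`. `a'` bounds the power sums of `S⁻¹ A S`, and `b` bounds `S⁻¹ B` and `C S`.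
  set g : ℝ := (n * m + n * p) * (8 * c ^ 3) with hg
  set f : ℝ := 2400 * c ^ 13 + 7 * c ^ 3 * g + g with hf
  set a' : ℝ := 4 * c ^ 2 * (2 * c ^ 2) * a with ha'
  set b : ℝ := 4 * c ^ 3 with hb
  set cm : ℝ := 2 * a' * (b + 1) + 2 * a' ^ 2 * b * (b + 1) + a' * b with hcm
  have hg0 : 0 ≤ g := by positivity
  have hf0 : 0 ≤ f := by positivity
  have hgf : g ≤ f := by
    have : 0 ≤ 2400 * c ^ 13 + 7 * c ^ 3 * g := by positivity
    linarith
  have ha'0 : 0 ≤ a' := by positivity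
  have hb0 : 0 ≤ b := by positivity
  have hcm0 : 0 ≤ cm := by positivity
  have hcmf : 0 ≤ m * p * (cm * f) := by positivity
  have ha'f : 0 ≤ 2 * a' * f := by positivity
  have hc2 : 0 ≤ c ^ 2 := by positivity
  -- Each summand serves one purpose, so that every smallness condition below follows from `K * η ≤
  -- 1`.
  refine ⟨1 + 4 * c ^ 2 + f + m * p * (cm * f) + 2 * a' * f, by linarith, ?_⟩
  intro d₁ d₂ hd₁ hd₂ G η hη hKη hG Ah Bh Ch hout
  set K : ℝ := 1 + 4 * c ^ 2 + f + m * p * (cm * f) + 2 * a' * f with hK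
  have hle : ∀ x : ℝ, x ≤ K → x * η ≤ 1 := fun x hx =>
    (mul_le_mul_of_nonneg_right hx hη).trans hKη
  have hη4 : 4 * c ^ 2 * η ≤ 1 := hle _ (by linarith)
  have hηf : f * η ≤ 1 := hle _ (by linarith)
  have hηg : g * η ≤ 1 := hle _ (by linarith)
  have hηa : 2 * a' * f * η ≤ 1 := hle _ (by linarith)
  obtain ⟨N, U, s, V, O, Q, Od, Qd, Fh, Abar, hN, hsvd, hO, hQ, hCh, hFh, hBh, hOd, hQd, hAbar,
    hAh⟩ := hout.exists_steps
  obtain ⟨L, hL, hLn⟩ := hl₁ d₁ hd₁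
  obtain ⟨R, hR, hRn⟩ := hl₂ d₂ hd₂
  have hHm : frobSq (hankelMinus d₁ d₂ G - extObsv d₁ M C * extCtrb d₂ M F B) ≤ η ^ 2 := by
    rw [← hankelMinus_mul_extCtrb]
    exact (frobSq_hankelMinus_sub_le _ _ _ _).trans hG
  have hHp : ‖hankelPlus d₁ d₂ G - extObsv d₁ M C * M * extCtrb d₂ M F B‖ ≤ η := by
    rw [← hankelPlus_mul_extCtrb]
    exact norm_le_of_frobSq_le _ hη ((frobSq_hankelPlus_sub_le _ _ _ _).trans hG)
  obtain ⟨S, hSu, hSn, hSi, hE1, hE2, hE3⟩ := exists_changeOfBasis_of_factorization hc hη hη4 hL hR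
    ((norm_extObsv_le M C haM d₁).trans h3)
    ((norm_le_sqrt_frobSq _).trans ((Real.sqrt_le_sqrt (frobSq_extCtrb_le M F B haM d₂)).trans h4))
    (hLn.trans h1) (hRn.trans h2) hMc hHm hHp hN hsvd hO hQ hOd hQd
  have hgen : ∀ {x y : ℕ} (X : Matrix (Fin x) (Fin y) ℝ),
      (x * y : ℝ) ≤ n * m + n * p → (∀ i j, |X i j| ≤ 8 * c ^ 3 * η) → ‖X‖ ≤ g * η := by
    intro x y X hxy hX
    refine (norm_le_of_abs_entry_le X (by positivity) hX).trans ?_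
    rw [Fintype.card_fin, Fintype.card_fin, hg]
    have : (x * y : ℝ) * (8 * c ^ 3 * η) ≤ (n * m + n * p) * (8 * c ^ 3 * η) :=
      mul_le_mul_of_nonneg_right hxy (by positivity)
    linarith
  have hnm : (0 : ℝ) ≤ n * m := by positivity
  have hnp : (0 : ℝ) ≤ n * p := by positivity
  have hCb : ‖Ch - C * S‖ ≤ g * η := by
    refine hgen _ (by rw [mul_comm]; linarith) fun i j => ?_
    -- A column index exists only if `n > 0`, and then `d₁ ≥ n` supplies a first block row; for `n =
    -- 0` there is no entry to bound.
    have h0 : 0 < d₁ := by have := j.2; omega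
    have e : (Ch - C * S) i j = (O - extObsv d₁ M C * S) (⟨0, h0⟩, i) j := by
      simp [hCh ⟨0, h0⟩ rfl, Matrix.mul_apply, extObsv_zero]
    rw [e]
    exact (abs_entry_le_norm _ _ _).trans hE1
  have hFb : ‖Fh - S⁻¹ * F‖ ≤ g * η := by
    refine hgen _ (by linarith) fun i j => ?_
    have h0 : 0 < d₂ := by have := i.2; omega
    have e : (Fh - S⁻¹ * F) i j = (Q - S⁻¹ * extCtrb d₂ M F B) i (.inl (⟨0, h0⟩, j)) := by
      simp [hFh ⟨0, h0⟩ rfl, Matrix.mul_apply, extCtrb_inl_zero]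
    rw [e]
    exact (abs_entry_le_norm _ _ _).trans hE2
  have hBb : ‖Bh - S⁻¹ * B‖ ≤ g * η := by
    refine hgen _ (by linarith) fun i j => ?_
    have h0 : 0 < d₂ := by have := i.2; omega
    have e : (Bh - S⁻¹ * B) i j = (Q - S⁻¹ * extCtrb d₂ M F B) i (.inr (⟨0, h0⟩, j)) := by
      simp [hBh ⟨0, h0⟩ rfl, Matrix.mul_apply, extCtrb_inr_zero]
    rw [e]
    exact (abs_entry_le_norm _ _ _).trans hE2
  have hCS : ‖C * S‖ ≤ 2 * c ^ 3 := (l2_norm_mul_le_of_le hCc hSn).trans (le_of_eq (by ring))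
  have hSF : ‖S⁻¹ * F‖ ≤ 4 * c ^ 3 := (l2_norm_mul_le_of_le hSi hFc).trans (le_of_eq (by ring))
  have hSB : ‖S⁻¹ * B‖ ≤ b := (l2_norm_mul_le_of_le hSi hBc).trans (le_of_eq (by ring))
  have hChn : ‖Ch‖ ≤ 3 * c ^ 3 := by
    calc ‖Ch‖ = ‖C * S + (Ch - C * S)‖ := by congr 1; abel
      _ ≤ 2 * c ^ 3 + g * η := (norm_add_le _ _).trans (add_le_add hCS hCb)
      _ ≤ _ := by linarith
  have hAb : ‖Ah - S⁻¹ * A * S‖ ≤ f * η := by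
    have e : Ah - S⁻¹ * A * S = (Od * hankelPlus d₁ d₂ G * Qd - S⁻¹ * M * S)
        + (Fh - S⁻¹ * F) * Ch + S⁻¹ * F * (Ch - C * S) := by
      have : A = M + F * C := by rw [hM]; abel
      rw [hAh, hAbar]
      conv_lhs => rw [this]
      simp only [Matrix.mul_add, Matrix.add_mul, Matrix.sub_mul, Matrix.mul_sub, Matrix.mul_assoc]
      abel
    rw [e]
    have t1 := l2_norm_mul_le_of_le hFb hChn
    have t2 := l2_norm_mul_le_of_le hSF hCb
    calc _ ≤ 2400 * c ^ 13 * η + g * η * (3 * c ^ 3) + 4 * c ^ 3 * (g * η) :=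
          (norm_add_le _ _).trans (add_le_add ((norm_add_le _ _).trans (add_le_add hE3 t1)) t2)
      _ ≤ f * η := by
          have : 0 ≤ g * η := by positivity
          rw [hf]; linarith
  have hgη : g * η ≤ f * η := mul_le_mul_of_nonneg_right hgf hη
  have hfη : f * η ≤ K * η := mul_le_mul_of_nonneg_right (by linarith) hη
  refine ⟨⟨S, hSu, hSn.trans (by linarith), hSi.trans (by linarith), hAb.trans hfη,
    (hBb.trans hgη).trans hfη, (hCb.trans hgη).trans hfη⟩, fun H => ?_⟩
  refine (norm_markovMatrix_sub_le_of_conj hSu haA hSn hSi hAb (hBb.trans hgη) (hCb.trans hgη)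
    (b := b) ?_ hηf hSB (hCS.trans ?_) H).trans ?_
  · rw [← ha']; linarith
  · rw [hb]; linarith
  · rw [← ha', ← hcm]
    have : m * p * (cm * f) * η ≤ K * η := mul_le_mul_of_nonneg_right (by linarith) hη
    linarith

end SysIdPerturbation

/-! ### Contractivity of the predictor matrix and summability of powers. -/

section Stability

variable {n m p : ℕ}

lemma norm_toLp_sq_eq_dotProduct {α : Type*} [Fintype α] (v : α → ℝ) :
    ‖WithLp.toLp 2 v‖ ^ 2 = v ⬝ᵥ v := by
  rw [EuclideanSpace.real_norm_sq_eq]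
  simp [dotProduct, sq]

lemma dotProduct_mul_transpose_mulVec {α β : Type*} [Fintype α] [Fintype β] (M : Matrix α β ℝ)
    (v : α → ℝ) : v ⬝ᵥ ((M * Mᵀ) *ᵥ v) = (Mᵀ *ᵥ v) ⬝ᵥ (Mᵀ *ᵥ v) := by
  rw [← Matrix.mulVec_mulVec, Matrix.dotProduct_mulVec, ← Matrix.mulVec_transpose]

lemma innovCov_posDef {C : Matrix (Fin m) (Fin n) ℝ} {Sig : Matrix (Fin n) (Fin n) ℝ} {σz : ℝ}
    (hS : Sig.PosSemidef) (hσz : 0 < σz) : (innovCov C Sig σz).PosDef := by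
  have h1 : (C * Sig * Cᵀ).PosSemidef := by
    simpa using hS.mul_mul_conjTranspose_same C
  have h2 : (σz ^ 2 • (1 : Matrix (Fin m) (Fin m) ℝ)).PosDef :=
    Matrix.PosDef.one.smul (by positivity)
  exact Matrix.PosDef.posSemidef_add h1 h2

lemma kalmanGain_mul_innovCov {A : Matrix (Fin n) (Fin n) ℝ} {C : Matrix (Fin m) (Fin n) ℝ}
    {Sig : Matrix (Fin n) (Fin n) ℝ} {σz : ℝ} (hS : Sig.PosSemidef) (hσz : 0 < σz) :
    kalmanGain A C Sig σz * innovCov C Sig σz = A * Sig * Cᵀ := by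
  unfold kalmanGain
  rw [Matrix.mul_assoc, Matrix.nonsing_inv_mul _
    ((Matrix.isUnit_iff_isUnit_det _).1 (innovCov_posDef hS hσz).isUnit), Matrix.mul_one]

/-- The Riccati equation as a Lyapunov equation for the predictor matrix. -/
lemma IsDARESolution.lyapunov {A : Matrix (Fin n) (Fin n) ℝ} {C : Matrix (Fin m) (Fin n) ℝ}
    {σw σz : ℝ} {Sig : Matrix (Fin n) (Fin n) ℝ} (h : IsDARESolution A C σw σz Sig)
    (hσz : 0 < σz) :
    Sig = predictorMatrix A C Sig σz * Sig * (predictorMatrix A C Sig σz)ᵀ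
      + σw ^ 2 • (1 : Matrix (Fin n) (Fin n) ℝ)
      + σz ^ 2 • (kalmanGain A C Sig σz * (kalmanGain A C Sig σz)ᵀ) := by
  have hF := kalmanGain_mul_innovCov (A := A) (C := C) h.posSemidef hσz
  have hric := h.riccati
  set F := kalmanGain A C Sig σz with hFd
  have h1 : F * C * Sig * Aᵀ
      = A * Sig * Cᵀ * (innovCov C Sig σz)⁻¹ * C * Sig * Aᵀ := by rw [hFd, kalmanGain]
  have h2 : F * C * Sig * Cᵀ * Fᵀ + σz ^ 2 • (F * Fᵀ) = A * Sig * Cᵀ * Fᵀ := by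
    rw [← hF, innovCov, Matrix.mul_add, Matrix.add_mul, Matrix.mul_smul, Matrix.mul_one,
      Matrix.smul_mul]
    simp only [Matrix.mul_assoc]
  rw [← h1] at hric
  conv_lhs => rw [hric]
  have h3 : predictorMatrix A C Sig σz * Sig * (predictorMatrix A C Sig σz)ᵀ
      = A * Sig * Aᵀ - F * C * Sig * Aᵀ - A * Sig * Cᵀ * Fᵀ + F * C * Sig * Cᵀ * Fᵀ := by
    unfold predictorMatrix
    rw [← hFd, Matrix.transpose_sub, Matrix.transpose_mul]
    simp only [Matrix.sub_mul, Matrix.mul_sub, Matrix.mul_assoc]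
    abel
  rw [h3, ← h2]
  abel

open scoped MatrixOrder in
lemma exists_eq_mul_transpose {S : Matrix (Fin n) (Fin n) ℝ} (h : S.PosSemidef) :
    ∃ R : Matrix (Fin n) (Fin n) ℝ, S = R * Rᵀ := by
  obtain ⟨Q, hQ⟩ := CStarAlgebra.nonneg_iff_eq_star_mul_self.1 h.nonneg
  exact ⟨Qᵀ, by rw [Matrix.transpose_transpose, hQ, Matrix.star_eq_conjTranspose,
    Matrix.conjTranspose_eq_transpose_of_trivial]⟩

/-- With `Σ = R Rᵀ` and `X = R⁻¹ Ā R`, the Lyapunov identity reads `X Xᵀ = 1 - σw² R⁻¹ R⁻ᵀ - σz²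
(R⁻¹ F)(R⁻¹ F)ᵀ`. Dropping the last term and bounding `R⁻¹ R⁻ᵀ` from below in terms of `‖Rᵀ‖` shows
that `X` contracts strictly. -/
lemma IsDARESolution.exists_contraction {A : Matrix (Fin n) (Fin n) ℝ}
    {C : Matrix (Fin m) (Fin n) ℝ} {σw σz : ℝ} {Sig : Matrix (Fin n) (Fin n) ℝ}
    (h : IsDARESolution A C σw σz Sig) (hσw : 0 < σw) (hσz : 0 < σz) :
    ∃ υ : ℝ, 0 < υ ∧ υ < 1 ∧ IsSimilarToContraction (predictorMatrix A C Sig σz) υ := by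
  have hly := h.lyapunov hσz
  set M := predictorMatrix A C Sig σz with hM
  set F := kalmanGain A C Sig σz with hF
  have hpd : Sig.PosDef := by
    rw [hly, add_assoc]
    refine Matrix.PosDef.posSemidef_add ?_ (Matrix.PosDef.add_posSemidef ?_ ?_)
    · simpa using h.posSemidef.mul_mul_conjTranspose_same M
    · exact Matrix.PosDef.one.smul (by positivity)
    · have := (Matrix.posSemidef_self_mul_conjTranspose F)
      rw [Matrix.conjTranspose_eq_transpose_of_trivial] at this
      exact this.smul (sq_nonneg σz)
  obtain ⟨R, hR⟩ := exists_eq_mul_transpose h.posSemidef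
  have hRu : IsUnit R.det := by
    have h1 : IsUnit Sig.det := (Matrix.isUnit_iff_isUnit_det _).1 hpd.isUnit
    rw [hR, Matrix.det_mul] at h1
    exact isUnit_of_mul_isUnit_left h1
  have hRi : R⁻¹ * R = 1 := Matrix.nonsing_inv_mul _ hRu
  have hRt : Rᵀ * R⁻¹ᵀ = 1 := by rw [← Matrix.transpose_mul, hRi, Matrix.transpose_one]
  set X := R⁻¹ * M * R with hX
  have hXX : X * Xᵀ = 1 - σw ^ 2 • (R⁻¹ * R⁻¹ᵀ) - σz ^ 2 • ((R⁻¹ * F) * (R⁻¹ * F)ᵀ) := by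
    have h1 : M * Sig * Mᵀ = Sig - σw ^ 2 • (1 : Matrix (Fin n) (Fin n) ℝ) - σz ^ 2 • (F * Fᵀ) := by
      conv_rhs => rw [hly]
      abel
    have h2 : X * Xᵀ = R⁻¹ * (M * Sig * Mᵀ) * R⁻¹ᵀ := by
      rw [hX, hR]
      simp only [Matrix.transpose_mul, Matrix.mul_assoc]
    rw [h2, h1, Matrix.mul_sub, Matrix.mul_sub, Matrix.sub_mul, Matrix.sub_mul]
    congr 1
    · congr 1
      · rw [hR, ← Matrix.mul_assoc, hRi, Matrix.one_mul, hRt]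
      · rw [Matrix.mul_smul, Matrix.mul_one, Matrix.smul_mul]
    · rw [Matrix.mul_smul, Matrix.smul_mul, Matrix.transpose_mul]
      simp only [Matrix.mul_assoc]
  -- The denominator is larger than `‖Rᵀ‖ ^ 2` so that `c < 1` always holds and the rate `√(1 - c)`
  -- is positive.
  set c : ℝ := σw ^ 2 / (1 + ‖Rᵀ‖ ^ 2 + σw ^ 2) with hc
  have hσ2 : 0 < σw ^ 2 := by positivity
  have hden : 0 < 1 + ‖Rᵀ‖ ^ 2 + σw ^ 2 := by positivity
  have hc0 : 0 < c := by positivity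
  have hc1 : c < 1 := by
    rw [hc, div_lt_one hden]; nlinarith [sq_nonneg ‖Rᵀ‖]
  refine ⟨√(1 - c), Real.sqrt_pos.2 (by linarith), ?_, R⁻¹, ?_, ?_⟩
  · rw [Real.sqrt_lt' one_pos]; linarith
  · exact Matrix.isUnit_nonsing_inv_det _ hRu
  rw [Matrix.nonsing_inv_nonsing_inv _ hRu, ← hX, ← norm_transpose_eq, Matrix.l2_opNorm_def]
  refine ContinuousLinearMap.opNorm_le_bound _ (Real.sqrt_nonneg _) fun x => ?_
  change ‖WithLp.toLp 2 (Xᵀ *ᵥ x.ofLp)‖ ≤ _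
  rw [← Real.sqrt_sq (norm_nonneg x), ← Real.sqrt_mul (by linarith)]
  refine Real.le_sqrt_of_sq_le ?_
  obtain ⟨v, rfl⟩ : ∃ v : Fin n → ℝ, x = WithLp.toLp 2 v := ⟨x.ofLp, rfl⟩
  have e1 : ‖WithLp.toLp 2 (Xᵀ *ᵥ v)‖ ^ 2 = ‖WithLp.toLp 2 v‖ ^ 2
      - σw ^ 2 * ‖WithLp.toLp 2 (R⁻¹ᵀ *ᵥ v)‖ ^ 2
      - σz ^ 2 * ‖WithLp.toLp 2 ((R⁻¹ * F)ᵀ *ᵥ v)‖ ^ 2 := by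
    simp only [norm_toLp_sq_eq_dotProduct]
    rw [← dotProduct_mul_transpose_mulVec X, hXX, Matrix.sub_mulVec, Matrix.sub_mulVec,
      Matrix.one_mulVec, Matrix.smul_mulVec, Matrix.smul_mulVec, dotProduct_sub, dotProduct_sub,
      dotProduct_smul, dotProduct_smul, dotProduct_mul_transpose_mulVec,
      dotProduct_mul_transpose_mulVec, smul_eq_mul, smul_eq_mul]
  have e2 : ‖WithLp.toLp 2 v‖ ≤ ‖Rᵀ‖ * ‖WithLp.toLp 2 (R⁻¹ᵀ *ᵥ v)‖ := by
    have := norm_toLp_mulVec_le Rᵀ (R⁻¹ᵀ *ᵥ v)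
    rwa [Matrix.mulVec_mulVec, hRt, Matrix.one_mulVec] at this
  have e3 : ‖WithLp.toLp 2 v‖ ^ 2 ≤ ‖Rᵀ‖ ^ 2 * ‖WithLp.toLp 2 (R⁻¹ᵀ *ᵥ v)‖ ^ 2 := by
    rw [← mul_pow]; exact pow_le_pow_left₀ (norm_nonneg _) e2 2
  have e4 : c * ‖WithLp.toLp 2 v‖ ^ 2 ≤ σw ^ 2 * ‖WithLp.toLp 2 (R⁻¹ᵀ *ᵥ v)‖ ^ 2 := by
    rw [hc, div_mul_eq_mul_div, div_le_iff₀ hden, mul_assoc]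
    refine mul_le_mul_of_nonneg_left (e3.trans ?_) hσ2.le
    rw [mul_comm]
    exact mul_le_mul_of_nonneg_left (by linarith) (sq_nonneg _)
  have e5 : 0 ≤ σz ^ 2 * ‖WithLp.toLp 2 ((R⁻¹ * F)ᵀ *ᵥ v)‖ ^ 2 := by positivity
  change ‖WithLp.toLp 2 (Xᵀ *ᵥ v)‖ ^ 2 ≤ _
  linarith

lemma IsSimilarToContraction.exists_norm_pow_le {M : Matrix (Fin n) (Fin n) ℝ} {υ : ℝ}
    (h : IsSimilarToContraction M υ) :
    ∃ c : ℝ, 0 ≤ c ∧ ∀ k, ‖M ^ k‖ ≤ c * υ ^ k := by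
  obtain ⟨P, hP, hPn⟩ := h
  refine ⟨‖P⁻¹‖ * ‖P‖, by positivity, fun k => ?_⟩
  have h1 : ∀ k, ‖(P * M * P⁻¹) ^ k‖ ≤ υ ^ k := by
    intro k
    induction k with
    | zero => simpa using norm_one_le_one
    | succ k ih => rw [pow_succ, pow_succ]; exact l2_norm_mul_le_of_le ih hPn
  have h2 : P⁻¹ * (P * M * P⁻¹) * P = M := by
    calc _ = (P⁻¹ * P) * M * (P⁻¹ * P) := by simp only [Matrix.mul_assoc]
      _ = M := by rw [Matrix.nonsing_inv_mul _ hP, Matrix.one_mul, Matrix.mul_one]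
  have h3 := conj_pow hP (P * M * P⁻¹) k
  rw [h2] at h3
  rw [h3]
  exact (l2_norm_mul_le_of_le (l2_norm_mul_le_of_le le_rfl (h1 k)) le_rfl).trans
    (le_of_eq (by ring))

lemma exists_sum_norm_pow_le_of_geometric {M : Matrix (Fin n) (Fin n) ℝ} {c υ : ℝ}
    (hυ0 : 0 ≤ υ) (hυ : υ < 1) (hM : ∀ k, ‖M ^ k‖ ≤ c * υ ^ k) :
    ∃ a : ℝ, ∀ N, ∑ k ∈ Finset.range N, ‖M ^ k‖ ≤ a := by
  have hs : Summable fun k => ‖M ^ k‖ :=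
    Summable.of_nonneg_of_le (fun _ => norm_nonneg _) hM
      ((summable_geometric_of_lt_one hυ0 hυ).mul_left c)
  exact ⟨∑' k, ‖M ^ k‖, fun N => hs.sum_le_tsum _ fun _ _ => norm_nonneg _⟩

lemma norm_entry_le_l2_opNorm_complex (M : Matrix (Fin n) (Fin n) ℂ) (i j : Fin n) :
    ‖M i j‖ ≤ ‖M‖ := by
  have h := Matrix.l2_opNorm_mulVec M (WithLp.toLp 2 (Pi.single j 1))
  have h2 : ‖(WithLp.toLp 2 (Pi.single j (1 : ℂ)) : EuclideanSpace ℂ (Fin n))‖ = 1 := by simp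
  rw [h2, mul_one] at h
  refine le_trans ?_ h
  have := PiLp.norm_apply_le (WithLp.toLp 2 (M *ᵥ Pi.single j (1 : ℂ))) i
  simpa using this

/-- Gelfand's formula over `ℂ` gives `‖A ^ k‖ ≤ r ^ k` eventually, for some `r < 1` above the
spectral radius. The passage to the real spectral norm goes through the entries and costs a factor
`n * n`. -/
lemma IsSchurStable.exists_sum_norm_pow_le {A : Matrix (Fin n) (Fin n) ℝ} (h : IsSchurStable A) :
    ∃ a : ℝ, ∀ N, ∑ k ∈ Finset.range N, ‖A ^ k‖ ≤ a := by
  set Ac : Matrix (Fin n) (Fin n) ℂ := A.map (algebraMap ℝ ℂ) with hAc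
  have : CompleteSpace (Matrix (Fin n) (Fin n) ℂ) := FiniteDimensional.complete ℂ _
  have hlim := spectrum.pow_nnnorm_pow_one_div_tendsto_nhds_spectralRadius Ac
  obtain ⟨r, hr1, hr2⟩ := ENNReal.lt_iff_exists_nnreal_btwn.1 (show spectralRadius ℂ Ac < 1 from h)
  have hev := hlim.eventually_lt_const hr1
  have hr : (r : ℝ) < 1 := by exact_mod_cast hr2
  have hb : ∀ᶠ k : ℕ in Filter.atTop, ‖A ^ k‖ ≤ n * n * (r : ℝ) ^ k := by
    filter_upwards [hev, Filter.eventually_ge_atTop 1] with k hk hk1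
    have hk0 : (0 : ℝ) < k := by exact_mod_cast hk1
    have h1 : ‖Ac ^ k‖₊ ≤ r ^ k := by
      have h2 := ENNReal.rpow_le_rpow hk.le hk0.le
      rw [← ENNReal.rpow_mul, one_div, inv_mul_cancel₀ hk0.ne', ENNReal.rpow_one,
        ENNReal.rpow_natCast] at h2
      exact_mod_cast h2
    have h3 : ‖Ac ^ k‖ ≤ (r : ℝ) ^ k := by exact_mod_cast h1
    have h4 := norm_le_of_abs_entry_le (A ^ k) (pow_nonneg r.2 k) fun i j => by
      have h5 := (norm_entry_le_l2_opNorm_complex (Ac ^ k) i j).trans h3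
      rw [hAc, ← Matrix.map_pow] at h5
      simpa using h5
    simpa using h4
  have hs : Summable fun k => ‖A ^ k‖ := by
    refine summable_of_isBigO_nat
      ((summable_geometric_of_lt_one r.2 hr).mul_left (n * n : ℝ)) ?_
    refine Asymptotics.IsBigO.of_bound 1 ?_
    filter_upwards [hb] with k hk
    rw [norm_norm, one_mul]
    exact hk.trans (le_abs_self _)
  exact ⟨∑' k, ‖A ^ k‖, fun N => hs.sum_le_tsum _ fun _ _ => norm_nonneg _⟩

end Stability

/-! ### Ridge regression under persistent excitation. -/

section Ridge

variable {m p : ℕ}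

lemma dotProduct_designMatrix_mulVec (h : ℕ) (lam : ℝ) (y : ℕ → EuclideanSpace ℝ (Fin m))
    (u : ℕ → EuclideanSpace ℝ (Fin p)) (T : ℕ) (d : ArxIdx m p h → ℝ) :
    d ⬝ᵥ (designMatrix h lam y u T *ᵥ d)
      = lam * (d ⬝ᵥ d) + ∑ t ∈ Finset.Icc h T, (regressor h y u t ⬝ᵥ d) ^ 2 := by
  unfold designMatrix
  rw [Matrix.add_mulVec, dotProduct_add, Matrix.smul_mulVec, Matrix.one_mulVec, dotProduct_smul,
    smul_eq_mul, Matrix.sum_mulVec, dotProduct_sum]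
  congr 1
  refine Finset.sum_congr rfl fun t _ => ?_
  rw [Matrix.vecMulVec_mulVec, dotProduct_smul, dotProduct_comm d]
  simp [sq]

/-- Estimation error of ridge regression under persistent excitation. -/
lemma frobSq_sub_le_of_isRidgeEstimate {h : ℕ} {lam σs : ℝ} {y : ℕ → EuclideanSpace ℝ (Fin m)}
    {u : ℕ → EuclideanSpace ℝ (Fin p)} {T : ℕ} {G G₀ : Matrix (Fin m) (ArxIdx m p h) ℝ}
    (hσs : 0 < σs) (hT : 0 < T) (hpe : PersistentlyExciting h lam σs y u T)
    (hG : IsRidgeEstimate h lam y u T G) {b : ℝ}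
    (hb : ∀ i c, |∑ t ∈ Finset.Icc h T, (y t i - (G₀ *ᵥ regressor h y u t) i)
      * regressor h y u t c - lam * G₀ i c| ≤ b) :
    frobSq (G - G₀) ≤ (m * (h * m + h * p)) * (2 * b / (σs ^ 2 * T)) ^ 2 := by
  set D := G - G₀ with hD
  set φ := regressor h y u with hφ
  have hGD : G = G₀ + D := by rw [hD]; abel
  have hTp : (0 : ℝ) < T := by exact_mod_cast hT
  have hsT : 0 < σs ^ 2 * (T : ℝ) := by positivity
  have hobj : ∀ X : Matrix (Fin m) (ArxIdx m p h) ℝ, ridgeObjective h lam y u T X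
      = ∑ i, (lam * ∑ c, X i c ^ 2 + ∑ t ∈ Finset.Icc h T, (y t i - (X *ᵥ φ t) i) ^ 2) := by
    intro X
    unfold ridgeObjective frobSq
    rw [Finset.sum_add_distrib, Finset.mul_sum, Finset.sum_comm (s := Finset.univ)]
    congr 1
    refine Finset.sum_congr rfl fun t _ => ?_
    rw [EuclideanSpace.real_norm_sq_eq]
    rfl
  -- The objective splits over rows and is quadratic: the increment from `G₀` to `G` in row `i`
  -- equals `D_iᵀ V_T D_i` minus twice the pairing of `D_i` with the score at `G₀`. Excitation
  -- bounds the quadratic term from below.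
  have hrow : ∀ i, σs ^ 2 * T * ∑ c, D i c ^ 2
      ≤ (lam * ∑ c, G i c ^ 2 + ∑ t ∈ Finset.Icc h T, (y t i - (G *ᵥ φ t) i) ^ 2)
        - (lam * ∑ c, G₀ i c ^ 2 + ∑ t ∈ Finset.Icc h T, (y t i - (G₀ *ᵥ φ t) i) ^ 2)
        + 2 * ∑ c, D i c * (∑ t ∈ Finset.Icc h T, (y t i - (G₀ *ᵥ φ t) i) * φ t c
          - lam * G₀ i c) := by
    intro i
    have h1 := hpe.dotProduct_mulVec_nonneg (D i)
    rw [star_trivial, Matrix.sub_mulVec, dotProduct_sub, dotProduct_designMatrix_mulVec,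
      Matrix.smul_mulVec, Matrix.one_mulVec, dotProduct_smul, smul_eq_mul] at h1
    have e1 : D i ⬝ᵥ D i = ∑ c, D i c ^ 2 := by simp [dotProduct, sq]
    have e2 : ∑ c, G i c ^ 2
        = ∑ c, G₀ i c ^ 2 + 2 * ∑ c, D i c * G₀ i c + ∑ c, D i c ^ 2 := by
      rw [Finset.mul_sum, ← Finset.sum_add_distrib, ← Finset.sum_add_distrib]
      refine Finset.sum_congr rfl fun c _ => ?_
      rw [hGD, Matrix.add_apply]; ring
    have e3 : ∀ t, (G *ᵥ φ t) i = (G₀ *ᵥ φ t) i + φ t ⬝ᵥ D i := by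
      intro t
      rw [hGD, Matrix.add_mulVec, Pi.add_apply, dotProduct_comm (φ t)]
      rfl
    have e4 : ∑ t ∈ Finset.Icc h T, (y t i - (G *ᵥ φ t) i) ^ 2
        = ∑ t ∈ Finset.Icc h T, (y t i - (G₀ *ᵥ φ t) i) ^ 2
          - 2 * ∑ t ∈ Finset.Icc h T, (y t i - (G₀ *ᵥ φ t) i) * (φ t ⬝ᵥ D i)
          + ∑ t ∈ Finset.Icc h T, (φ t ⬝ᵥ D i) ^ 2 := by
      rw [Finset.mul_sum, ← Finset.sum_sub_distrib, ← Finset.sum_add_distrib]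
      refine Finset.sum_congr rfl fun t _ => ?_
      rw [e3]; ring
    have e5 : ∑ t ∈ Finset.Icc h T, (y t i - (G₀ *ᵥ φ t) i) * (φ t ⬝ᵥ D i)
        = ∑ c, D i c * ∑ t ∈ Finset.Icc h T, (y t i - (G₀ *ᵥ φ t) i) * φ t c := by
      simp only [dotProduct, Finset.mul_sum]
      rw [Finset.sum_comm]
      refine Finset.sum_congr rfl fun c _ => Finset.sum_congr rfl fun t _ => by ring
    have e6 : ∑ c, D i c * (∑ t ∈ Finset.Icc h T, (y t i - (G₀ *ᵥ φ t) i) * φ t c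
          - lam * G₀ i c)
        = ∑ c, D i c * (∑ t ∈ Finset.Icc h T, (y t i - (G₀ *ᵥ φ t) i) * φ t c)
          - lam * ∑ c, D i c * G₀ i c := by
      rw [Finset.mul_sum, ← Finset.sum_sub_distrib]
      refine Finset.sum_congr rfl fun c _ => by ring
    rw [e6, e4, e5, e2]
    rw [e1] at h1
    linarith
  -- Minimality is needed only against the competitor `G₀`, after summing over rows; neither the
  -- normal equations nor an inverse of `V_T` is required.
  have hmain : σs ^ 2 * T * frobSq D ≤ 2 * b * ∑ i, ∑ c, |D i c| := by
    have h1 := hG G₀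
    rw [hobj, hobj] at h1
    have h2 := Finset.sum_le_sum fun i (_ : i ∈ Finset.univ) => hrow i
    rw [← Finset.mul_sum, Finset.sum_add_distrib, Finset.sum_sub_distrib, ← Finset.mul_sum] at h2
    have h3 : ∑ i, ∑ c, D i c * (∑ t ∈ Finset.Icc h T, (y t i - (G₀ *ᵥ φ t) i) * φ t c
        - lam * G₀ i c) ≤ b * ∑ i, ∑ c, |D i c| := by
      rw [Finset.mul_sum]
      refine Finset.sum_le_sum fun i _ => ?_
      rw [Finset.mul_sum]
      refine Finset.sum_le_sum fun c _ => ?_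
      refine (le_abs_self _).trans ?_
      rw [abs_mul, mul_comm]
      exact mul_le_mul_of_nonneg_right (hb i c) (abs_nonneg _)
    unfold frobSq
    linarith
  have hcs : (∑ i, ∑ c, |D i c|) ^ 2 ≤ (m * (h * m + h * p)) * frobSq D := by
    have h1 := sq_sum_le_card_mul_sum_sq (s := Finset.univ)
      (f := fun ic : Fin m × ArxIdx m p h => |D ic.1 ic.2|)
    rw [Fintype.sum_prod_type, Fintype.sum_prod_type] at h1
    simpa [frobSq] using h1
  set S := ∑ i, ∑ c, |D i c| with hS
  have hfr := frobSq_nonneg D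
  rcases hfr.eq_or_lt with h0 | hpos
  · rw [← h0]; positivity
  have h5 : (σs ^ 2 * T * frobSq D) ^ 2 ≤ (2 * b) ^ 2 * ((m * (h * m + h * p)) * frobSq D) := by
    calc _ ≤ (2 * b * S) ^ 2 := pow_le_pow_left₀ (by positivity) hmain 2
      _ = (2 * b) ^ 2 * S ^ 2 := by ring
      _ ≤ _ := mul_le_mul_of_nonneg_left hcs (sq_nonneg _)
  rw [div_pow, ← mul_div_assoc, le_div_iff₀ (by positivity)]
  refine le_of_mul_le_mul_right ?_ hpos
  linarith

end Ridge

/-! ### The Kalman predictor along a path and the score at the true parameters. -/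

section Predictor

variable {n m p : ℕ}

lemma linear_recursion {M : Matrix (Fin n) (Fin n) ℝ} {v g : ℕ → Fin n → ℝ}
    (hv : ∀ t, v (t + 1) = M *ᵥ v t + g t) (s h : ℕ) :
    v (s + h) = M ^ h *ᵥ v s + ∑ k ∈ Finset.range h, M ^ k *ᵥ g (s + h - 1 - k) := by
  induction h with
  | zero => simp
  | succ h ih =>
    rw [← add_assoc, hv, ih, Finset.sum_range_succ', Matrix.mulVec_add, Matrix.mulVec_mulVec,
      ← pow_succ', Matrix.mulVec_sum, add_assoc]
    congr 1
    congr 1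
    · refine Finset.sum_congr rfl fun k _ => ?_
      rw [Matrix.mulVec_mulVec, ← pow_succ']
      congr 2
      omega
    · simp

lemma norm_linear_recursion_le {M : Matrix (Fin n) (Fin n) ℝ} {v g : ℕ → Fin n → ℝ}
    (hv : ∀ t, v (t + 1) = M *ᵥ v t + g t) {a b₀ b : ℝ}
    (ha : ∀ N, ∑ k ∈ Finset.range N, ‖M ^ k‖ ≤ a) (h0 : ‖WithLp.toLp 2 (v 0)‖ ≤ b₀) {t : ℕ}
    (hb0 : 0 ≤ b) (hg : ∀ s < t, ‖WithLp.toLp 2 (g s)‖ ≤ b) :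
    ‖WithLp.toLp 2 (v t)‖ ≤ a * (b₀ + b) := by
  have hrec := linear_recursion hv 0 t
  simp only [zero_add] at hrec
  have hMt : ‖M ^ t‖ ≤ a :=
    (Finset.single_le_sum (f := fun k => ‖M ^ k‖) (fun _ _ => norm_nonneg _)
      (Finset.self_mem_range_succ t)).trans (ha (t + 1))
  have ha0 : 0 ≤ a := (norm_nonneg _).trans hMt
  rw [hrec, WithLp.toLp_add, WithLp.toLp_sum, mul_add]
  refine (norm_add_le _ _).trans (add_le_add ?_ ?_)
  · exact (norm_toLp_mulVec_le _ _).trans (mul_le_mul hMt h0 (norm_nonneg _) ha0)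
  · refine (norm_sum_le _ _).trans ?_
    calc _ ≤ ∑ k ∈ Finset.range t, ‖M ^ k‖ * b := by
          refine Finset.sum_le_sum fun k hk => (norm_toLp_mulVec_le _ _).trans ?_
          have := Finset.mem_range.1 hk
          exact mul_le_mul_of_nonneg_left (hg _ (by omega)) (norm_nonneg _)
      _ ≤ a * b := by
          rw [← Finset.sum_mul]
          exact mul_le_mul_of_nonneg_right (ha t) hb0

/-- The steady-state one-step state predictor started at zero. -/
def predState (M : Matrix (Fin n) (Fin n) ℝ) (F : Matrix (Fin n) (Fin m) ℝ)
    (B : Matrix (Fin n) (Fin p) ℝ) (y : ℕ → EuclideanSpace ℝ (Fin m))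
    (u : ℕ → EuclideanSpace ℝ (Fin p)) : ℕ → EuclideanSpace ℝ (Fin n)
  | 0 => 0
  | t + 1 => WithLp.toLp 2 (M *ᵥ (predState M F B y u t).ofLp
      + (F *ᵥ (y t).ofLp + B *ᵥ (u t).ofLp))

/-- The one-step prediction error `y_t - C x̂_t`. -/
def predError (M : Matrix (Fin n) (Fin n) ℝ) (F : Matrix (Fin n) (Fin m) ℝ)
    (B : Matrix (Fin n) (Fin p) ℝ) (C : Matrix (Fin m) (Fin n) ℝ)
    (y : ℕ → EuclideanSpace ℝ (Fin m)) (u : ℕ → EuclideanSpace ℝ (Fin p)) (t : ℕ) :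
    EuclideanSpace ℝ (Fin m) :=
  y t - WithLp.toLp 2 (C *ᵥ (predState M F B y u t).ofLp)

variable (M : Matrix (Fin n) (Fin n) ℝ) (F : Matrix (Fin n) (Fin m) ℝ)
  (B : Matrix (Fin n) (Fin p) ℝ) (C : Matrix (Fin m) (Fin n) ℝ)
  (y : ℕ → EuclideanSpace ℝ (Fin m)) (u : ℕ → EuclideanSpace ℝ (Fin p))

lemma extCtrb_mulVec_regressor (h t : ℕ) :
    extCtrb h M F B *ᵥ regressor h y u t = ∑ k ∈ Finset.range h,
      M ^ k *ᵥ (F *ᵥ (y (t - 1 - k)).ofLp + B *ᵥ (u (t - 1 - k)).ofLp) := by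
  rw [Finset.sum_range]
  ext i
  simp only [Matrix.mulVec_add, Matrix.mulVec_mulVec]
  rw [Finset.sum_add_distrib, Pi.add_apply, Finset.sum_apply, Finset.sum_apply]
  simp only [Matrix.mulVec, dotProduct, Fintype.sum_sum_type, Fintype.sum_prod_type]
  rfl

lemma predState_eq {h t : ℕ} (ht : h ≤ t) :
    (predState M F B y u t).ofLp = M ^ h *ᵥ (predState M F B y u (t - h)).ofLp
      + extCtrb h M F B *ᵥ regressor h y u t := by
  have h1 := linear_recursion (M := M) (v := fun t => (predState M F B y u t).ofLp)
    (g := fun t => F *ᵥ (y t).ofLp + B *ᵥ (u t).ofLp) (fun t => rfl) (t - h) h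
  rw [extCtrb_mulVec_regressor]
  have e : t - h + h = t := by omega
  simp only [e] at h1
  exact h1

/-- Unrolling the predictor for `h` steps expresses it through the `h` lags in the regressor; all
older data survive only in the truncation term `C M ^ h x̂_{t-h}`. -/
lemma residual_eq {h t : ℕ} (ht : h ≤ t) (i : Fin m) :
    y t i - ((C * extCtrb h M F B) *ᵥ regressor h y u t) i
      = predError M F B C y u t i + ((C * M ^ h) *ᵥ (predState M F B y u (t - h)).ofLp) i := by
  have h1 := predState_eq M F B y u ht
  unfold predError
  rw [PiLp.sub_apply, h1, Matrix.mulVec_add, Matrix.mulVec_mulVec, Matrix.mulVec_mulVec]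
  simp only [Pi.add_apply]
  ring

/-- States, outputs and predictor states of a stable system are bounded linearly in the size of
noise and input. -/
lemma exists_trajectory_bound (A : Matrix (Fin n) (Fin n) ℝ) {a : ℝ}
    (haM : ∀ N, ∑ k ∈ Finset.range N, ‖M ^ k‖ ≤ a)
    (haA : ∀ N, ∑ k ∈ Finset.range N, ‖A ^ k‖ ≤ a) :
    ∃ c : ℝ, 1 ≤ c ∧ ∀ (T : ℕ) (ρ : ℝ) (x w : ℕ → EuclideanSpace ℝ (Fin n))
      (y z : ℕ → EuclideanSpace ℝ (Fin m)) (u : ℕ → EuclideanSpace ℝ (Fin p)), 0 ≤ ρ →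
      (∀ t, (x (t + 1)).ofLp = A *ᵥ (x t).ofLp + B *ᵥ (u t).ofLp + (w t).ofLp) →
      (∀ t, (y t).ofLp = C *ᵥ (x t).ofLp + (z t).ofLp) →
      ‖x 0‖ ≤ ρ → (∀ t ≤ T, ‖w t‖ ≤ ρ) → (∀ t ≤ T, ‖z t‖ ≤ ρ) → (∀ t < T, ‖u t‖ ≤ ρ) →
      (∀ t ≤ T, ‖predState M F B y u t‖ ≤ c * ρ) ∧
      ∀ h t, 1 ≤ h → h ≤ t → t ≤ T → ∀ j, |regressor h y u t j| ≤ c * ρ := by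
  have ha0 : 0 ≤ a := by simpa using haA 0
  set cy : ℝ := ‖C‖ * (a * (1 + (‖B‖ + 1))) + 1 with hcy
  have hcy0 : 1 ≤ cy := by
    have : 0 ≤ ‖C‖ * (a * (1 + (‖B‖ + 1))) := by positivity
    linarith
  set cs : ℝ := a * (0 + (‖F‖ * cy + ‖B‖)) with hcs
  have hcs0 : 0 ≤ cs := by positivity
  refine ⟨cy + cs, by linarith, ?_⟩
  intro T ρ x w y z u hρ hx hy hx0 hw hz hu
  have hxb : ∀ t ≤ T, ‖x t‖ ≤ a * (ρ + (‖B‖ * ρ + ρ)) := by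
    intro t ht
    refine norm_linear_recursion_le (M := A) (v := fun t => (x t).ofLp)
      (g := fun t => B *ᵥ (u t).ofLp + (w t).ofLp)
      (fun t => by rw [hx, add_assoc]) haA hx0 (by positivity) fun s hs => ?_
    rw [WithLp.toLp_add]
    refine (norm_add_le _ _).trans (add_le_add ?_ (hw s (by omega)))
    exact (norm_toLp_mulVec_le B (u s).ofLp).trans
      (mul_le_mul_of_nonneg_left (hu s (by omega)) (norm_nonneg _))
  have hyb : ∀ t ≤ T, ‖y t‖ ≤ cy * ρ := by
    intro t ht
    have e : y t = WithLp.toLp 2 (C *ᵥ (x t).ofLp) + z t := by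
      apply WithLp.ofLp_injective; rw [hy]; rfl
    rw [e]
    calc _ ≤ ‖C‖ * (a * (ρ + (‖B‖ * ρ + ρ))) + ρ :=
          (norm_add_le _ _).trans (add_le_add ((norm_toLp_mulVec_le C (x t).ofLp).trans
            (mul_le_mul_of_nonneg_left (hxb t ht) (norm_nonneg _))) (hz t ht))
      _ = _ := by rw [hcy]; ring
  have hcρ : cy * ρ ≤ (cy + cs) * ρ := mul_le_mul_of_nonneg_right (by linarith) hρ
  have hsρ : cs * ρ ≤ (cy + cs) * ρ := mul_le_mul_of_nonneg_right (by linarith) hρ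
  have h1ρ : ρ ≤ (cy + cs) * ρ := by nlinarith
  refine ⟨fun t ht => ?_, fun h t hh hht ht j => ?_⟩
  · refine le_trans ?_ hsρ
    have h0 : ‖WithLp.toLp 2 ((predState M F B y u 0).ofLp)‖ ≤ 0 := by simp [predState]
    refine (norm_linear_recursion_le (M := M) (v := fun t => (predState M F B y u t).ofLp)
      (g := fun t => F *ᵥ (y t).ofLp + B *ᵥ (u t).ofLp) (fun t => rfl) haM h0 (t := t)
      (b := ‖F‖ * (cy * ρ) + ‖B‖ * ρ) (by positivity) fun s hs => ?_).trans
      (le_of_eq (by rw [hcs]; ring))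
    rw [WithLp.toLp_add]
    refine (norm_add_le _ _).trans (add_le_add ?_ ?_)
    · exact (norm_toLp_mulVec_le F (y s).ofLp).trans
        (mul_le_mul_of_nonneg_left (hyb s (by omega)) (norm_nonneg _))
    · exact (norm_toLp_mulVec_le B (u s).ofLp).trans
        (mul_le_mul_of_nonneg_left (hu s (by omega)) (norm_nonneg _))
  · rcases j with ⟨k, i⟩ | ⟨k, i⟩
    · exact ((PiLp.norm_apply_le (y (t - 1 - k)) i).trans (hyb _ (by omega))).trans hcρ
    · exact ((PiLp.norm_apply_le (u (t - 1 - k)) i).trans (hu _ (by omega))).trans h1ρ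

/-- Deterministic bound on the normal-equation residual at the true ARX parameters. -/
lemma exists_score_bound (A : Matrix (Fin n) (Fin n) ℝ) {a cb s lam : ℝ} (hs : 0 ≤ s)
    (hlam : 0 ≤ lam) (hcb : 0 ≤ cb)
    (haM : ∀ N, ∑ k ∈ Finset.range N, ‖M ^ k‖ ≤ a)
    (haA : ∀ N, ∑ k ∈ Finset.range N, ‖A ^ k‖ ≤ a) :
    ∃ K : ℝ, 0 ≤ K ∧ ∀ (T h : ℕ) (ρ ℓ : ℝ) (x w : ℕ → EuclideanSpace ℝ (Fin n))
      (y z : ℕ → EuclideanSpace ℝ (Fin m)) (u : ℕ → EuclideanSpace ℝ (Fin p)),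
      1 ≤ T → 1 ≤ h → 1 ≤ ρ → 0 ≤ ℓ →
      (∀ t, (x (t + 1)).ofLp = A *ᵥ (x t).ofLp + B *ᵥ (u t).ofLp + (w t).ofLp) →
      (∀ t, (y t).ofLp = C *ᵥ (x t).ofLp + (z t).ofLp) →
      ‖x 0‖ ≤ ρ → (∀ t ≤ T, ‖w t‖ ≤ ρ) → (∀ t ≤ T, ‖z t‖ ≤ ρ) → (∀ t < T, ‖u t‖ ≤ ρ) →
      ∀ (i : Fin m) (c : ArxIdx m p h), ‖M ^ h‖ * (T : ℝ) ^ 2 ≤ cb →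
      (∀ θ : ℝ, θ = (√T)⁻¹ ∨ θ = -(√T)⁻¹ →
        ∑ t ∈ Finset.Icc h T, (θ * regressor h y u t c * predError M F B C y u t i
          - θ ^ 2 * s * regressor h y u t c ^ 2 / 2) ≤ ℓ) →
      |∑ t ∈ Finset.Icc h T, (y t i - ((C * extCtrb h M F B) *ᵥ regressor h y u t) i)
        * regressor h y u t c - lam * (C * extCtrb h M F B) i c| ≤ √T * (K * (ℓ + ρ ^ 2)) := by
  have ha0 : 0 ≤ a := by simpa using haA 0
  obtain ⟨c₁, hc₁, hbd⟩ := exists_trajectory_bound M F B C A haM haA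
  set cG : ℝ := ‖C‖ * √(n * m * (‖F‖ ^ 2 * a ^ 2) + n * p * (‖B‖ ^ 2 * a ^ 2)) with hcG
  have hcG0 : 0 ≤ cG := by positivity
  refine ⟨1 + s * c₁ ^ 2 + ‖C‖ * cb * c₁ ^ 2 + lam * cG, by positivity, ?_⟩
  intro T h ρ ℓ x w y z u hT hh hρ hℓ hx hy hx0 hw hz hu i c hMh hexp
  obtain ⟨hps, hreg⟩ := hbd T ρ x w y z u (by linarith) hx hy hx0 hw hz hu
  set φ : ℕ → ℝ := fun t => regressor h y u t c with hφ
  set e : ℕ → ℝ := fun t => predError M F B C y u t i with he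
  set I := Finset.Icc h T with hI
  have hIcard : (I.card : ℝ) ≤ T := by
    rw [hI, Nat.card_Icc]; exact_mod_cast (by omega)
  have hTr : (1 : ℝ) ≤ T := by exact_mod_cast hT
  have hT0 : (0 : ℝ) < T := by linarith
  have hsq : 0 < √(T : ℝ) := Real.sqrt_pos.2 hT0
  have hsq1 : 1 ≤ √(T : ℝ) := Real.one_le_sqrt.2 hTr
  have hss : √(T : ℝ) * √(T : ℝ) = T := Real.mul_self_sqrt hT0.le
  have hφb : ∀ t ∈ I, |φ t| ≤ c₁ * ρ := fun t ht => by
    have := Finset.mem_Icc.1 ht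
    exact hreg h t hh this.1 this.2 c
  have hφ2 : ∑ t ∈ I, φ t ^ 2 ≤ T * (c₁ * ρ) ^ 2 := by
    calc _ ≤ ∑ _t ∈ I, (c₁ * ρ) ^ 2 := Finset.sum_le_sum fun t ht => by
          rw [← sq_abs]; exact pow_le_pow_left₀ (abs_nonneg _) (hφb t ht) 2
      _ = I.card * (c₁ * ρ) ^ 2 := by rw [Finset.sum_const, nsmul_eq_mul]
      _ ≤ _ := mul_le_mul_of_nonneg_right hIcard (sq_nonneg _)
  -- With `θ² = 1 / T` the quadratic compensator is at most a constant times `ρ ^ 2`, since `∑ φ² ≤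
  -- T (c₁ ρ)²`; the two signs of `θ` give the absolute value.
  have hmart : |∑ t ∈ I, e t * φ t| ≤ √T * (ℓ + s * (c₁ * ρ) ^ 2) := by
    have h2 : ∀ θ : ℝ, ∑ t ∈ I, (θ * φ t * e t - θ ^ 2 * s * φ t ^ 2 / 2)
        = θ * ∑ t ∈ I, e t * φ t - θ ^ 2 * s / 2 * ∑ t ∈ I, φ t ^ 2 := by
      intro θ
      rw [Finset.sum_sub_distrib, Finset.mul_sum, Finset.mul_sum]
      congr 1 <;> exact Finset.sum_congr rfl fun t _ => by ring
    have h3 : ∀ θ : ℝ, θ ^ 2 = (T : ℝ)⁻¹ → θ ^ 2 * s / 2 * ∑ t ∈ I, φ t ^ 2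
        ≤ s * (c₁ * ρ) ^ 2 := by
      intro θ hθ
      calc _ ≤ θ ^ 2 * s / 2 * (T * (c₁ * ρ) ^ 2) :=
            mul_le_mul_of_nonneg_left hφ2 (by positivity)
        _ = s * (c₁ * ρ) ^ 2 / 2 := by rw [hθ]; field_simp
        _ ≤ _ := by
            have : 0 ≤ s * (c₁ * ρ) ^ 2 := by positivity
            linarith
    have hθ2 : ((√(T : ℝ))⁻¹) ^ 2 = (T : ℝ)⁻¹ := by rw [inv_pow, Real.sq_sqrt hT0.le]
    have p1 := hexp _ (Or.inl rfl)
    have p2 := hexp _ (Or.inr rfl)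
    rw [h2] at p1 p2
    have q1 := h3 _ hθ2
    have q2 := h3 (-(√(T : ℝ))⁻¹) (by rw [neg_sq, hθ2])
    have r1 : (√(T : ℝ))⁻¹ * ∑ t ∈ I, e t * φ t ≤ ℓ + s * (c₁ * ρ) ^ 2 := by linarith
    have r2 : (√(T : ℝ))⁻¹ * -∑ t ∈ I, e t * φ t ≤ ℓ + s * (c₁ * ρ) ^ 2 := by linarith
    rw [inv_mul_le_iff₀ hsq] at r1 r2
    exact abs_le'.2 ⟨r1, r2⟩
  -- There are at most `T ≤ T ^ 2` summands, and `‖M ^ h‖ * T ^ 2` is bounded by hypothesis.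
  have hbias : |∑ t ∈ I, ((C * M ^ h) *ᵥ (predState M F B y u (t - h)).ofLp) i * φ t|
      ≤ ‖C‖ * cb * c₁ ^ 2 * ρ ^ 2 := by
    have hρ0 : 0 ≤ ρ := by linarith
    have hterm : ∀ t ∈ I, |((C * M ^ h) *ᵥ (predState M F B y u (t - h)).ofLp) i * φ t|
        ≤ ‖C‖ * ‖M ^ h‖ * (c₁ * ρ) * (c₁ * ρ) := by
      intro t ht
      rw [abs_mul]
      refine mul_le_mul ?_ (hφb t ht) (abs_nonneg _) (by positivity)
      have h1 := PiLp.norm_apply_le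
        (WithLp.toLp 2 ((C * M ^ h) *ᵥ (predState M F B y u (t - h)).ofLp)) i
      refine h1.trans ((norm_toLp_mulVec_le _ _).trans ?_)
      have h2 := hps (t - h) (by have := Finset.mem_Icc.1 ht; omega)
      exact mul_le_mul (Matrix.l2_opNorm_mul _ _) h2 (norm_nonneg _) (by positivity)
    refine (Finset.abs_sum_le_sum_abs _ _).trans ((Finset.sum_le_sum hterm).trans ?_)
    rw [Finset.sum_const, nsmul_eq_mul]
    have h4 : (I.card : ℝ) * ‖M ^ h‖ ≤ cb := by
      have h5 : (I.card : ℝ) ≤ (T : ℝ) ^ 2 := hIcard.trans (by nlinarith)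
      calc _ ≤ (T : ℝ) ^ 2 * ‖M ^ h‖ := mul_le_mul_of_nonneg_right h5 (norm_nonneg _)
        _ ≤ cb := by rw [mul_comm]; exact hMh
    calc _ = (I.card : ℝ) * ‖M ^ h‖ * (‖C‖ * (c₁ * ρ) ^ 2) := by ring
      _ ≤ cb * (‖C‖ * (c₁ * ρ) ^ 2) := mul_le_mul_of_nonneg_right h4 (by positivity)
      _ = _ := by ring
  have hG : |lam * (C * extCtrb h M F B) i c| ≤ lam * cG := by
    rw [abs_mul, abs_of_nonneg hlam]
    refine mul_le_mul_of_nonneg_left ((abs_entry_le_norm _ _ _).trans ?_) hlam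
    exact l2_norm_mul_le_of_le le_rfl
      ((norm_le_sqrt_frobSq _).trans (Real.sqrt_le_sqrt (frobSq_extCtrb_le M F B haM h)))
  have hdecomp : ∑ t ∈ I, (y t i - ((C * extCtrb h M F B) *ᵥ regressor h y u t) i) * φ t
      = ∑ t ∈ I, e t * φ t
        + ∑ t ∈ I, ((C * M ^ h) *ᵥ (predState M F B y u (t - h)).ofLp) i * φ t := by
    rw [← Finset.sum_add_distrib]
    refine Finset.sum_congr rfl fun t ht => ?_
    rw [residual_eq M F B C y u (Finset.mem_Icc.1 ht).1 i]
    ring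
  change |∑ t ∈ I, (y t i - ((C * extCtrb h M F B) *ᵥ regressor h y u t) i) * φ t - _| ≤ _
  rw [hdecomp]
  have hρ2 : 1 ≤ ρ ^ 2 := one_le_pow₀ hρ
  have hbig : 0 ≤ ‖C‖ * cb * c₁ ^ 2 * ρ ^ 2 + lam * cG := by positivity
  have f1 : ‖C‖ * cb * c₁ ^ 2 * ρ ^ 2 + lam * cG
      ≤ √T * (‖C‖ * cb * c₁ ^ 2 * ρ ^ 2 + lam * cG) := by nlinarith
  have f2 : lam * cG ≤ lam * cG * ρ ^ 2 := by
    have : 0 ≤ lam * cG := by positivity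
    nlinarith
  have f3 : ℓ + s * (c₁ * ρ) ^ 2 + (‖C‖ * cb * c₁ ^ 2 * ρ ^ 2 + lam * cG)
      ≤ (1 + s * c₁ ^ 2 + ‖C‖ * cb * c₁ ^ 2 + lam * cG) * (ℓ + ρ ^ 2) := by
    have g1 : 0 ≤ (s * c₁ ^ 2 + ‖C‖ * cb * c₁ ^ 2 + lam * cG) * ℓ := by positivity
    nlinarith
  calc _ ≤ |∑ t ∈ I, e t * φ t|
        + |∑ t ∈ I, ((C * M ^ h) *ᵥ (predState M F B y u (t - h)).ofLp) i * φ t|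
        + |lam * (C * extCtrb h M F B) i c| :=
        (abs_sub _ _).trans (add_le_add (abs_add_le _ _) le_rfl)
    _ ≤ √T * (ℓ + s * (c₁ * ρ) ^ 2) + ‖C‖ * cb * c₁ ^ 2 * ρ ^ 2 + lam * cG :=
        add_le_add (add_le_add hmart hbias) hG
    _ ≤ √T * (ℓ + s * (c₁ * ρ) ^ 2 + (‖C‖ * cb * c₁ ^ 2 * ρ ^ 2 + lam * cG)) := by
        rw [mul_add]; linarith
    _ ≤ _ := mul_le_mul_of_nonneg_left f3 hsq.le

end Predictor

/-! ### Regrouping independent σ-algebras. -/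

section Independence

variable {Ω : Type*} {mΩ : MeasurableSpace Ω} {μ : Measure Ω}

/-- On the π-system of intersections `A ∩ B`, which generates `m₂ ⊔ m₃`, the probability of `s ∩ A ∩
B` factors by applying the second hypothesis, the first, and the second again. -/
lemma indep_sup_right_of_indep_sup_left [IsProbabilityMeasure μ] {m₁ m₂ m₃ : MeasurableSpace Ω}
    (h₁ : m₁ ≤ mΩ) (h₂ : m₂ ≤ mΩ) (h₃ : m₃ ≤ mΩ) (h₁₂ : Indep m₁ m₂ μ)
    (h₁₂₃ : Indep (m₁ ⊔ m₂) m₃ μ) : Indep m₁ (m₂ ⊔ m₃) μ := by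
  set P : Set (Set Ω) := {s | ∃ A B, MeasurableSet[m₂] A ∧ MeasurableSet[m₃] B ∧ s = A ∩ B}
    with hP
  have hpi : IsPiSystem P := by
    rintro _ ⟨A, B, hA, hB, rfl⟩ _ ⟨A', B', hA', hB', rfl⟩ _
    exact ⟨A ∩ A', B ∩ B', hA.inter hA', hB.inter hB', Set.inter_inter_inter_comm A B A' B'⟩
  have hgen : m₂ ⊔ m₃ = MeasurableSpace.generateFrom P := by
    apply le_antisymm
    · refine sup_le (fun A hA => ?_) (fun B hB => ?_)
      · exact MeasurableSpace.measurableSet_generateFrom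
          ⟨A, Set.univ, hA, MeasurableSet.univ, (Set.inter_univ A).symm⟩
      · exact MeasurableSpace.measurableSet_generateFrom
          ⟨Set.univ, B, MeasurableSet.univ, hB, (Set.univ_inter B).symm⟩
    · refine MeasurableSpace.generateFrom_le ?_
      rintro _ ⟨A, B, hA, hB, rfl⟩
      exact MeasurableSet.inter ((le_sup_left : m₂ ≤ m₂ ⊔ m₃) A hA)
        ((le_sup_right : m₃ ≤ m₂ ⊔ m₃) B hB)
  refine IndepSets.indep h₁ (sup_le h₂ h₃) (@MeasurableSpace.isPiSystem_measurableSet Ω m₁) hpi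
    (@MeasurableSpace.generateFrom_measurableSet Ω m₁).symm hgen ?_
  rw [IndepSets_iff]
  rintro s _ hs ⟨A, B, hA, hB, rfl⟩
  have hs' : MeasurableSet[m₁ ⊔ m₂] s := (le_sup_left : m₁ ≤ m₁ ⊔ m₂) s hs
  have hA' : MeasurableSet[m₁ ⊔ m₂] A := (le_sup_right : m₂ ≤ m₁ ⊔ m₂) A hA
  rw [Indep_iff] at h₁₂ h₁₂₃
  rw [← Set.inter_assoc, h₁₂₃ _ _ (MeasurableSet.inter hs' hA') hB, h₁₂ s A hs hA,
    h₁₂₃ A B hA' hB, mul_assoc]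

end Independence

/-! ### Centered Gaussian vectors and one Kalman step. -/

section Gaussian

/-- The continuous linear map between Euclidean spaces given by a matrix. -/
noncomputable abbrev mulVecL {a b : ℕ} (M : Matrix (Fin a) (Fin b) ℝ) :
    EuclideanSpace ℝ (Fin b) →L[ℝ] EuclideanSpace ℝ (Fin a) :=
  LinearMap.toContinuousLinearMap (Matrix.toLpLin 2 2 M)

lemma mulVecL_apply {a b : ℕ} (M : Matrix (Fin a) (Fin b) ℝ) (v : EuclideanSpace ℝ (Fin b)) :
    mulVecL M v = WithLp.toLp 2 (M *ᵥ v.ofLp) := rfl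

variable {Ω : Type*} {mΩ : MeasurableSpace Ω} {μ : Measure Ω} {n m k : ℕ}

/-- `X` is a centered Gaussian vector with covariance matrix `S`. -/
structure IsCenteredGaussian (X : Ω → EuclideanSpace ℝ (Fin k)) (S : Matrix (Fin k) (Fin k) ℝ)
    (μ : Measure Ω) : Prop where
  gaussian : HasGaussianLaw X μ
  mean : ∀ a : Fin k → ℝ, ∫ ω, a ⬝ᵥ (X ω).ofLp ∂μ = 0
  cov : ∀ a b : Fin k → ℝ,
    cov[fun ω => a ⬝ᵥ (X ω).ofLp, fun ω => b ⬝ᵥ (X ω).ofLp; μ] = a ⬝ᵥ S *ᵥ b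

lemma dotProduct_eq_inner (a : Fin k → ℝ) (v : EuclideanSpace ℝ (Fin k)) :
    a ⬝ᵥ v.ofLp = inner ℝ (WithLp.toLp 2 a) v := by
  rw [EuclideanSpace.inner_eq_star_dotProduct, star_trivial, dotProduct_comm]

lemma _root_.ProbabilityTheory.HasLaw.isCenteredGaussian {X : Ω → EuclideanSpace ℝ (Fin k)}
    {S : Matrix (Fin k) (Fin k) ℝ} (hS : S.PosSemidef)
    (hX : HasLaw X (multivariateGaussian 0 S) μ) : IsCenteredGaussian X S μ where
  gaussian := hX.hasGaussianLaw
  mean a := by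
    have h1 := hX.integral_comp (f := fun v => innerSL ℝ (WithLp.toLp 2 a) v)
      (by fun_prop)
    have h2 := IsGaussian.integral_dual (μ := multivariateGaussian 0 S)
      (innerSL ℝ (WithLp.toLp 2 a))
    rw [integral_id_multivariateGaussian, map_zero] at h2
    simp only [dotProduct_eq_inner]
    exact h1.trans h2
  cov a b := by
    simp only [dotProduct_eq_inner]
    rw [hX.covariance_fun_comp (f := fun v => inner ℝ (WithLp.toLp 2 a) v)
      (g := fun v => inner ℝ (WithLp.toLp 2 b) v) (by fun_prop) (by fun_prop),
      ← covarianceBilin_apply_eq_cov IsGaussian.memLp_two_id,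
      covarianceBilin_multivariateGaussian hS]

lemma IsCenteredGaussian.gaussian_dotProduct {X : Ω → EuclideanSpace ℝ (Fin k)}
    {S : Matrix (Fin k) (Fin k) ℝ} (h : IsCenteredGaussian X S μ) (a : Fin k → ℝ) :
    HasGaussianLaw (fun ω => a ⬝ᵥ (X ω).ofLp) μ := by
  simp only [dotProduct_eq_inner]
  exact h.gaussian.map_fun (innerSL ℝ (WithLp.toLp 2 a))

lemma IsCenteredGaussian.memLp {X : Ω → EuclideanSpace ℝ (Fin k)}
    {S : Matrix (Fin k) (Fin k) ℝ} (h : IsCenteredGaussian X S μ) (a : Fin k → ℝ) :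
    MemLp (fun ω => a ⬝ᵥ (X ω).ofLp) 2 μ :=
  (h.gaussian_dotProduct a).memLp_two

lemma measurable_dotProduct_ofLp (a : Fin k → ℝ) :
    Measurable fun v : EuclideanSpace ℝ (Fin k) => a ⬝ᵥ v.ofLp := by
  simp only [dotProduct_eq_inner]; fun_prop

lemma IsCenteredGaussian.cov_eq_zero_of_indepFun {X : Ω → EuclideanSpace ℝ (Fin n)}
    {Y : Ω → EuclideanSpace ℝ (Fin m)} {S : Matrix (Fin n) (Fin n) ℝ}
    {R : Matrix (Fin m) (Fin m) ℝ} (hX : IsCenteredGaussian X S μ)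
    (hY : IsCenteredGaussian Y R μ) (h : IndepFun X Y μ) (a : Fin n → ℝ) (b : Fin m → ℝ) :
    cov[fun ω => a ⬝ᵥ (X ω).ofLp, fun ω => b ⬝ᵥ (Y ω).ofLp; μ] = 0 :=
  IndepFun.covariance_eq_zero
    (h.comp (measurable_dotProduct_ofLp a) (measurable_dotProduct_ofLp b)) (hX.memLp a) (hY.memLp b)

/-- Covariances of linear forms in three pairwise independent centered Gaussian vectors. -/
lemma cov_linear_form [IsProbabilityMeasure μ] {X W : Ω → EuclideanSpace ℝ (Fin n)}
    {Z : Ω → EuclideanSpace ℝ (Fin m)} {SX SW : Matrix (Fin n) (Fin n) ℝ}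
    {SZ : Matrix (Fin m) (Fin m) ℝ} (hX : IsCenteredGaussian X SX μ)
    (hW : IsCenteredGaussian W SW μ) (hZ : IsCenteredGaussian Z SZ μ)
    (hXW : IndepFun X W μ) (hXZ : IndepFun X Z μ) (hWZ : IndepFun W Z μ)
    (α β α' β' : Fin n → ℝ) (γ γ' : Fin m → ℝ) :
    cov[fun ω => α ⬝ᵥ (X ω).ofLp + β ⬝ᵥ (W ω).ofLp + γ ⬝ᵥ (Z ω).ofLp,
      fun ω => α' ⬝ᵥ (X ω).ofLp + β' ⬝ᵥ (W ω).ofLp + γ' ⬝ᵥ (Z ω).ofLp; μ]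
      = α ⬝ᵥ SX *ᵥ α' + β ⬝ᵥ SW *ᵥ β' + γ ⬝ᵥ SZ *ᵥ γ' := by
  have hsplit : ∀ (f : Ω → ℝ), MemLp f 2 μ → ∀ (a b : Fin n → ℝ) (c : Fin m → ℝ),
      cov[fun ω => a ⬝ᵥ (X ω).ofLp + b ⬝ᵥ (W ω).ofLp + c ⬝ᵥ (Z ω).ofLp, f; μ]
        = cov[fun ω => a ⬝ᵥ (X ω).ofLp, f; μ] + cov[fun ω => b ⬝ᵥ (W ω).ofLp, f; μ]
          + cov[fun ω => c ⬝ᵥ (Z ω).ofLp, f; μ] := by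
    intro f hf a b c
    have h1 := covariance_add_left (μ := μ) ((hX.memLp a).add (hW.memLp b)) (hZ.memLp c) hf
    have h2 := covariance_add_left (μ := μ) (hX.memLp a) (hW.memLp b) hf
    rw [h2] at h1
    exact h1
  have hmem : MemLp (fun ω => α' ⬝ᵥ (X ω).ofLp + β' ⬝ᵥ (W ω).ofLp + γ' ⬝ᵥ (Z ω).ofLp) 2 μ :=
    ((hX.memLp α').add (hW.memLp β')).add (hZ.memLp γ')
  rw [hsplit _ hmem]
  rw [covariance_comm (fun ω => α ⬝ᵥ (X ω).ofLp), covariance_comm (fun ω => β ⬝ᵥ (W ω).ofLp),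
    covariance_comm (fun ω => γ ⬝ᵥ (Z ω).ofLp), hsplit _ (hX.memLp α), hsplit _ (hW.memLp β),
    hsplit _ (hZ.memLp γ)]
  rw [covariance_comm (fun ω => α' ⬝ᵥ (X ω).ofLp), hX.cov,
    hW.cov_eq_zero_of_indepFun hX hXW.symm, hZ.cov_eq_zero_of_indepFun hX hXZ.symm,
    hX.cov_eq_zero_of_indepFun hW hXW, covariance_comm (fun ω => β' ⬝ᵥ (W ω).ofLp), hW.cov,
    hZ.cov_eq_zero_of_indepFun hW hWZ.symm, hX.cov_eq_zero_of_indepFun hZ hXZ,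
    hW.cov_eq_zero_of_indepFun hZ hWZ, covariance_comm (fun ω => γ' ⬝ᵥ (Z ω).ofLp), hZ.cov]
  ring

/-- One step of the steady-state Kalman recursion: the next estimation error and the current
innovation are independent centered Gaussian vectors. -/
lemma kalman_step [IsProbabilityMeasure μ] {A : Matrix (Fin n) (Fin n) ℝ}
    {C : Matrix (Fin m) (Fin n) ℝ} {σw σz : ℝ} {Sig : Matrix (Fin n) (Fin n) ℝ}
    (hσz : 0 < σz) (hSig : IsDARESolution A C σw σz Sig)
    {X W : Ω → EuclideanSpace ℝ (Fin n)} {Z : Ω → EuclideanSpace ℝ (Fin m)}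
    (hX : IsCenteredGaussian X Sig μ)
    (hW : IsCenteredGaussian W (σw ^ 2 • (1 : Matrix (Fin n) (Fin n) ℝ)) μ)
    (hZ : IsCenteredGaussian Z (σz ^ 2 • (1 : Matrix (Fin m) (Fin m) ℝ)) μ)
    (hWZ : IndepFun W Z μ) (hXWZ : IndepFun X (fun ω => (W ω, Z ω)) μ)
    {X' : Ω → EuclideanSpace ℝ (Fin n)} {e : Ω → EuclideanSpace ℝ (Fin m)}
    (hX' : X' = fun ω => mulVecL (predictorMatrix A C Sig σz) (X ω) + W ω
      - mulVecL (kalmanGain A C Sig σz) (Z ω))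
    (he : e = fun ω => mulVecL C (X ω) + Z ω) :
    IsCenteredGaussian X' Sig μ ∧ IsCenteredGaussian e (innovCov C Sig σz) μ ∧
      IndepFun X' e μ := by
  have hFS := kalmanGain_mul_innovCov (A := A) (C := C) hSig.posSemidef hσz
  have hly := hSig.lyapunov hσz
  set F := kalmanGain A C Sig σz with hF
  set M := predictorMatrix A C Sig σz with hM
  have hXW : IndepFun X W μ := hXWZ.comp measurable_id measurable_fst
  have hXZ : IndepFun X Z μ := hXWZ.comp measurable_id measurable_snd
  have hjoint : HasGaussianLaw (fun ω => (X ω, (W ω, Z ω))) μ :=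
    hXWZ.hasGaussianLaw hX.gaussian (hWZ.hasGaussianLaw hW.gaussian hZ.gaussian)
  -- `(X', e)` is a linear image of a jointly Gaussian vector, hence jointly Gaussian, and
  -- independence reduces to vanishing cross-covariance.
  let L : EuclideanSpace ℝ (Fin n) × (EuclideanSpace ℝ (Fin n) × EuclideanSpace ℝ (Fin m)) →L[ℝ]
      EuclideanSpace ℝ (Fin n) × EuclideanSpace ℝ (Fin m) :=
    ((mulVecL M).comp (ContinuousLinearMap.fst ℝ _ _)
      + (ContinuousLinearMap.fst ℝ _ _).comp (ContinuousLinearMap.snd ℝ _ _)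
      - (mulVecL F).comp ((ContinuousLinearMap.snd ℝ _ _).comp
          (ContinuousLinearMap.snd ℝ _ _))).prod
      ((mulVecL C).comp (ContinuousLinearMap.fst ℝ _ _)
        + (ContinuousLinearMap.snd ℝ _ _).comp (ContinuousLinearMap.snd ℝ _ _))
  have hpair : HasGaussianLaw (fun ω => (X' ω, e ω)) μ := by
    have := hjoint.map_fun L
    rw [hX', he]
    exact this
  have hlinX : ∀ a : Fin n → ℝ, (fun ω => a ⬝ᵥ (X' ω).ofLp)
      = fun ω => (Mᵀ *ᵥ a) ⬝ᵥ (X ω).ofLp + a ⬝ᵥ (W ω).ofLp + (-(Fᵀ *ᵥ a)) ⬝ᵥ (Z ω).ofLp := by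
    intro a
    ext ω
    rw [hX']
    simp only [mulVecL_apply, WithLp.ofLp_sub, WithLp.ofLp_add, dotProduct_sub, dotProduct_add,
      Matrix.dotProduct_mulVec, Matrix.mulVec_transpose, neg_dotProduct]
    ring
  have hline : ∀ b : Fin m → ℝ, (fun ω => b ⬝ᵥ (e ω).ofLp)
      = fun ω => (Cᵀ *ᵥ b) ⬝ᵥ (X ω).ofLp + (0 : Fin n → ℝ) ⬝ᵥ (W ω).ofLp + b ⬝ᵥ (Z ω).ofLp := by
    intro b
    ext ω
    rw [he]
    simp only [mulVecL_apply, WithLp.ofLp_add, dotProduct_add, Matrix.dotProduct_mulVec,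
      Matrix.mulVec_transpose, zero_dotProduct, add_zero]
  have hint : ∀ {k : ℕ} {Y : Ω → EuclideanSpace ℝ (Fin k)} {S : Matrix (Fin k) (Fin k) ℝ},
      IsCenteredGaussian Y S μ → ∀ a : Fin k → ℝ, Integrable (fun ω => a ⬝ᵥ (Y ω).ofLp) μ :=
    fun hY a => (hY.gaussian_dotProduct a).integrable
  have hmean : ∀ (a b : Fin n → ℝ) (c : Fin m → ℝ),
      ∫ ω, (a ⬝ᵥ (X ω).ofLp + b ⬝ᵥ (W ω).ofLp + c ⬝ᵥ (Z ω).ofLp) ∂μ = 0 := by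
    intro a b c
    have h1 : Integrable (fun ω => a ⬝ᵥ (X ω).ofLp + b ⬝ᵥ (W ω).ofLp) μ :=
      (hint hX a).add (hint hW b)
    rw [integral_add h1 (hint hZ c),
      integral_add (hint hX a) (hint hW b), hX.mean, hW.mean, hZ.mean]
    simp
  have hcov := cov_linear_form hX hW hZ hXW hXZ hWZ
  have hmv : ∀ {i j : ℕ} (N : Matrix (Fin i) (Fin j) ℝ) (a : Fin i → ℝ) (v : Fin j → ℝ),
      (Nᵀ *ᵥ a) ⬝ᵥ v = a ⬝ᵥ (N *ᵥ v) := by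
    intro i j N a v
    rw [Matrix.mulVec_transpose, Matrix.dotProduct_mulVec]
  refine ⟨⟨hpair.fst, fun a => ?_, fun a b => ?_⟩, ⟨hpair.snd, fun a => ?_, fun a b => ?_⟩, ?_⟩
  · rw [hlinX]; exact hmean _ _ _
  · rw [hlinX, hlinX, hcov, neg_dotProduct, Matrix.mulVec_neg, dotProduct_neg, neg_neg, hmv, hmv]
    conv_rhs => rw [hly]
    simp only [Matrix.add_mulVec, dotProduct_add, Matrix.mulVec_mulVec, Matrix.smul_mulVec,
      Matrix.one_mulVec, Matrix.mul_assoc, Matrix.smul_mul, Matrix.one_mul,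
      Matrix.mulVec_smul, dotProduct_smul]
  · rw [hline]; exact hmean _ _ _
  · rw [hline, hline, hcov, hmv, zero_dotProduct, add_zero, innovCov]
    simp only [Matrix.add_mulVec, dotProduct_add, Matrix.mulVec_mulVec, Matrix.mul_assoc]
  · refine hpair.indepFun_of_covariance_inner fun a b => ?_
    have h1 := hlinX a.ofLp
    have h2 := hline b.ofLp
    simp only [dotProduct_eq_inner _ (X' _)] at h1
    simp only [dotProduct_eq_inner _ (e _)] at h2
    change cov[fun ω => inner ℝ (WithLp.toLp 2 a.ofLp) (X' ω),
      fun ω => inner ℝ (WithLp.toLp 2 b.ofLp) (e ω); μ] = 0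
    rw [h1, h2, hcov, hmv, Matrix.mulVec_zero, dotProduct_zero, add_zero, neg_dotProduct, hmv]
    -- The optimality of the gain: the cross-covariance of `X'` and `e` is `M Σ Cᵀ - σz² F`, which
    -- this identity annihilates.
    have h3 : M * Sig * Cᵀ = σz ^ 2 • F := by
      have h4 : F * innovCov C Sig σz = F * C * Sig * Cᵀ + σz ^ 2 • F := by
        rw [innovCov, Matrix.mul_add, Matrix.mul_smul, Matrix.mul_one]
        simp only [Matrix.mul_assoc]
      rw [hM, predictorMatrix, ← hF, Matrix.sub_mul, Matrix.sub_mul, ← hFS, h4]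
      abel
    rw [Matrix.mulVec_mulVec, Matrix.mulVec_mulVec, h3, Matrix.mulVec_mulVec,
      Matrix.mul_smul, Matrix.mul_one]
    ring

/-- A coordinate is a real centered Gaussian of variance `S i i`, whose moment generating function
is explicit. -/
lemma IsCenteredGaussian.lintegral_exp_le {X : Ω → EuclideanSpace ℝ (Fin k)}
    {S : Matrix (Fin k) (Fin k) ℝ} (h : IsCenteredGaussian X S μ) [IsProbabilityMeasure μ]
    (i : Fin k) {s : ℝ} (hs : S i i ≤ s) (θ : ℝ) :
    ∫⁻ ω, ENNReal.ofReal (Real.exp (θ * X ω i)) ∂μ ≤ ENNReal.ofReal (Real.exp (θ ^ 2 * s / 2)) := by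
  have hg := h.gaussian_dotProduct (Pi.single i 1)
  simp only [single_one_dotProduct] at hg
  have hm := h.mean (Pi.single i 1)
  simp only [single_one_dotProduct] at hm
  have hv := h.cov (Pi.single i 1) (Pi.single i 1)
  simp only [single_one_dotProduct, Matrix.mulVec_single_one, Matrix.col_apply] at hv
  rw [covariance_self hg.aemeasurable] at hv
  have hlaw := hg.map_eq_gaussianReal
  rw [hm, hv] at hlaw
  have hS : 0 ≤ S i i := by rw [← hv]; exact variance_nonneg _ _
  have hmgf : mgf (fun ω => X ω i) μ θ = Real.exp (θ ^ 2 * S i i / 2) := by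
    rw [mgf_gaussianReal hlaw, Real.coe_toNNReal _ hS]
    congr 1; ring
  -- `mgf` would have the default value `0` without integrability, but it was just computed to be
  -- positive.
  have hint : Integrable (fun ω => Real.exp (θ * X ω i)) μ := by
    by_contra hcon
    have := mgf_undef hcon
    rw [hmgf] at this
    exact (Real.exp_pos _).ne' this
  rw [← ofReal_integral_eq_lintegral_ofReal hint (Filter.Eventually.of_forall fun _ =>
    (Real.exp_pos _).le)]
  refine ENNReal.ofReal_le_ofReal ?_
  change mgf (fun ω => X ω i) μ θ ≤ _
  rw [hmgf]
  refine Real.exp_le_exp.2 ?_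
  have := mul_le_mul_of_nonneg_left hs (sq_nonneg θ)
  linarith

end Gaussian

/-! ### Gaussianity and independence of the innovations in closed loop. -/

section Innovations

variable {Ω : Type*} {n m p : ℕ}

/-- The exogenous randomness and the outputs before time `t`. -/
abbrev info (𝒱 : MeasurableSpace Ω) (y : ℕ → Ω → EuclideanSpace ℝ (Fin m)) (t : ℕ) :
    MeasurableSpace Ω :=
  𝒱 ⊔ ⨆ s ∈ Finset.range t, MeasurableSpace.comap (y s) inferInstance

/-- The index shifts because `u_t` may depend on `y_t`: at level `t` the inputs up to `u_{t-1}` are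
known, which is exactly what the regressor at time `t` requires. -/
lemma inputInfo_eq_info (𝒱 : MeasurableSpace Ω) (y : ℕ → Ω → EuclideanSpace ℝ (Fin m)) (t : ℕ) :
    inputInfo 𝒱 y t = info 𝒱 y (t + 1) := rfl

lemma info_zero (𝒱 : MeasurableSpace Ω) (y : ℕ → Ω → EuclideanSpace ℝ (Fin m)) :
    info 𝒱 y 0 = 𝒱 := by
  simp [info]

lemma info_succ (𝒱 : MeasurableSpace Ω) (y : ℕ → Ω → EuclideanSpace ℝ (Fin m)) (t : ℕ) :
    info 𝒱 y (t + 1) = info 𝒱 y t ⊔ MeasurableSpace.comap (y t) inferInstance := by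
  unfold info
  rw [Finset.range_add_one, Finset.iSup_insert, sup_assoc]
  congr 1
  exact sup_comm _ _

lemma info_mono (𝒱 : MeasurableSpace Ω) (y : ℕ → Ω → EuclideanSpace ℝ (Fin m)) :
    Monotone (info 𝒱 y) :=
  monotone_nat_of_le_succ fun t => by rw [info_succ]; exact le_sup_left

lemma measurable_output_info (𝒱 : MeasurableSpace Ω) (y : ℕ → Ω → EuclideanSpace ℝ (Fin m))
    {s t : ℕ} (h : s < t) : Measurable[info 𝒱 y t] (y s) := by
  rw [measurable_iff_comap_le]
  have h1 : MeasurableSpace.comap (y s) inferInstance ≤ info 𝒱 y (s + 1) := by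
    rw [info_succ]; exact le_sup_right
  exact h1.trans (info_mono 𝒱 y h)

/-- The sources that act before time `t`. -/
def Source.before (t : ℕ) : Set Source
  | .exo => True
  | .init => True
  | .process s => s < t
  | .meas s => s < t

/-- The σ-algebra generated by the sources acting before time `t`. -/
abbrev past (𝒱 : MeasurableSpace Ω) (x0 : Ω → EuclideanSpace ℝ (Fin n))
    (w : ℕ → Ω → EuclideanSpace ℝ (Fin n)) (z : ℕ → Ω → EuclideanSpace ℝ (Fin m)) (t : ℕ) :
    MeasurableSpace Ω :=
  ⨆ i ∈ Source.before t, sourceSigma 𝒱 x0 w z i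

variable {𝒱 : MeasurableSpace Ω} {mΩ : MeasurableSpace Ω} {μ : Measure Ω}
  {A : Matrix (Fin n) (Fin n) ℝ} {B : Matrix (Fin n) (Fin p) ℝ} {C : Matrix (Fin m) (Fin n) ℝ}
  {Sig : Matrix (Fin n) (Fin n) ℝ} {σw σz : ℝ}
  {x w : ℕ → Ω → EuclideanSpace ℝ (Fin n)} {y z : ℕ → Ω → EuclideanSpace ℝ (Fin m)}
  {u : ℕ → Ω → EuclideanSpace ℝ (Fin p)}

lemma sourceSigma_le_past (x0 : Ω → EuclideanSpace ℝ (Fin n)) {t : ℕ} {i : Source}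
    (hi : i ∈ Source.before t) : sourceSigma 𝒱 x0 w z i ≤ past 𝒱 x0 w z t :=
  le_iSup₂_of_le i hi le_rfl

lemma past_mono (x0 : Ω → EuclideanSpace ℝ (Fin n)) : Monotone (past 𝒱 x0 w z) := by
  intro s t hst
  refine iSup₂_le fun i hi => sourceSigma_le_past x0 ?_
  cases i with
  | exo => trivial
  | init => trivial
  | process r => exact lt_of_lt_of_le (show r < s from hi) hst
  | meas r => exact lt_of_lt_of_le (show r < s from hi) hst

lemma IsTrajectory.sourceSigma_le (h : IsTrajectory 𝒱 μ A B C Sig σw σz x w y z u) (i : Source) :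
    sourceSigma 𝒱 (x 0) w z i ≤ mΩ := by
  cases i with
  | exo => exact h.exo_le
  | init => exact measurable_iff_comap_le.1 h.measurable_init
  | process t => exact measurable_iff_comap_le.1 (h.measurable_process t)
  | meas t => exact measurable_iff_comap_le.1 (h.measurable_meas t)

lemma IsTrajectory.past_le (h : IsTrajectory 𝒱 μ A B C Sig σw σz x w y z u) (t : ℕ) :
    past 𝒱 (x 0) w z t ≤ mΩ :=
  iSup₂_le fun i _ => h.sourceSigma_le i

lemma IsTrajectory.state_eq (h : IsTrajectory 𝒱 μ A B C Sig σw σz x w y z u) (t : ℕ) :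
    x (t + 1) = fun ω => mulVecL A (x t ω) + mulVecL B (u t ω) + w t ω := by
  ext ω : 1
  exact WithLp.ofLp_injective 2 (h.state t ω)

lemma IsTrajectory.output_eq (h : IsTrajectory 𝒱 μ A B C Sig σw σz x w y z u) (t : ℕ) :
    y t = fun ω => mulVecL C (x t ω) + z t ω := by
  ext ω : 1
  exact WithLp.ofLp_injective 2 (h.output t ω)

lemma measurable_mulVecL_comp {a b : ℕ} (M : Matrix (Fin a) (Fin b) ℝ) {m' : MeasurableSpace Ω}
    {f : Ω → EuclideanSpace ℝ (Fin b)} (hf : Measurable[m'] f) :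
    Measurable[m'] fun ω => mulVecL M (f ω) :=
  (mulVecL M).continuous.measurable.comp hf

/-- Both claims are needed in one induction: `y_t` depends on `x_t`, the input `u_t` depends on
`y_t`, and `x_{t+1}` depends on `u_t`. -/
lemma IsTrajectory.measurable_past (h : IsTrajectory 𝒱 μ A B C Sig σw σz x w y z u) (t : ℕ) :
    Measurable[past 𝒱 (x 0) w z t] (x t) ∧ info 𝒱 y t ≤ past 𝒱 (x 0) w z t := by
  induction t with
  | zero =>
    refine ⟨?_, ?_⟩
    · rw [measurable_iff_comap_le]
      exact sourceSigma_le_past (i := .init) (x 0) trivial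
    · rw [info_zero]
      exact sourceSigma_le_past (i := .exo) (x 0) trivial
  | succ t ih =>
    have hmono := past_mono (𝒱 := 𝒱) (w := w) (z := z) (x 0) (Nat.le_succ t)
    have hx : Measurable[past 𝒱 (x 0) w z (t + 1)] (x t) := ih.1.mono hmono le_rfl
    have hw : Measurable[past 𝒱 (x 0) w z (t + 1)] (w t) := by
      rw [measurable_iff_comap_le]
      exact sourceSigma_le_past (i := .process t) (x 0) (Nat.lt_succ_self t)
    have hz : Measurable[past 𝒱 (x 0) w z (t + 1)] (z t) := by
      rw [measurable_iff_comap_le]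
      exact sourceSigma_le_past (i := .meas t) (x 0) (Nat.lt_succ_self t)
    have hy : Measurable[past 𝒱 (x 0) w z (t + 1)] (y t) := by
      rw [h.output_eq]
      exact (measurable_mulVecL_comp C hx).add hz
    have hinfo : info 𝒱 y (t + 1) ≤ past 𝒱 (x 0) w z (t + 1) := by
      rw [info_succ]
      exact sup_le (ih.2.trans hmono) (measurable_iff_comap_le.1 hy)
    have hu : Measurable[past 𝒱 (x 0) w z (t + 1)] (u t) :=
      (h.input t).mono (by rw [inputInfo_eq_info]; exact hinfo) le_rfl
    refine ⟨?_, hinfo⟩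
    rw [h.state_eq]
    exact ((measurable_mulVecL_comp A hx).add (measurable_mulVecL_comp B hu)).add hw

lemma IsTrajectory.info_le (h : IsTrajectory 𝒱 μ A B C Sig σw σz x w y z u) (t : ℕ) :
    info 𝒱 y t ≤ mΩ :=
  (h.measurable_past t).2.trans (h.past_le t)

lemma IsTrajectory.measurable_input_info (h : IsTrajectory 𝒱 μ A B C Sig σw σz x w y z u)
    {s t : ℕ} (hst : s < t) : Measurable[info 𝒱 y t] (u s) :=
  (h.input s).mono (by rw [inputInfo_eq_info]; exact info_mono 𝒱 y hst) le_rfl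

lemma IsTrajectory.measurable_predState (h : IsTrajectory 𝒱 μ A B C Sig σw σz x w y z u)
    (M : Matrix (Fin n) (Fin n) ℝ) (F : Matrix (Fin n) (Fin m) ℝ) (t : ℕ) :
    Measurable[info 𝒱 y t]
      fun ω => predState M F B (fun s => y s ω) (fun s => u s ω) t := by
  induction t with
  | zero => exact measurable_const
  | succ t ih =>
    have h1 := ih.mono (info_mono 𝒱 y (Nat.le_succ t)) le_rfl
    exact (measurable_mulVecL_comp M h1).add
      ((measurable_mulVecL_comp F (measurable_output_info 𝒱 y (Nat.lt_succ_self t))).add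
        (measurable_mulVecL_comp B (h.measurable_input_info (Nat.lt_succ_self t))))

/-- The innovation of a trajectory. -/
def innovation (A : Matrix (Fin n) (Fin n) ℝ) (B : Matrix (Fin n) (Fin p) ℝ)
    (C : Matrix (Fin m) (Fin n) ℝ) (F : Matrix (Fin n) (Fin m) ℝ)
    (y : ℕ → Ω → EuclideanSpace ℝ (Fin m)) (u : ℕ → Ω → EuclideanSpace ℝ (Fin p)) (t : ℕ) (ω : Ω) :
    EuclideanSpace ℝ (Fin m) :=
  predError (A - F * C) F B C (fun s => y s ω) (fun s => u s ω) t

lemma IsTrajectory.measurable_innovation (h : IsTrajectory 𝒱 μ A B C Sig σw σz x w y z u)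
    (F : Matrix (Fin n) (Fin m) ℝ) (t : ℕ) :
    Measurable[info 𝒱 y (t + 1)] (innovation A B C F y u t) :=
  (measurable_output_info 𝒱 y (Nat.lt_succ_self t)).sub
    (measurable_mulVecL_comp C
      ((h.measurable_predState (A - F * C) F t).mono (info_mono 𝒱 y (Nat.le_succ t)) le_rfl))

/-- The estimation error of the predictor. -/
def predStateError (A : Matrix (Fin n) (Fin n) ℝ) (B : Matrix (Fin n) (Fin p) ℝ)
    (C : Matrix (Fin m) (Fin n) ℝ) (F : Matrix (Fin n) (Fin m) ℝ)
    (x : ℕ → Ω → EuclideanSpace ℝ (Fin n)) (y : ℕ → Ω → EuclideanSpace ℝ (Fin m))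
    (u : ℕ → Ω → EuclideanSpace ℝ (Fin p)) (t : ℕ) (ω : Ω) : EuclideanSpace ℝ (Fin n) :=
  x t ω - predState (A - F * C) F B (fun s => y s ω) (fun s => u s ω) t

lemma IsTrajectory.innovation_eq (h : IsTrajectory 𝒱 μ A B C Sig σw σz x w y z u)
    (F : Matrix (Fin n) (Fin m) ℝ) (t : ℕ) :
    innovation A B C F y u t
      = fun ω => mulVecL C (predStateError A B C F x y u t ω) + z t ω := by
  ext ω : 1
  unfold innovation predError predStateError
  change y t ω - _ = _
  rw [congrFun (h.output_eq t) ω, map_sub]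
  simp only [mulVecL_apply]
  abel

/-- The input enters plant and predictor in the same way and cancels. The error recursion is driven
by noise alone, so feedback does not affect its law. -/
lemma IsTrajectory.predStateError_succ (h : IsTrajectory 𝒱 μ A B C Sig σw σz x w y z u)
    (F : Matrix (Fin n) (Fin m) ℝ) (t : ℕ) :
    predStateError A B C F x y u (t + 1)
      = fun ω => mulVecL (A - F * C) (predStateError A B C F x y u t ω) + w t ω
        - mulVecL F (z t ω) := by
  ext ω : 1
  unfold predStateError
  rw [congrFun (h.state_eq t) ω, predState, h.output t ω]
  apply WithLp.ofLp_injective 2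
  simp only [mulVecL_apply, WithLp.ofLp_sub, WithLp.ofLp_add, Matrix.mulVec_sub, Matrix.mulVec_add,
    Matrix.sub_mulVec, Matrix.mulVec_mulVec]
  abel

lemma IsTrajectory.measurable_predStateError (h : IsTrajectory 𝒱 μ A B C Sig σw σz x w y z u)
    (F : Matrix (Fin n) (Fin m) ℝ) (t : ℕ) :
    Measurable[past 𝒱 (x 0) w z t] (predStateError A B C F x y u t) :=
  (h.measurable_past t).1.sub
    ((h.measurable_predState (A - F * C) F t).mono (h.measurable_past t).2 le_rfl)

/-- Since `y_t = e_t + C x̂_t` and `x̂_t` is already known, all that is new at time `t` is the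
innovation. -/
lemma IsTrajectory.info_succ_le (h : IsTrajectory 𝒱 μ A B C Sig σw σz x w y z u)
    (F : Matrix (Fin n) (Fin m) ℝ) (t : ℕ) :
    info 𝒱 y (t + 1) ≤ MeasurableSpace.comap (innovation A B C F y u t) inferInstance
      ⊔ info 𝒱 y t := by
  rw [info_succ]
  refine sup_le le_sup_right ?_
  set m' := MeasurableSpace.comap (innovation A B C F y u t) inferInstance ⊔ info 𝒱 y t with hm'
  have h1 : Measurable[m'] (innovation A B C F y u t) :=
    (comap_measurable _).mono le_sup_left le_rfl
  have h2 : Measurable[m'] fun ω => mulVecL C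
      (predState (A - F * C) F B (fun s => y s ω) (fun s => u s ω) t) :=
    measurable_mulVecL_comp C ((h.measurable_predState (A - F * C) F t).mono le_sup_right le_rfl)
  have h3 : y t = fun ω => innovation A B C F y u t ω + mulVecL C
      (predState (A - F * C) F B (fun s => y s ω) (fun s => u s ω) t) := by
    ext ω : 1
    simp [innovation, predError, mulVecL_apply]
  rw [← measurable_iff_comap_le, h3]
  exact h1.add h2

/-- The sources at time `t` are disjoint from the earlier ones in the independent family. -/
lemma IsTrajectory.noise_step (h : IsTrajectory 𝒱 μ A B C Sig σw σz x w y z u) (t : ℕ) :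
    IndepFun (w t) (z t) μ ∧
      Indep (past 𝒱 (x 0) w z t)
        (MeasurableSpace.comap (fun ω => (w t ω, z t ω)) inferInstance) μ := by
  refine ⟨?_, ?_⟩
  · rw [IndepFun_iff_Indep]
    exact h.indep.indep (i := .process t) (j := .meas t) (by simp)
  · have hd : Disjoint (Source.before t) {Source.process t, Source.meas t} := by
      rw [Set.disjoint_right]
      rintro i (rfl | rfl) hi
      · exact lt_irrefl t hi
      · exact lt_irrefl t hi
    have h1 := indep_iSup_of_disjoint h.sourceSigma_le h.indep hd
    rw [iSup_pair] at h1
    have h2 : MeasurableSpace.comap (fun ω => (w t ω, z t ω)) inferInstance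
        = MeasurableSpace.comap (w t) inferInstance ⊔ MeasurableSpace.comap (z t) inferInstance :=
      MeasurableSpace.comap_prodMk _ _
    rw [h2]
    exact h1

/-- The estimation error is a centered Gaussian vector with covariance `Σ`, independent of the
information available to the predictor; the innovation has covariance `C Σ Cᵀ + σ_z² I` and is
independent of the past information. -/
lemma IsTrajectory.innovation_step [IsProbabilityMeasure μ]
    (h : IsTrajectory 𝒱 μ A B C Sig σw σz x w y z u) (hσz : 0 < σz)
    (hSig : IsDARESolution A C σw σz Sig) (t : ℕ)
    (hG : IsCenteredGaussian (predStateError A B C (kalmanGain A C Sig σz) x y u t) Sig μ)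
    (hI : Indep (MeasurableSpace.comap (predStateError A B C (kalmanGain A C Sig σz) x y u t)
      inferInstance) (info 𝒱 y t) μ) :
    (IsCenteredGaussian (predStateError A B C (kalmanGain A C Sig σz) x y u (t + 1)) Sig μ ∧
      Indep (MeasurableSpace.comap (predStateError A B C (kalmanGain A C Sig σz) x y u (t + 1))
        inferInstance) (info 𝒱 y (t + 1)) μ) ∧
    IsCenteredGaussian (innovation A B C (kalmanGain A C Sig σz) y u t) (innovCov C Sig σz) μ ∧
      Indep (MeasurableSpace.comap (innovation A B C (kalmanGain A C Sig σz) y u t) inferInstance)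
        (info 𝒱 y t) μ := by
  set F := kalmanGain A C Sig σz with hF
  set X := predStateError A B C F x y u t with hX
  set X' := predStateError A B C F x y u (t + 1) with hX'
  set e := innovation A B C F y u t with he
  obtain ⟨hWZ, hpast⟩ := h.noise_step t
  have hXp : Measurable[past 𝒱 (x 0) w z t] X := h.measurable_predStateError F t
  have hXm : Measurable X := hXp.mono (h.past_le t) le_rfl
  have hWZm : Measurable fun ω => (w t ω, z t ω) :=
    (h.measurable_process t).prodMk (h.measurable_meas t)
  have hX'eq : X' = fun ω => mulVecL (A - F * C) (X ω) + w t ω - mulVecL F (z t ω) :=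
    h.predStateError_succ F t
  have heeq : e = fun ω => mulVecL C (X ω) + z t ω := h.innovation_eq F t
  have hXWZ : IndepFun X (fun ω => (w t ω, z t ω)) μ := by
    rw [IndepFun_iff_Indep]
    exact indep_of_indep_of_le_left hpast (measurable_iff_comap_le.1 hXp)
  have hW1 : (σw ^ 2 • (1 : Matrix (Fin n) (Fin n) ℝ)).PosSemidef :=
    Matrix.PosSemidef.one.smul (sq_nonneg σw)
  have hZ1 : (σz ^ 2 • (1 : Matrix (Fin m) (Fin m) ℝ)).PosSemidef :=
    Matrix.PosSemidef.one.smul (sq_nonneg σz)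
  obtain ⟨hg1, hg2, hind⟩ := kalman_step hσz hSig hG ((h.law_process t).isCenteredGaussian hW1)
    ((h.law_meas t).isCenteredGaussian hZ1) hWZ hXWZ hX'eq heeq
  -- `X` is independent of the information, and the new noise is independent of both together, so
  -- the information is independent of the pair.
  have hall : Indep (info 𝒱 y t) (MeasurableSpace.comap X inferInstance
      ⊔ MeasurableSpace.comap (fun ω => (w t ω, z t ω)) inferInstance) μ := by
    refine indep_sup_right_of_indep_sup_left (h.info_le t) (measurable_iff_comap_le.1 hXm)
      (measurable_iff_comap_le.1 hWZm) hI.symm ?_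
    exact indep_of_indep_of_le_left hpast
      (sup_le (h.measurable_past t).2 (measurable_iff_comap_le.1 hXp))
  set m' := MeasurableSpace.comap X inferInstance
      ⊔ MeasurableSpace.comap (fun ω => (w t ω, z t ω)) inferInstance with hm'
  have hXm' : Measurable[m'] X := (comap_measurable _).mono le_sup_left le_rfl
  have hWZm' : Measurable[m'] fun ω => (w t ω, z t ω) :=
    (comap_measurable _).mono le_sup_right le_rfl
  have hWm' : Measurable[m'] (w t) := measurable_fst.comp hWZm'
  have hZm' : Measurable[m'] (z t) := measurable_snd.comp hWZm'
  have hX'm' : Measurable[m'] X' := by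
    rw [hX'eq]
    exact ((measurable_mulVecL_comp _ hXm').add hWm').sub (measurable_mulVecL_comp _ hZm')
  have hem' : Measurable[m'] e := by
    rw [heeq]
    exact (measurable_mulVecL_comp _ hXm').add hZm'
  have hm'le : m' ≤ mΩ :=
    sup_le (measurable_iff_comap_le.1 hXm) (measurable_iff_comap_le.1 hWZm)
  have hX'le := measurable_iff_comap_le.1 hX'm'
  have hele := measurable_iff_comap_le.1 hem'
  refine ⟨⟨hg1, ?_⟩, hg2, ?_⟩
  -- The next error is independent of `e`, and the pair is independent of the old information;
  -- regrouping makes the error independent of `e` joined with that information.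
  · refine indep_of_indep_of_le_right ?_ (h.info_succ_le F t)
    refine indep_sup_right_of_indep_sup_left (hX'le.trans hm'le) (hele.trans hm'le) (h.info_le t)
      ((IndepFun_iff_Indep _ _ _).1 hind) ?_
    exact indep_of_indep_of_le_left hall.symm (sup_le hX'le hele)
  · exact indep_of_indep_of_le_left hall.symm hele

theorem IsTrajectory.innovation_properties [IsProbabilityMeasure μ]
    (h : IsTrajectory 𝒱 μ A B C Sig σw σz x w y z u) (hσz : 0 < σz)
    (hSig : IsDARESolution A C σw σz Sig) (t : ℕ) :
    IsCenteredGaussian (innovation A B C (kalmanGain A C Sig σz) y u t) (innovCov C Sig σz) μ ∧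
      Indep (MeasurableSpace.comap (innovation A B C (kalmanGain A C Sig σz) y u t) inferInstance)
        (info 𝒱 y t) μ := by
  have key : ∀ t,
      IsCenteredGaussian (predStateError A B C (kalmanGain A C Sig σz) x y u t) Sig μ ∧
      Indep (MeasurableSpace.comap (predStateError A B C (kalmanGain A C Sig σz) x y u t)
        inferInstance) (info 𝒱 y t) μ := by
    intro t
    induction t with
    | zero =>
      -- The predictor starts at zero and `x_0` has covariance `Σ`, so the filter is stationary from
      -- the start and there is no transient.
      have e : predStateError A B C (kalmanGain A C Sig σz) x y u 0 = x 0 := by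
        ext ω : 1
        simp [predStateError, predState]
      rw [e, info_zero]
      exact ⟨h.law_init.isCenteredGaussian hSig.posSemidef,
        h.indep.indep (i := .init) (j := .exo) (by simp)⟩
    | succ t ih => exact (h.innovation_step hσz hSig t ih.1 ih.2).1
  exact (h.innovation_step hσz hSig t (key t).1 (key t).2).2

end Innovations

/-! ### Exponential supermartingale and exponential moments. -/

section Concentration

variable {Ω : Type*} {mΩ : MeasurableSpace Ω} {μ : Measure Ω}

/-- The exponential process of a martingale transform with conditionally sub-Gaussian increments
is a supermartingale started at one. -/
lemma lintegral_exp_transform_le_one [IsProbabilityMeasure μ] {ℱ : ℕ → MeasurableSpace Ω}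
    (hmono : Monotone ℱ) (hle : ∀ t, ℱ t ≤ mΩ) {f e : ℕ → Ω → ℝ} {s : ℝ}
    (hf : ∀ t, Measurable[ℱ t] (f t)) (he : ∀ t, Measurable[ℱ (t + 1)] (e t))
    (hind : ∀ t, Indep (MeasurableSpace.comap (e t) inferInstance) (ℱ t) μ)
    (hsub : ∀ t (θ : ℝ), ∫⁻ ω, ENNReal.ofReal (Real.exp (θ * e t ω)) ∂μ
      ≤ ENNReal.ofReal (Real.exp (θ ^ 2 * s / 2))) (θ : ℝ) (N : ℕ) :
    ∫⁻ ω, ENNReal.ofReal (Real.exp (∑ t ∈ Finset.range N,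
      (θ * f t ω * e t ω - θ ^ 2 * s * f t ω ^ 2 / 2))) ∂μ ≤ 1 := by
  have hZ : ∀ N, Measurable[ℱ N] fun ω => ∑ t ∈ Finset.range N,
      (θ * f t ω * e t ω - θ ^ 2 * s * f t ω ^ 2 / 2) := by
    intro N
    refine Finset.measurable_sum _ fun t ht => ?_
    have ht := Finset.mem_range.1 ht
    have h1 : Measurable[ℱ N] (f t) := (hf t).mono (hmono ht.le) le_rfl
    have h2 : Measurable[ℱ N] (e t) := (he t).mono (hmono ht) le_rfl
    exact ((h1.const_mul θ).mul h2).sub (((h1.pow_const 2).const_mul _).div_const 2)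
  induction N with
  | zero => simp
  | succ N ih =>
    set Z : Ω → ℝ := fun ω => ∑ t ∈ Finset.range N,
      (θ * f t ω * e t ω - θ ^ 2 * s * f t ω ^ 2 / 2) with hZd
    set Y : Ω → ℝ × ℝ := fun ω => (Z ω, f N ω) with hY
    have hYF : Measurable[ℱ N] Y := (hZ N).prodMk (hf N)
    have hYm : Measurable Y := hYF.mono (hle N) le_rfl
    have hem : Measurable (e N) := (he N).mono (hle _) le_rfl
    have hIF : IndepFun Y (e N) μ := by
      rw [IndepFun_iff_Indep]
      exact indep_of_indep_of_le_left (hind N).symm (measurable_iff_comap_le.1 hYF)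
    -- Conditioning is done by Fubini: `(Z, f N)` is independent of `e N`, so the former can be
    -- frozen at `q` while integrating over the latter, and the compensator cancels the sub-Gaussian
    -- factor. No bound or integrability of `f` is needed.
    set g : (ℝ × ℝ) × ℝ → ENNReal := fun q =>
      ENNReal.ofReal (Real.exp (q.1.1 + (θ * q.1.2 * q.2 - θ ^ 2 * s * q.1.2 ^ 2 / 2))) with hg
    have hgm : Measurable g := by fun_prop
    have hinner : ∀ q : ℝ × ℝ, ∫⁻ v, g (q, v) ∂(μ.map (e N))
        ≤ ENNReal.ofReal (Real.exp q.1) := by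
      intro q
      rw [lintegral_map (by fun_prop) hem]
      have e1 : ∀ ω, g (q, e N ω)
          = ENNReal.ofReal (Real.exp (q.1 - (θ * q.2) ^ 2 * s / 2))
            * ENNReal.ofReal (Real.exp ((θ * q.2) * e N ω)) := by
        intro ω
        rw [← ENNReal.ofReal_mul (Real.exp_pos _).le, ← Real.exp_add]
        simp only [hg]
        congr 2
        ring
      simp only [e1]
      rw [lintegral_const_mul _ (by fun_prop)]
      calc _ ≤ ENNReal.ofReal (Real.exp (q.1 - (θ * q.2) ^ 2 * s / 2))
            * ENNReal.ofReal (Real.exp ((θ * q.2) ^ 2 * s / 2)) := by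
            gcongr; exact hsub N _
        _ = _ := by
            rw [← ENNReal.ofReal_mul (Real.exp_pos _).le, ← Real.exp_add]
            congr 2
            ring
    calc _ = ∫⁻ ω, g (Y ω, e N ω) ∂μ := by
          refine lintegral_congr fun ω => ?_
          rw [Finset.sum_range_succ]
      _ = ∫⁻ q, g q ∂(μ.map fun ω => (Y ω, e N ω)) :=
          (lintegral_map hgm (hYm.prodMk hem)).symm
      _ = ∫⁻ q, ∫⁻ v, g (q, v) ∂(μ.map (e N)) ∂(μ.map Y) := by
          rw [(indepFun_iff_map_prod_eq_prod_map_map hYm.aemeasurable hem.aemeasurable).1 hIF,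
            lintegral_prod _ hgm.aemeasurable]
      _ ≤ ∫⁻ q, ENNReal.ofReal (Real.exp q.1) ∂(μ.map Y) := lintegral_mono hinner
      _ = ∫⁻ ω, ENNReal.ofReal (Real.exp (Z ω)) ∂μ := lintegral_map (by fun_prop) hYm
      _ ≤ 1 := ih

/-- Fernique's theorem gives a square-exponential moment, and completing the square dominates `exp
‖v‖` by it. -/
lemma exists_lintegral_exp_norm_le {k : ℕ} (S : Matrix (Fin k) (Fin k) ℝ) :
    ∃ K : ℝ, 1 ≤ K ∧ ∫⁻ v, ENNReal.ofReal (Real.exp ‖v‖) ∂(multivariateGaussian 0 S)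
      ≤ ENNReal.ofReal K := by
  obtain ⟨c, hc, hint⟩ := IsGaussian.exists_integrable_exp_sq (multivariateGaussian 0 S)
  have hle : ∀ v : EuclideanSpace ℝ (Fin k),
      Real.exp ‖v‖ ≤ Real.exp (1 / (4 * c)) * Real.exp (c * ‖v‖ ^ 2) := by
    intro v
    rw [← Real.exp_add]
    refine Real.exp_le_exp.2 ?_
    have h1 : 1 / (4 * c) + c * ‖v‖ ^ 2 - ‖v‖ = c * (‖v‖ - 1 / (2 * c)) ^ 2 := by
      field_simp; ring
    have : 0 ≤ c * (‖v‖ - 1 / (2 * c)) ^ 2 := by positivity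
    linarith
  have hint2 : Integrable (fun v => Real.exp ‖v‖) (multivariateGaussian 0 S) := by
    refine (hint.const_mul (Real.exp (1 / (4 * c)))).mono' (by fun_prop) ?_
    refine Filter.Eventually.of_forall fun v => ?_
    rw [Real.norm_of_nonneg (Real.exp_pos _).le]
    exact hle v
  refine ⟨max 1 (∫ v, Real.exp ‖v‖ ∂(multivariateGaussian 0 S)), le_max_left _ _, ?_⟩
  rw [← ofReal_integral_eq_lintegral_ofReal hint2
    (Filter.Eventually.of_forall fun _ => (Real.exp_pos _).le)]
  exact ENNReal.ofReal_le_ofReal (le_max_right _ _)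

lemma exists_event_of_lintegral_le [IsProbabilityMeasure μ] {Ψ : Ω → ENNReal} (hΨ : Measurable Ψ)
    {M δ : ℝ} (hM : 0 < M) (hδ : 0 < δ) (h : ∫⁻ ω, Ψ ω ∂μ ≤ ENNReal.ofReal M) :
    ∃ E : Set Ω, MeasurableSet E ∧ 1 - δ ≤ μ.real E ∧ ∀ ω ∈ E, Ψ ω ≤ ENNReal.ofReal (M / δ) := by
  refine ⟨{ω | Ψ ω ≤ ENNReal.ofReal (M / δ)}, measurableSet_le hΨ measurable_const, ?_,
    fun ω hω => hω⟩
  set E := {ω | Ψ ω ≤ ENNReal.ofReal (M / δ)} with hE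
  have hEm : MeasurableSet E := measurableSet_le hΨ measurable_const
  have hMδ : 0 < M / δ := div_pos hM hδ
  have h1 : μ Eᶜ ≤ ENNReal.ofReal δ := by
    calc μ Eᶜ ≤ μ {ω | ENNReal.ofReal (M / δ) ≤ Ψ ω} :=
          measure_mono fun ω hω => (not_le.1 (show ¬ Ψ ω ≤ ENNReal.ofReal (M / δ) from hω)).le
      _ ≤ (∫⁻ ω, Ψ ω ∂μ) / ENNReal.ofReal (M / δ) :=
          meas_ge_le_lintegral_div hΨ.aemeasurable (ENNReal.ofReal_pos.2 hMδ).ne'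
            ENNReal.ofReal_ne_top
      _ ≤ ENNReal.ofReal M / ENNReal.ofReal (M / δ) := by gcongr
      _ = ENNReal.ofReal δ := by
          rw [← ENNReal.ofReal_div_of_pos hMδ]
          congr 1
          field_simp
  have h2 : μ.real Eᶜ ≤ δ := ENNReal.toReal_le_of_le_ofReal hδ.le h1
  rw [probReal_compl_eq_one_sub hEm] at h2
  linarith

end Concentration

/-! ### The high-probability event. -/

section Event

variable {Ω : Type*} {n m p : ℕ}
variable {𝒱 : MeasurableSpace Ω} {mΩ : MeasurableSpace Ω} {μ : Measure Ω}
  {A : Matrix (Fin n) (Fin n) ℝ} {B : Matrix (Fin n) (Fin p) ℝ} {C : Matrix (Fin m) (Fin n) ℝ}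
  {Sig : Matrix (Fin n) (Fin n) ℝ} {σw σz : ℝ}
  {x w : ℕ → Ω → EuclideanSpace ℝ (Fin n)} {y z : ℕ → Ω → EuclideanSpace ℝ (Fin m)}
  {u : ℕ → Ω → EuclideanSpace ℝ (Fin p)}

/-- Logarithm of the self-normalized exponential process of one regressor coordinate and one
innovation coordinate. -/
noncomputable def logExpSum (A : Matrix (Fin n) (Fin n) ℝ) (B : Matrix (Fin n) (Fin p) ℝ)
    (C : Matrix (Fin m) (Fin n) ℝ) (F : Matrix (Fin n) (Fin m) ℝ) (s : ℝ)
    (y : ℕ → Ω → EuclideanSpace ℝ (Fin m)) (u : ℕ → Ω → EuclideanSpace ℝ (Fin p))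
    (h T : ℕ) (i : Fin m) (c : ArxIdx m p h) (θ : ℝ) (ω : Ω) : ℝ :=
  ∑ t ∈ Finset.Icc h T,
    (θ * regressor h (fun s => y s ω) (fun s => u s ω) t c
        * predError (A - F * C) F B C (fun s => y s ω) (fun s => u s ω) t i
      - θ ^ 2 * s * regressor h (fun s => y s ω) (fun s => u s ω) t c ^ 2 / 2)

lemma IsTrajectory.measurable_regressor (h : IsTrajectory 𝒱 μ A B C Sig σw σz x w y z u)
    {l t : ℕ} (ht : 0 < t) (c : ArxIdx m p l) :
    Measurable[info 𝒱 y t] fun ω => regressor l (fun s => y s ω) (fun s => u s ω) t c := by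
  rcases c with ⟨k, i⟩ | ⟨k, i⟩
  · exact (by fun_prop : Measurable fun v : EuclideanSpace ℝ (Fin m) => v i).comp
      (measurable_output_info 𝒱 y (s := t - 1 - k) (t := t) (by omega))
  · exact (by fun_prop : Measurable fun v : EuclideanSpace ℝ (Fin p) => v i).comp
      (h.measurable_input_info (s := t - 1 - k) (t := t) (by omega))

lemma measurable_innovation_apply (h : IsTrajectory 𝒱 μ A B C Sig σw σz x w y z u)
    (F : Matrix (Fin n) (Fin m) ℝ) (t : ℕ) (i : Fin m) :
    Measurable[info 𝒱 y (t + 1)] fun ω => innovation A B C F y u t ω i :=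
  (by fun_prop : Measurable fun v : EuclideanSpace ℝ (Fin m) => v i).comp
    (h.measurable_innovation F t)

lemma IsTrajectory.measurable_logExpSum (h : IsTrajectory 𝒱 μ A B C Sig σw σz x w y z u)
    (F : Matrix (Fin n) (Fin m) ℝ) (s : ℝ) {l : ℕ} (hl : 1 ≤ l) (T : ℕ) (i : Fin m)
    (c : ArxIdx m p l) (θ : ℝ) : Measurable (logExpSum A B C F s y u l T i c θ) := by
  refine Finset.measurable_sum _ fun t ht => ?_
  have ht := Finset.mem_Icc.1 ht
  have h1 := (h.measurable_regressor (by omega : 0 < t) c).mono (h.info_le t) le_rfl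
  have h2 := (measurable_innovation_apply h F t i).mono (h.info_le _) le_rfl
  exact ((h1.const_mul θ).mul h2).sub (((h1.pow_const 2).const_mul _).div_const 2)

lemma IsTrajectory.lintegral_logExpSum_le [IsProbabilityMeasure μ]
    (h : IsTrajectory 𝒱 μ A B C Sig σw σz x w y z u) (hσz : 0 < σz)
    (hSig : IsDARESolution A C σw σz Sig) {s : ℝ} (hs : ∀ i, innovCov C Sig σz i i ≤ s)
    {l : ℕ} (hl : 1 ≤ l) (T : ℕ) (i : Fin m) (c : ArxIdx m p l) (θ : ℝ) :
    ∫⁻ ω, ENNReal.ofReal (Real.exp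
      (logExpSum A B C (kalmanGain A C Sig σz) s y u l T i c θ ω)) ∂μ ≤ 1 := by
  set F := kalmanGain A C Sig σz with hF
  -- Zero before time `l`: the sum then runs over a full range, and measurability survives at `t =
  -- 0`, where truncated subtraction would make the regressor read `y 0`, which is not yet known.
  set f : ℕ → Ω → ℝ := fun t ω =>
    if l ≤ t then regressor l (fun s => y s ω) (fun s => u s ω) t c else 0 with hfd
  have hf : ∀ t, Measurable[info 𝒱 y t] (f t) := by
    intro t
    by_cases hlt : l ≤ t
    · simp only [hfd, hlt, if_true]
      exact h.measurable_regressor (by omega) c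
    · simp only [hfd, hlt, if_false]
      exact measurable_const
  have hprop := fun t => h.innovation_properties hσz hSig t
  have hmain := lintegral_exp_transform_le_one (info_mono 𝒱 y) h.info_le hf
    (fun t => measurable_innovation_apply h F t i)
    (fun t => indep_of_indep_of_le_left (hprop t).2 (by
      rw [← measurable_iff_comap_le]
      exact (by fun_prop : Measurable fun v : EuclideanSpace ℝ (Fin m) => v i).comp
        (comap_measurable _)))
    (fun t θ => (hprop t).1.lintegral_exp_le i (hs i) θ) θ (T + 1)
  refine le_trans (le_of_eq (lintegral_congr fun ω => ?_)) hmain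
  congr 2
  have hI : Finset.Icc l T = (Finset.range (T + 1)).filter (l ≤ ·) := by
    ext t
    simp only [Finset.mem_Icc, Finset.mem_filter, Finset.mem_range]
    omega
  unfold logExpSum
  rw [hI, Finset.sum_filter]
  refine Finset.sum_congr rfl fun t _ => ?_
  by_cases hlt : l ≤ t
  · simp only [hfd, hlt, if_true]; rfl
  · simp [hfd, hlt]

lemma le_log_of_ofReal_exp_le {a b : ℝ} (hb : 0 < b)
    (h : ENNReal.ofReal (Real.exp a) ≤ ENNReal.ofReal b) : a ≤ Real.log b := by
  rw [Real.le_log_iff_exp_le hb]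
  exact (ENNReal.ofReal_le_ofReal_iff hb.le).1 h

/-- With high probability, all noise vectors and all logarithmic exponential processes are
bounded by a logarithm. -/
lemma exists_noise_event (n m p : ℕ) (Sig : Matrix (Fin n) (Fin n) ℝ) (σw σz : ℝ) :
    ∃ K : ℝ, 1 ≤ K ∧
    ∀ {A : Matrix (Fin n) (Fin n) ℝ} {B : Matrix (Fin n) (Fin p) ℝ} {C : Matrix (Fin m) (Fin n) ℝ}
      {s : ℝ}, 0 < σz → IsDARESolution A C σw σz Sig → (∀ i, innovCov C Sig σz i i ≤ s) →
    ∀ (T l : ℕ) (δ θ : ℝ), 1 ≤ l → 0 < δ →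
    ∀ {Ω : Type*} {𝒱 : MeasurableSpace Ω} {mΩ : MeasurableSpace Ω} {μ : Measure Ω}
      [IsProbabilityMeasure μ] {x w : ℕ → Ω → EuclideanSpace ℝ (Fin n)}
      {y z : ℕ → Ω → EuclideanSpace ℝ (Fin m)} {u : ℕ → Ω → EuclideanSpace ℝ (Fin p)},
      IsTrajectory 𝒱 μ A B C Sig σw σz x w y z u →
    ∃ E : Set Ω, MeasurableSet[mΩ] E ∧ 1 - δ ≤ μ.real E ∧ ∀ ω ∈ E, ∀ ℓ : ℝ,
      Real.log ((K * (2 * T + 3) + 2 * (m * (l * m + l * p))) / δ) ≤ ℓ →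
      ‖x 0 ω‖ ≤ ℓ ∧ (∀ t ≤ T, ‖w t ω‖ ≤ ℓ) ∧ (∀ t ≤ T, ‖z t ω‖ ≤ ℓ) ∧
      ∀ (i : Fin m) (c : ArxIdx m p l) (θ' : ℝ), θ' = θ ∨ θ' = -θ →
        logExpSum A B C (kalmanGain A C Sig σz) s y u l T i c θ' ω ≤ ℓ := by
  obtain ⟨K₁, hK₁, hb₁⟩ := exists_lintegral_exp_norm_le Sig
  obtain ⟨K₂, hK₂, hb₂⟩ :=
    exists_lintegral_exp_norm_le (σw ^ 2 • (1 : Matrix (Fin n) (Fin n) ℝ))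
  obtain ⟨K₃, hK₃, hb₃⟩ :=
    exists_lintegral_exp_norm_le (σz ^ 2 • (1 : Matrix (Fin m) (Fin m) ℝ))
  refine ⟨K₁ + K₂ + K₃, by linarith, ?_⟩
  intro A B C s hσz hSig hs T l δ θ hl hδ Ω 𝒱 mΩ μ _ x w y z u h
  set K := K₁ + K₂ + K₃ with hK
  have hmono : ∀ K' : ℝ, K' ≤ K → ENNReal.ofReal K' ≤ ENNReal.ofReal K :=
    fun K' hK' => ENNReal.ofReal_le_ofReal hK'
  set F := kalmanGain A C Sig σz with hF
  set a : Ω → ENNReal := fun ω => ENNReal.ofReal (Real.exp ‖x 0 ω‖) with ha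
  set b : ℕ → Ω → ENNReal := fun t ω => ENNReal.ofReal (Real.exp ‖w t ω‖) with hb
  set d : ℕ → Ω → ENNReal := fun t ω => ENNReal.ofReal (Real.exp ‖z t ω‖) with hd
  set q : ℝ → Fin m × ArxIdx m p l → Ω → ENNReal := fun θ ic ω =>
    ENNReal.ofReal (Real.exp (logExpSum A B C F s y u l T ic.1 ic.2 θ ω)) with hq
  have hxm := h.measurable_init
  have hwm := h.measurable_process
  have hzm := h.measurable_meas
  have ham : Measurable a := by fun_prop
  have hbm : ∀ t, Measurable (b t) := fun t => by fun_prop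
  have hdm : ∀ t, Measurable (d t) := fun t => by fun_prop
  have hqm : ∀ θ ic, Measurable (q θ ic) := fun θ ic =>
    ENNReal.measurable_ofReal.comp (Real.measurable_exp.comp
      (h.measurable_logExpSum F s hl T ic.1 ic.2 θ))
  have hai : ∫⁻ ω, a ω ∂μ ≤ ENNReal.ofReal K := by
    refine le_trans (le_of_eq ?_) (hb₁.trans (hmono K₁ (by linarith)))
    exact h.law_init.lintegral_comp (f := fun v => ENNReal.ofReal (Real.exp ‖v‖)) (by fun_prop)
  have hbi : ∀ t, ∫⁻ ω, b t ω ∂μ ≤ ENNReal.ofReal K := fun t => by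
    refine le_trans (le_of_eq ?_) (hb₂.trans (hmono K₂ (by linarith)))
    exact (h.law_process t).lintegral_comp (f := fun v => ENNReal.ofReal (Real.exp ‖v‖))
      (by fun_prop)
  have hdi : ∀ t, ∫⁻ ω, d t ω ∂μ ≤ ENNReal.ofReal K := fun t => by
    refine le_trans (le_of_eq ?_) (hb₃.trans (hmono K₃ (by linarith)))
    exact (h.law_meas t).lintegral_comp (f := fun v => ENNReal.ofReal (Real.exp ‖v‖))
      (by fun_prop)
  have hqi : ∀ θ ic, ∫⁻ ω, q θ ic ω ∂μ ≤ 1 := fun θ ic =>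
    h.lintegral_logExpSum_le hσz hSig hs hl T ic.1 ic.2 θ
  -- Summing all exponentials replaces a union bound: one application of Markov's inequality to `Ψ`
  -- bounds every summand. There are `2 * T + 3` noise norms and two signs for each of the `m * (l *
  -- m + l * p)` coordinate pairs.
  set Ψ : Ω → ENNReal := fun ω => (a ω + ∑ t ∈ Finset.range (T + 1), (b t ω + d t ω))
    + ∑ ic, (q θ ic ω + q (-θ) ic ω) with hΨ
  have hs1 : Measurable fun ω => ∑ t ∈ Finset.range (T + 1), (b t ω + d t ω) :=
    Finset.measurable_sum _ fun t _ => (hbm t).add (hdm t)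
  have hs2 : Measurable fun ω => ∑ ic, (q θ ic ω + q (-θ) ic ω) :=
    Finset.measurable_sum _ fun ic _ => (hqm θ ic).add (hqm (-θ) ic)
  have hΨm : Measurable Ψ := (ham.add hs1).add hs2
  set M : ℝ := K * (2 * T + 3) + 2 * (m * (l * m + l * p)) with hM
  have hM0 : 0 < M := by
    have : 0 < K := by linarith
    positivity
  have hΨi : ∫⁻ ω, Ψ ω ∂μ ≤ ENNReal.ofReal M := by
    have e1 : ∫⁻ ω, ∑ t ∈ Finset.range (T + 1), (b t ω + d t ω) ∂μ
        = ∑ t ∈ Finset.range (T + 1), ∫⁻ ω, (b t ω + d t ω) ∂μ :=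
      lintegral_finsetSum _ fun t _ => (hbm t).add (hdm t)
    have e2 : ∫⁻ ω, ∑ ic, (q θ ic ω + q (-θ) ic ω) ∂μ
        = ∑ ic, ∫⁻ ω, (q θ ic ω + q (-θ) ic ω) ∂μ :=
      lintegral_finsetSum _ fun ic _ => (hqm θ ic).add (hqm (-θ) ic)
    rw [lintegral_add_right _ hs2, lintegral_add_right _ hs1, e1, e2]
    have i1 : ∑ t ∈ Finset.range (T + 1), ∫⁻ ω, (b t ω + d t ω) ∂μ
        ≤ ∑ _t ∈ Finset.range (T + 1), (ENNReal.ofReal K + ENNReal.ofReal K) :=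
      Finset.sum_le_sum fun t _ => by
        rw [lintegral_add_right _ (hdm t)]; exact add_le_add (hbi t) (hdi t)
    have i2 : ∑ ic, ∫⁻ ω, (q θ ic ω + q (-θ) ic ω) ∂μ
        ≤ ∑ _ic : Fin m × ArxIdx m p l, (1 + 1 : ENNReal) :=
      Finset.sum_le_sum fun ic _ => by
        rw [lintegral_add_right _ (hqm _ ic)]; exact add_le_add (hqi _ ic) (hqi _ ic)
    refine (add_le_add (add_le_add hai i1) i2).trans (le_of_eq ?_)
    have hK0 : 0 ≤ K := by linarith
    rw [Finset.sum_const, Finset.sum_const, ← ENNReal.ofReal_add hK0 hK0, ← ENNReal.ofReal_one,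
      ← ENNReal.ofReal_add zero_le_one zero_le_one, ← ENNReal.ofReal_nsmul,
      ← ENNReal.ofReal_nsmul, ← ENNReal.ofReal_add hK0 (by positivity),
      ← ENNReal.ofReal_add (by positivity) (by positivity)]
    congr 1
    simp only [Finset.card_range, Finset.card_univ, Fintype.card_prod, Fintype.card_sum,
      Fintype.card_fin, nsmul_eq_mul, hM]
    push_cast
    ring
  obtain ⟨E, hE, hEμ, hEb⟩ := exists_event_of_lintegral_le hΨm hM0 hδ hΨi
  refine ⟨E, hE, hEμ, fun ω hω ℓ hℓ => ?_⟩
  have hMδ : 0 < M / δ := div_pos hM0 hδ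
  have hfin : ∀ r : ℝ, ENNReal.ofReal (Real.exp r) ≤ Ψ ω → r ≤ ℓ := fun r hr =>
    (le_log_of_ofReal_exp_le hMδ (hr.trans (hEb ω hω))).trans hℓ
  have hbt : ∀ t ≤ T, b t ω + d t ω ≤ Ψ ω := fun t ht =>
    (Finset.single_le_sum (f := fun t => b t ω + d t ω) (fun _ _ => zero_le)
      (Finset.mem_range.2 (Nat.lt_succ_of_le ht))).trans (le_add_self.trans le_self_add)
  have hqt : ∀ ic, q θ ic ω + q (-θ) ic ω ≤ Ψ ω := fun ic =>
    (Finset.single_le_sum (f := fun ic => q θ ic ω + q (-θ) ic ω) (fun _ _ => zero_le)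
      (Finset.mem_univ ic)).trans le_add_self
  refine ⟨hfin _ (le_self_add.trans le_self_add), fun t ht => hfin _ (le_self_add.trans (hbt t ht)),
    fun t ht => hfin _ (le_add_self.trans (hbt t ht)), ?_⟩
  rintro i c θ' (rfl | rfl)
  · exact hfin _ (le_self_add.trans (hqt (i, c)))
  · exact hfin _ (le_add_self.trans (hqt (i, c)))

end Event

/-! ### Bookkeeping of constants and logarithms. -/

section Constants

/-- The lower bound on the number of lags, exponentiated; the factor `√m ≥ 1` is dropped. This is
what keeps the accumulated truncation bias bounded. -/
lemma pow_mul_sq_le_of_log_div_log_le {υ cH lam : ℝ} {m T h : ℕ} (hυ0 : 0 < υ) (hυ1 : υ < 1)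
    (hcH : 0 < cH) (hlam : 0 < lam) (hm : 1 ≤ m) (hT : 1 ≤ T)
    (hh : Real.log (cH * (T : ℝ) ^ 2 * √(m : ℝ) / √lam) / Real.log (1 / υ) ≤ h) :
    υ ^ h * (T : ℝ) ^ 2 ≤ √lam / cH := by
  have hT0 : (0 : ℝ) < T := by exact_mod_cast hT
  have hm1 : 1 ≤ √(m : ℝ) := Real.one_le_sqrt.2 (by exact_mod_cast hm)
  have hl : 0 < √lam := Real.sqrt_pos.2 hlam
  have hm0 : 0 < √(m : ℝ) := by linarith
  have hlog : 0 < Real.log (1 / υ) := Real.log_pos (by rw [lt_div_iff₀ hυ0]; linarith)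
  rw [div_le_iff₀ hlog, ← Real.log_pow, Real.log_le_log_iff (by positivity) (by positivity),
    one_div, inv_pow, le_inv_comm₀ (by positivity) (by positivity), inv_div,
    le_div_iff₀ (by positivity)] at hh
  rw [le_div_iff₀ hcH]
  calc υ ^ h * (T : ℝ) ^ 2 * cH ≤ υ ^ h * (T : ℝ) ^ 2 * cH * √(m : ℝ) :=
        le_mul_of_one_le_right (by positivity) hm1
    _ = υ ^ h * (cH * (T : ℝ) ^ 2 * √(m : ℝ)) := by ring
    _ ≤ √lam := hh

/-- With `r = T / δ`, both `T` and `1 / δ` are at most `r`, and `h` is at most `cE * r` since `1 +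
log r ≤ r`. So the argument of the logarithm is at most a constant times `r * r`. -/
lemma exists_log_le_mul_log (m p : ℕ) {K cE : ℝ} (hK : 1 ≤ K) (hcE : 0 ≤ cE) :
    ∃ c : ℝ, 1 ≤ c ∧ ∀ (T h : ℕ) (δ : ℝ), 1 ≤ T → 0 < δ → δ < 1 →
      (h : ℝ) ≤ cE * (1 + Real.log (T / δ)) →
      Real.log ((K * (2 * T + 3) + 2 * (m * (h * m + h * p))) / δ)
        ≤ c * (1 + Real.log (T / δ)) := by
  set c₃ : ℝ := 5 * K + 2 * (m * (m + p)) * cE with hc₃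
  have hc₃0 : 0 < c₃ := by positivity
  refine ⟨2 + |Real.log c₃|, by linarith [abs_nonneg (Real.log c₃)], ?_⟩
  intro T h δ hT hδ0 hδ1 hh
  have hTr : (1 : ℝ) ≤ T := by exact_mod_cast hT
  set r : ℝ := T / δ with hr
  have hr1 : 1 ≤ r := by rw [hr, le_div_iff₀ hδ0]; linarith
  have hδr : 1 / δ ≤ r := by rw [hr]; gcongr
  have hTr' : (T : ℝ) ≤ r := by rw [hr, le_div_iff₀ hδ0]; nlinarith
  have hlog0 : 0 ≤ Real.log r := Real.log_nonneg hr1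
  have hLr : 1 + Real.log r ≤ r := by linarith [Real.log_le_sub_one_of_pos (by linarith : 0 < r)]
  have hnum : K * (2 * T + 3) + 2 * (m * (h * m + h * p)) ≤ c₃ * r := by
    have h1 : K * (2 * T + 3) ≤ 5 * K * r := by nlinarith
    have h2 : (h : ℝ) ≤ cE * r := hh.trans (mul_le_mul_of_nonneg_left hLr hcE)
    have h3 : 2 * ((m : ℝ) * (h * m + h * p)) ≤ 2 * (m * (m + p)) * (cE * r) := by
      calc _ = 2 * ((m : ℝ) * (m + p)) * h := by ring
        _ ≤ _ := mul_le_mul_of_nonneg_left h2 (by positivity)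
    rw [hc₃]; linarith
  have hquot : (K * (2 * T + 3) + 2 * (m * (h * m + h * p))) / δ ≤ c₃ * (r * r) := by
    rw [div_eq_mul_one_div, show c₃ * (r * r) = c₃ * r * r by ring]
    exact mul_le_mul hnum hδr (by positivity) (by positivity)
  calc _ ≤ Real.log (c₃ * (r * r)) := Real.log_le_log (by positivity) hquot
    _ = Real.log c₃ + 2 * Real.log r := by
        rw [Real.log_mul hc₃0.ne' (by positivity), Real.log_mul (by positivity) (by positivity)]
        ring
    _ ≤ (2 + |Real.log c₃|) * (1 + Real.log r) := by
        nlinarith [le_abs_self (Real.log c₃), abs_nonneg (Real.log c₃),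
          mul_nonneg (abs_nonneg (Real.log c₃)) hlog0]

/-- From the entrywise score bound to the rate of the ridge estimate. -/
lemma mul_sq_score_le {m p d h T : ℕ} {σs cE L K c : ℝ} {q : ℕ} (hσs : 0 < σs)
    (hL : 0 ≤ L) (hK : 0 ≤ K) (hT : 1 ≤ T) (hdh : d ≤ h) (hh : (h : ℝ) ≤ cE * L) :
    (d : ℝ) * ((m * (h * m + h * p)) *
        (2 * (√(T : ℝ) * (K * (2 * (c * L ^ (q + 1)) ^ 2))) / (σs ^ 2 * T)) ^ 2)
      ≤ (4 * cE * (m + p + 1) * K * c ^ 2 / σs ^ 2 * L ^ (2 * q + 3) / √(T : ℝ)) ^ 2 := by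
  have hT0 : (0 : ℝ) < T := by exact_mod_cast hT
  have hs0 : 0 < √(T : ℝ) := Real.sqrt_pos.2 hT0
  have hdh' : (d : ℝ) ≤ h := by exact_mod_cast hdh
  have hss : (T : ℝ) = √(T : ℝ) * √(T : ℝ) := (Real.mul_self_sqrt hT0.le).symm
  set X : ℝ := 4 * K * c ^ 2 / σs ^ 2 * L ^ (2 * q + 2) / √(T : ℝ) with hX
  have h1 : 2 * (√(T : ℝ) * (K * (2 * (c * L ^ (q + 1)) ^ 2))) / (σs ^ 2 * T) = X := by
    rw [hX]
    nth_rewrite 2 [hss]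
    field_simp
    ring
  have hX0 : 0 ≤ X := by positivity
  -- The number of entries times the Hankel multiplicity is quadratic in `h`; after the square root
  -- it costs one extra factor `L`.
  have h2 : (d : ℝ) * (m * (h * m + h * p)) ≤ (cE * L * (m + p + 1)) ^ 2 := by
    calc (d : ℝ) * (m * (h * m + h * p)) ≤ h * (m * (h * m + h * p)) := by gcongr
      _ = h ^ 2 * (m * (m + p)) := by ring
      _ ≤ h ^ 2 * (m + p + 1) ^ 2 := by
          gcongr
          have := Nat.cast_nonneg (α := ℝ) m
          have := Nat.cast_nonneg (α := ℝ) p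
          nlinarith
      _ ≤ (cE * L) ^ 2 * (m + p + 1) ^ 2 := by gcongr
      _ = _ := by ring
  rw [h1, ← mul_assoc]
  calc _ ≤ (cE * L * (m + p + 1)) ^ 2 * X ^ 2 := by gcongr
    _ = _ := by rw [hX]; ring

end Constants

end LTI

/-! ### Assembly of the main theorem. -/

theorem mainTheorem2 {n m p : ℕ}
    (A : Matrix (Fin n) (Fin n) ℝ) (B : Matrix (Fin n) (Fin p) ℝ) (C : Matrix (Fin m) (Fin n) ℝ)
    (σw σz : ℝ) (hσw : 0 < σw) (hσz : 0 < σz)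
    (Sig : Matrix (Fin n) (Fin n) ℝ) (hSig : IsDARESolution A C σw σz Sig)
    (hAB : IsControllable A B) (hAC : IsObservable A C)
    (hAF : IsControllable A (kalmanGain A C Sig σz))
    (hA : IsSchurStable A) (lam : ℝ) (hlam : 0 < lam) :
    (∃ υ : ℝ, 0 < υ ∧ υ < 1 ∧ IsSimilarToContraction (predictorMatrix A C Sig σz) υ) ∧
    ∀ υ : ℝ, 0 < υ → υ < 1 → IsSimilarToContraction (predictorMatrix A C Sig σz) υ →
    ∀ (σs cH cE κ : ℝ) (q : ℕ), 0 < σs → 0 < cH → 0 < cE → 0 ≤ κ →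
    ∃ (K : ℝ) (k : ℕ), 0 < K ∧
    ∀ (δ : ℝ) (T d₁ d₂ : ℕ), 0 < δ → δ < 1 →
      -- `T` is large enough
      K * (1 + Real.log (T / δ)) ^ k ≤ √(T : ℝ) →
      -- choice of the Hankel sizes and of the number of lags `d₁ + d₂ + 1`
      n ≤ d₁ → n ≤ d₂ →
      Real.log (cH * (T : ℝ) ^ 2 * √(m : ℝ) / √lam) / Real.log (1 / υ) ≤ (d₁ + d₂ + 1 : ℕ) →
      ((d₁ + d₂ + 1 : ℕ) : ℝ) ≤ cE * (1 + Real.log (T / δ)) →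
    ∀ (Ω : Type*) (𝒱 : MeasurableSpace Ω) [mΩ : MeasurableSpace Ω] (μ : Measure Ω)
      [IsProbabilityMeasure μ] (x w : ℕ → Ω → EuclideanSpace ℝ (Fin n))
      (y z : ℕ → Ω → EuclideanSpace ℝ (Fin m)) (u : ℕ → Ω → EuclideanSpace ℝ (Fin p)),
      IsTrajectory 𝒱 μ A B C Sig σw σz x w y z u →
    ∃ E : Set Ω, MeasurableSet[mΩ] E ∧ 1 - δ ≤ μ.real E ∧ ∀ ω ∈ E,
      PersistentlyExciting (d₁ + d₂ + 1) lam σs (fun t => y t ω) (fun t => u t ω) T →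
      (∀ t < T, ‖u t ω‖ ≤ κ * (1 + Real.log (T / δ)) ^ q) →
      ∀ (Ghat : Matrix (Fin m) (ArxIdx m p (d₁ + d₂ + 1)) ℝ)
        (Ahat : Matrix (Fin n) (Fin n) ℝ) (Bhat : Matrix (Fin n) (Fin p) ℝ)
        (Chat : Matrix (Fin m) (Fin n) ℝ),
        IsRidgeEstimate (d₁ + d₂ + 1) lam (fun t => y t ω) (fun t => u t ω) T Ghat →
        IsSysIdOutput d₁ d₂ Ghat Ahat Bhat Chat →
        (∃ S : Matrix (Fin n) (Fin n) ℝ, IsUnit S.det ∧ ‖S‖ ≤ K ∧ ‖S⁻¹‖ ≤ K ∧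
          ‖Ahat - S⁻¹ * A * S‖ ≤ K * (1 + Real.log (T / δ)) ^ k / √(T : ℝ) ∧
          ‖Bhat - S⁻¹ * B‖ ≤ K * (1 + Real.log (T / δ)) ^ k / √(T : ℝ) ∧
          ‖Chat - C * S‖ ≤ K * (1 + Real.log (T / δ)) ^ k / √(T : ℝ)) ∧
        ∀ H : ℕ, ‖markovMatrix Ahat Bhat Chat H - markovMatrix A B C H‖
          ≤ K * (1 + Real.log (T / δ)) ^ k / √(T : ℝ) := by
  refine ⟨hSig.exists_contraction hσw hσz, ?_⟩
  intro υ hυ0 hυ1 hυ σs cH cE κ q hσs hcH hcE hκ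
  set F := kalmanGain A C Sig σz with hF
  obtain ⟨cυ, hcυ0, hcυ⟩ := hυ.exists_norm_pow_le
  obtain ⟨a₁, ha₁⟩ := exists_sum_norm_pow_le_of_geometric hυ0.le hυ1 hcυ
  obtain ⟨a₂, ha₂⟩ := hA.exists_sum_norm_pow_le
  have haM : ∀ N, ∑ k ∈ Finset.range N, ‖(A - F * C) ^ k‖ ≤ max a₁ a₂ :=
    fun N => (ha₁ N).trans (le_max_left _ _)
  have haA : ∀ N, ∑ k ∈ Finset.range N, ‖A ^ k‖ ≤ max a₁ a₂ :=
    fun N => (ha₂ N).trans (le_max_right _ _)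
  set s : ℝ := ∑ i, |innovCov C Sig σz i i| with hs
  have hs0 : 0 ≤ s := Finset.sum_nonneg fun _ _ => abs_nonneg _
  have hsi : ∀ i, innovCov C Sig σz i i ≤ s := fun i => (le_abs_self _).trans
    (Finset.single_le_sum (f := fun i => |innovCov C Sig σz i i|) (fun _ _ => abs_nonneg _)
      (Finset.mem_univ i))
  have hcb0 : 0 ≤ cυ * (√lam / cH) := by positivity
  obtain ⟨K₁, hK₁, hscore⟩ :=
    exists_score_bound (A - F * C) F B C A hs0 hlam.le hcb0 haM haA
  obtain ⟨K₂, hK₂, hsys⟩ := sysId_perturbation A B C F hAC hAF haM haA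
  obtain ⟨K₃, hK₃, hevent⟩ := exists_noise_event n m p Sig σw σz
  obtain ⟨cℓ, hcℓ, hlog⟩ := exists_log_le_mul_log m p hK₃ hcE.le
  -- Chosen so that `c * L ^ (q + 1)` dominates both the noise level `cℓ * L` and the input bound `κ
  -- * L ^ q`.
  set c : ℝ := cℓ + κ with hc
  set K' : ℝ := 4 * cE * (m + p + 1) * K₁ * c ^ 2 / σs ^ 2 with hK'
  have hK'0 : 0 ≤ K' := by positivity
  have hKpos : 0 < K₂ * K' + K₂ := by positivity
  -- `K₂ * K'` carries the rate, and the extra `K₂` bounds `S` and its inverse. The exponent is `2 *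
  -- (q + 1)` from the squared signal bound plus one from the number of lags.
  refine ⟨K₂ * K' + K₂, 2 * q + 3, hKpos, ?_⟩
  intro δ T d₁ d₂ hδ0 hδ1 hTlarge hd₁ hd₂ hh₁ hh₂ Ω 𝒱 mΩ μ _ x w y z u htraj
  -- For `T = 0` the conventions `log 0 = 0` and `√0 = 0` turn the size condition into the
  -- contradiction `K ≤ 0`.
  have hT : 1 ≤ T := by
    rcases Nat.eq_zero_or_pos T with rfl | hT
    · simp at hTlarge; linarith
    · exact hT
  set h := d₁ + d₂ + 1 with hh
  have hh1 : 1 ≤ h := by omega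
  set L : ℝ := 1 + Real.log (T / δ) with hL
  have hT0 : (0 : ℝ) < T := by exact_mod_cast hT
  have hTr : (1 : ℝ) ≤ T := by exact_mod_cast hT
  have hsq0 : 0 < √(T : ℝ) := Real.sqrt_pos.2 hT0
  have hL1 : 1 ≤ L := by
    have : 0 ≤ Real.log (T / δ) := Real.log_nonneg (by rw [le_div_iff₀ hδ0]; linarith)
    linarith
  have hL0 : 0 ≤ L := by linarith
  set η : ℝ := K' * L ^ (2 * q + 3) / √(T : ℝ) with hη
  have hη0 : 0 ≤ η := by positivity
  have hKη : K₂ * η ≤ (K₂ * K' + K₂) * L ^ (2 * q + 3) / √(T : ℝ) := by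
    rw [hη, ← mul_div_assoc, ← mul_assoc]
    gcongr
    linarith
  -- The requirement that `T` be large is exactly the smallness condition of the perturbation
  -- theorem.
  have hKη1 : K₂ * η ≤ 1 := hKη.trans (by rwa [div_le_one hsq0])
  obtain ⟨E, hE, hEμ, hEb⟩ :=
    hevent hσz hSig hsi T h δ (√(T : ℝ))⁻¹ hh1 hδ0 htraj
  refine ⟨E, hE, hEμ, fun ω hω hpe hu Gh Ah Bh Ch hridge hout => ?_⟩
  obtain ⟨hx0, hw, hz, hexp⟩ := hEb ω hω (cℓ * L) (hlog T h δ hT hδ0 hδ1 hh₂)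
  set ρ : ℝ := c * L ^ (q + 1) with hρ
  have hpow1 : 1 ≤ L ^ q := one_le_pow₀ hL1
  have hcℓρ : cℓ * L ≤ ρ := by
    rw [hρ, hc, pow_succ]
    exact mul_le_mul (by linarith) (le_mul_of_one_le_left hL0 hpow1) hL0 (by positivity)
  have hκρ : κ * L ^ q ≤ ρ := by
    rw [hρ, hc]
    exact mul_le_mul (by linarith) (pow_le_pow_right₀ hL1 (Nat.le_succ q)) (by positivity)
      (by positivity)
  have hℓ0 : 0 ≤ cℓ * L := by positivity
  have hρ1 : 1 ≤ ρ := le_trans (one_le_mul_of_one_le_of_one_le hcℓ hL1) hcℓρ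
  have hb : ∀ i c, |∑ t ∈ Finset.Icc h T,
      (y t ω i - ((C * extCtrb h (A - F * C) F B) *ᵥ
        regressor h (fun t => y t ω) (fun t => u t ω) t) i)
        * regressor h (fun t => y t ω) (fun t => u t ω) t c
      - lam * (C * extCtrb h (A - F * C) F B) i c| ≤ √(T : ℝ) * (K₁ * (2 * ρ ^ 2)) := by
    intro i c
    have hm : 1 ≤ m := Nat.one_le_of_lt i.2
    have hMh : ‖(A - F * C) ^ h‖ * (T : ℝ) ^ 2 ≤ cυ * (√lam / cH) := by
      calc ‖(A - F * C) ^ h‖ * (T : ℝ) ^ 2 ≤ cυ * υ ^ h * (T : ℝ) ^ 2 :=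
            mul_le_mul_of_nonneg_right (hcυ h) (by positivity)
        _ = cυ * (υ ^ h * (T : ℝ) ^ 2) := by ring
        _ ≤ _ := mul_le_mul_of_nonneg_left
            (pow_mul_sq_le_of_log_div_log_le hυ0 hυ1 hcH hlam hm hT hh₁) hcυ0
    refine (hscore T h ρ (cℓ * L) (fun t => x t ω) (fun t => w t ω) (fun t => y t ω)
      (fun t => z t ω) (fun t => u t ω) hT hh1 hρ1 hℓ0 (fun t => htraj.state t ω)
      (fun t => htraj.output t ω) (hx0.trans hcℓρ) (fun t ht => (hw t ht).trans hcℓρ)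
      (fun t ht => (hz t ht).trans hcℓρ) (fun t ht => (hu t ht).trans hκρ) i c hMh
      (fun θ hθ => hexp i c θ hθ)).trans ?_
    gcongr
    nlinarith
  have hfrob := frobSq_sub_le_of_isRidgeEstimate hσs hT hpe hridge hb
  have hη2 : (d₁ : ℝ) * frobSq (Gh - C * extCtrb h (A - F * C) F B) ≤ η ^ 2 :=
    (mul_le_mul_of_nonneg_left hfrob (Nat.cast_nonneg d₁)).trans
      (mul_sq_score_le hσs hL0 hK₁ hT (by omega) hh₂)
  obtain ⟨⟨S, hS, hS1, hS2, e1, e2, e3⟩, hmark⟩ :=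
    hsys d₁ d₂ hd₁ hd₂ Gh η hη0 hKη1 hη2 Ah Bh Ch hout
  have hKK : K₂ ≤ K₂ * K' + K₂ := by linarith [mul_nonneg (by linarith : 0 ≤ K₂) hK'0]
  exact ⟨⟨S, hS, hS1.trans hKK, hS2.trans hKK, e1.trans hKη, e2.trans hKη, e3.trans hKη⟩,
    fun H => (hmark H).trans hKη⟩
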